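/- **Definitions.** A disjunctive program $\Pi$ is a finite set of rules $r=\; a_1\vee\cdots\vee a_\ell\leftarrow a_{\ell+1},\ldots,a_m,\neg a_{m+1},\ldots,\neg a_n$ with distinct atoms $a_1,\dots,a_n$ ($0\le\ell\le m\le n$); write $H_r=\{a_1,\dots,a_\ell\}$, $B_r^+=\{a_{\ell+1},\dots,a_m\}$, $B_r^-=\{a_{m+1},\dots,a_n\}$, $\mathrm{at}(r)=H_r\cup B_r^+\cup B_r^-$ and $\mathrm{at}(\Pi)=\bigcup_{r\in\Pi}\mathrm{at}(r)$. A set $I$ of atoms satisfies $r$ if $(H_r\cup B_r^-)\cap I\neq\emptyset$ or $B_r^+\setminus I\ne\emptyset$. The set $I$ is an answer set of $\Pi$ if it is a subset-minimal model of the reduct $\Pi^I$, which is obtained from $\Pi$ by deleting all rules $r$ with $B_r^-\cap I\ne\emptyset$ and deleting the negated atoms from the remaining rules; $\Pi$ is consistent if it has an answer set. The incidence graph $\mathcal I_\Pi$ has as vertices the atoms and the rules of $\Pi$, and an edge $\{a,r\}$ whenever $a\in\mathrm{at}(r)$. An almost-paths graph is a disjoint union of paths in which every path vertex may additionally have one neighbour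 of degree $1$. The distance to almost paths of a finite graph is the least number of vertices whose removal yields an almost-paths graph. An input program is given as a list of its rules without repetition, with the atoms named $0,\dots,|\mathrm{at}(\Pi)|-1$ and the indices of the atoms written in unary; 3-CNF formulas are given in the same way (clauses with at most three literals, variables named $0,\dots,n-1$, where $n$ is the number of variables that occur). Time is the number of steps of a deterministic multi-stack Turing machine. The Exponential Time Hypothesis (ETH) states that there is no machine that decides the satisfiability of 3-CNF formulas with $n$ variables in time $2^{o(n)}\cdot\mathrm{poly}(n)$. **Theorem.** Assume ETH. Then no machine decides, given a disjunctive program $\Pi$, whether $\Pi$ is consistent in time $$2^{2^{o(k)}}\cdot\mathrm{poly}(|\mathrm{at}(\Pi)|),$$ where $k$ is the distance to almost paths of $\mathcal I_\Pi$; that is, there are no machine, function $f:\mathbb N\to\mathbb R$ with $f(k)=o(k)$ and polynomial $p$ such that the machine decides every $\Pi$ correctly within $2^{2^{f(k)}}\cdot p(|\mathrm{at}(\Pi)|)$ steps. Moreover, there is a constant $c$ such that the same holds if the inputs are restricted to those programs $\Pi$ for which some set $S$ of exactly $k$ vertices has the property that $\mathcal I_\Pi-S$ is an almost-paths graph in which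 every path has length (number of edges) at most $c\cdot k$. -/

import Mathlib

open Filter Asymptotics

namespace ASP

/-! ### Deciding a problem in a given time

The machine model is Mathlib's multi-stack Turing machine `Turing.FinTM2` (finitely many stacks,
labels and internal states); time is the number of machine steps. -/

/-- The machine `M` decides the property `ans` on all instances `x ∈ C`, started on any of the
strings `codes x` that represent `x`, and it halts after at most `T x` steps. -/
def DecidesInTime {X Γ : Type} (M : Turing.TM2ComputableAux Γ Bool)
    (codes : X → Set (List Γ)) (C : Set X) (ans : X → Prop) (T : X → ℝ) : Prop :=
  ∀ x ∈ C, ∀ w ∈ codes x, ∃ (b : Bool) (t : ℕ), (b = true ↔ ans x) ∧ (t : ℝ) ≤ T x ∧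
    Nonempty (Turing.TM2OutputsInTime M.tm (w.map M.inputAlphabet.symm)
      (some ([b].map M.outputAlphabet.symm)) t)

/-! ### 3-SAT and the Exponential Time Hypothesis -/

/-- A clause over variables from `ℕ`: the disjunction of the variables in `pos` and of the
negations of the variables in `neg`. -/
@[ext]
structure Clause where
  pos : Finset ℕ
  neg : Finset ℕ

/-- The variables of a clause. -/
def Clause.vars (c : Clause) : Finset ℕ := c.pos ∪ c.neg

/-- A propositional formula in CNF, as a finite set of clauses. -/
abbrev CNF : Type := Finset Clause

/-- The variables occurring in a formula. -/
def CNF.vars (F : CNF) : Finset ℕ := F.biUnion Clause.vars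

/-- The formula has a satisfying assignment. -/
def CNF.Satisfiable (F : CNF) : Prop :=
  ∃ τ : ℕ → Prop, ∀ c ∈ F, (∃ x ∈ c.pos, τ x) ∨ (∃ x ∈ c.neg, ¬ τ x)

/-- The instances of 3-SAT: every clause has at most three literals, and the variables that occur
are named `0, …, n - 1`, where `n` is their number. -/
def threeCNF : Set CNF :=
  {F | (∀ c ∈ F, c.pos.card + c.neg.card ≤ 3) ∧ ∃ n, F.vars = Finset.range n}

/-- The alphabet for writing down formulas. -/
inductive CNFSymbol
  | clause | pos | neg | one

/-- The string of a clause: a start mark, followed by its literals, each one written as a sign and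
the index of its variable in unary. -/
def Clause.code (c : Clause) : List CNFSymbol :=
  .clause ::
    ((c.pos.sort (· ≤ ·)).flatMap (fun x => .pos :: List.replicate x .one) ++
     (c.neg.sort (· ≤ ·)).flatMap (fun x => .neg :: List.replicate x .one))

/-- The strings that represent a formula: its clauses, written one after the other in any order,
each of them once. -/
def CNF.codes (F : CNF) : Set (List CNFSymbol) :=
  {w | ∃ L : List Clause, L.Nodup ∧ (∀ c, c ∈ L ↔ c ∈ F) ∧ w = L.flatMap Clause.code}

/-- The Exponential Time Hypothesis: satisfiability of 3-CNF formulas with `n` variables cannot be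
decided in time `2 ^ o(n) * poly(n)`. -/
def ETH : Prop :=
  ¬ ∃ (M : Turing.TM2ComputableAux CNFSymbol Bool) (f : ℕ → ℝ) (p : Polynomial ℕ),
    f =o[atTop] (fun n : ℕ => (n : ℝ)) ∧
    DecidesInTime M CNF.codes threeCNF CNF.Satisfiable
      (fun F => (2 : ℝ) ^ f F.vars.card * (p.eval F.vars.card : ℕ))

/-! ### Disjunctive programs -/

/-- A disjunctive rule `a₁ ∨ ⋯ ∨ a_ℓ ← a_{ℓ+1}, …, a_m, ¬ a_{m+1}, …, ¬ a_n` with distinct atoms,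
where `head = {a₁, …, a_ℓ}`, `pos = {a_{ℓ+1}, …, a_m}` and `neg = {a_{m+1}, …, a_n}`. -/
@[ext]
structure Rule (α : Type) where
  head : Finset α
  pos : Finset α
  neg : Finset α
  head_pos : Disjoint head pos
  head_neg : Disjoint head neg
  pos_neg : Disjoint pos neg

/-- A disjunctive program, as a finite set of rules. -/
abbrev Program (α : Type) : Type := Finset (Rule α)

section

variable {α : Type}

/-- The atoms of a rule. -/
def Rule.atoms [DecidableEq α] (r : Rule α) : Finset α := r.head ∪ r.pos ∪ r.neg

/-- The atoms of a program. -/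
def Program.atoms [DecidableEq α] (P : Program α) : Finset α := P.biUnion Rule.atoms

/-- The interpretation `I` satisfies the rule `r`. -/
def Rule.SatisfiedBy (r : Rule α) (I : Set α) : Prop :=
  (∃ a ∈ I, a ∈ r.head ∨ a ∈ r.neg) ∨ ∃ a ∈ r.pos, a ∉ I

/-- The interpretation `I` is a model of the set `R` of rules. -/
def IsModel (R : Set (Rule α)) (I : Set α) : Prop := ∀ r ∈ R, r.SatisfiedBy I

/-- The rule without its negated atoms. -/
def Rule.dropNeg (r : Rule α) : Rule α where
  head := r.head
  pos := r.pos
  neg := ∅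
  head_pos := r.head_pos
  head_neg := Finset.disjoint_empty_right _
  pos_neg := Finset.disjoint_empty_right _

/-- The Gelfond-Lifschitz reduct of `P` under `I`. -/
def Program.reduct (P : Program α) (I : Set α) : Set (Rule α) :=
  {r' | ∃ r ∈ P, (∀ a ∈ r.neg, a ∉ I) ∧ r' = r.dropNeg}

/-- `I` is an answer set of `P`: a subset-minimal model of the reduct of `P` under `I`. -/
def Program.IsAnswerSet (P : Program α) (I : Set α) : Prop :=
  Minimal (IsModel (P.reduct I)) I

/-- A program is consistent if it has an answer set. -/
def Program.Consistent (P : Program α) : Prop := ∃ I : Set α, P.IsAnswerSet I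

/-- The incidence graph: its vertices are the atoms and the rules of the program, and an atom is
adjacent to the rules it occurs in. -/
def Program.incidenceGraph [DecidableEq α] (P : Program α) :
    SimpleGraph ({a // a ∈ P.atoms} ⊕ {r // r ∈ P}) where
  Adj
    | .inl a, .inr r => a.1 ∈ r.1.atoms
    | .inr r, .inl a => a.1 ∈ r.1.atoms
    | _, _ => False
  symm := ⟨by rintro (a | r) (b | s) h <;> exact h⟩
  loopless := ⟨by rintro (a | r) h <;> exact h⟩

end

/-! ### Distance to almost paths -/

/-- A graph is an *almost-paths* graph if it is a disjoint union of paths (the subgraph induced by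
`P`, which is acyclic with all degrees at most two), where in addition every vertex of `P` may have
one neighbour of degree one outside of `P`. -/
def IsAlmostPaths {V : Type} (G : SimpleGraph V) : Prop :=
  ∃ P : Set V, (G.induce P).IsAcyclic ∧
    (∀ v ∈ P, (G.neighborSet v ∩ P).encard ≤ 2) ∧
    (∀ v ∈ P, (G.neighborSet v \ P).encard ≤ 1) ∧
    (∀ v ∉ P, ∃ u ∈ P, G.neighborSet v = {u})

/-- The graph obtained from `G` by removing the vertices in `S`. -/
abbrev removeVertices {V : Type} (G : SimpleGraph V) (S : Finset V) :
    SimpleGraph ((S : Set V)ᶜ : Set V) :=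
  G.induce ((S : Set V)ᶜ)

/-- The distance to almost paths of a finite graph: the least number of vertices whose removal
yields an almost-paths graph. -/
noncomputable def distAlmostPaths {V : Type} (G : SimpleGraph V) : ℕ :=
  sInf {k | ∃ S : Finset V, S.card = k ∧ IsAlmostPaths (removeVertices G S)}

/-- All paths in `G` have length at most `l`. -/
def PathLengthLE {V : Type} (G : SimpleGraph V) (l : ℕ) : Prop :=
  ∀ (u v : V) (q : G.Walk u v), q.IsPath → q.length ≤ l

/-- The distance to almost paths of the incidence graph of a program. -/
noncomputable def Program.dist (P : Program ℕ) : ℕ := distAlmostPaths P.incidenceGraph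

/-! ### Deciding consistency -/

/-- The instances of the consistency problem: programs whose atoms are named `0, …, n - 1`, where
`n` is the number of atoms. -/
def programs : Set (Program ℕ) := {P | ∃ n, P.atoms = Finset.range n}

/-- The instances for which some smallest set of vertices whose removal from the incidence graph
yields an almost-paths graph leaves only paths of length at most `c * k`, where `k` is the size of
that set, i.e. the distance to almost paths. -/
def shortPathPrograms (c : ℕ) : Set (Program ℕ) :=
  {P | P ∈ programs ∧ ∃ S, S.card = P.dist ∧
    IsAlmostPaths (removeVertices P.incidenceGraph S) ∧
    PathLengthLE (removeVertices P.incidenceGraph S) (c * P.dist)}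

/-- The alphabet for writing down programs. -/
inductive ProgramSymbol
  | rule | head | pos | neg | one

/-- The string of a rule: a start mark, followed by its atoms, each one written as a mark for the
part of the rule it occurs in and its index in unary. -/
def Rule.code (r : Rule ℕ) : List ProgramSymbol :=
  .rule ::
    ((r.head.sort (· ≤ ·)).flatMap (fun a => .head :: List.replicate a .one) ++
     (r.pos.sort (· ≤ ·)).flatMap (fun a => .pos :: List.replicate a .one) ++
     (r.neg.sort (· ≤ ·)).flatMap (fun a => .neg :: List.replicate a .one))

/-- The strings that represent a program: its rules, written one after the other in any order, each
of them once. -/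
def Program.codes (P : Program ℕ) : Set (List ProgramSymbol) :=
  {w | ∃ L : List (Rule ℕ), L.Nodup ∧ (∀ r, r ∈ L ↔ r ∈ P) ∧ w = L.flatMap Rule.code}

/-- Consistency of the programs in `C` can be decided in time `2 ^ (2 ^ o(k)) * poly(|at(P)|)`,
where `k` is the distance to almost paths of the incidence graph of the program `P`. -/
def ConsistencyInDoubleExpTime (C : Set (Program ℕ)) : Prop :=
  ∃ (M : Turing.TM2ComputableAux ProgramSymbol Bool) (f : ℕ → ℝ) (p : Polynomial ℕ),
    f =o[atTop] (fun k : ℕ => (k : ℝ)) ∧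
    DecidesInTime M Program.codes C Program.Consistent
      (fun P => (2 : ℝ) ^ ((2 : ℝ) ^ f P.dist) * (p.eval P.atoms.card : ℕ))

end ASP

/-! ### Semantics: saturation expresses an exists-forall statement by consistency -/

namespace ASP

/-! ### Disjunctive programs that encode a quantified formula by saturation -/

/-! A 3-CNF formula with `n` variables is turned in polynomial time into an equivalent program whose
distance to almost paths is exactly `k = 7 + 4 * a`, where `a` is the bit length of the length of
the input string. A repetition-free 3-CNF has a string of length at most `3 * (n + 1) ^ 7`
(`length_le_of_mem_codes`), so `k = O(log n)`. For `f(k) = o(k)` the number `2 ^ f(k)` is then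
`O(√n)`, hence `o(n)` (`maxExp_isLittleO`), and a decider running in time `2 ^ (2 ^ o(k))` times a
polynomial would contradict ETH.

Such a compression is possible because consistency expresses a statement "there is an assignment of
the existential variables such that every assignment of the universal variables makes some term
true" by saturation (`Saturates.consistent_iff`). The existential variables, of which there are
polynomially many, hold an assignment `x` of the formula and, for every clause, the position of a
literal claimed to be true. The `3 + 2 * a` universal variables hold a challenge: a clause index
`j`, a position, a sign `s` and a variable index `i`, read as "the literal selected in clause `j`
stands at this position, it is the literal with sign `s` and variable `i`, and it is false". The
terms are the possible rebuttals: there is no clause `j`; another position is selected; the literal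
at this position has another sign or another index; the value of `x` at `i` is `s`. All challenges
can be rebutted iff every selected literal is true (`consistent_reduction_iff`).

Clauses and variables communicate only through binary indices in the universal variables, so that no
term contains more than one existential literal, and every existential literal lies in a single
term. After removal of the atom `0` and of the universal literals, which are `7 + 4 * a` atoms, what
remains consists of pieces of paths term, literal, guess, literal, term, of length four
(`pathsAbove_reduction`). No smaller set suffices: each removed atom has four rules of its own,
while degrees in an almost-paths graph are at most three (`card_le_of_stars`).

That the reduction is computable by a machine is shown with a small structured language on stacks.
Its programs are compiled to machine code and prefixed to the given decider (`preMachine_outputs`),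
and the calculus `Does` tracks their effect together with polynomial bounds on time and space
(`does_reductionProg`). -/

/-- The atom of the literal that gives the variable `z` the value `b`. -/
def litAtom (z : ℕ) (b : Bool) : ℕ := 1 + 2 * z + b.toNat

theorem litAtom_inj {z z' : ℕ} {b b' : Bool} (h : litAtom z b = litAtom z' b') :
    z = z' ∧ b = b' := by
  cases b <;> cases b' <;> simp [litAtom] at h ⊢ <;> omega

theorem exists_litAtom {n : ℕ} (hn : n ≠ 0) : ∃ z b, n = litAtom z b := by
  rcases Nat.even_or_odd' (n - 1) with ⟨z, h | h⟩
  · exact ⟨z, false, by simp [litAtom]; omega⟩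
  · exact ⟨z, true, by simp [litAtom]; omega⟩

/-- The rules of `P` encode, by saturation of the atom `0`, the statement that some assignment to
the variables `D ≤ z < Z` makes every assignment to the variables `z < D` satisfy one of the sets of
literals in `terms`. -/
structure Saturates (P : Program ℕ) (D Z : ℕ) (terms : Set (Set ℕ)) : Prop where
  guess : ∀ z < Z, ∃ r ∈ P, (∀ a, a ∈ r.head ↔ a = litAtom z false ∨ a = litAtom z true) ∧
    r.pos = ∅ ∧ r.neg = ∅
  saturate : ∀ z < D, ∀ b, ∃ r ∈ P, r.head = {litAtom z b} ∧ r.pos = {0} ∧ r.neg = ∅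
  constr : ∃ r ∈ P, r.head = ∅ ∧ r.pos = ∅ ∧ r.neg = {0}
  term : ∀ T ∈ terms, ∃ r ∈ P, r.head = {0} ∧ (r.pos : Set ℕ) = T ∧ r.neg = ∅
  rules : ∀ r ∈ P,
    (∃ z < Z, ∀ b, litAtom z b ∈ r.head) ∨
    (0 ∈ r.pos ∧ r.head.Nonempty ∧ ∀ a ∈ r.head, a < 2 * D + 1) ∨
    (r.head = {0} ∧ (r.pos : Set ℕ) ∈ terms ∧ r.neg = ∅) ∨ ∃ a ∈ r.neg, a < 2 * D + 1
  lits : ∀ T ∈ terms, ∀ a ∈ T, ∃ z < Z, ∃ b, a = litAtom z b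

variable {P : Program ℕ} {D Z : ℕ} {terms : Set (Set ℕ)}

/-- The answer set is the saturated set: the atom `0`, both literals of every universal variable,
and the literals of `ξ`. A smaller model `J` of the reduct still picks a literal of every variable.
If it contains `0`, the saturation rules force everything else; if not, its choices form an
assignment `η`, and the rule of a term true under `η` derives `0`. -/
theorem Saturates.consistent (h : Saturates P D Z terms) (ξ : ℕ → Bool)
    (hξ : ∀ η : ℕ → Bool, (∀ z ≥ D, η z = ξ z) →
      ∃ T ∈ terms, ∀ a ∈ T, ∃ z, a = litAtom z (η z)) : P.Consistent := by
  set I : Set ℕ := {a | a < 2 * D + 1 ∨ ∃ z, D ≤ z ∧ z < Z ∧ a = litAtom z (ξ z)} with hI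
  have hhigh : ∀ z, D ≤ z → z < Z → ∀ b, litAtom z b ∈ I → b = ξ z := by
    rintro z hz - b (hb | ⟨z', hz', -, hb⟩)
    · simp [litAtom] at hb; omega
    · obtain ⟨rfl, rfl⟩ := litAtom_inj hb; rfl
  have hmem : ∀ z < Z, litAtom z (ξ z) ∈ I := by
    intro z hz
    by_cases hD : D ≤ z
    · exact Or.inr ⟨z, hD, hz, rfl⟩
    · left; cases ξ z <;> simp [litAtom] <;> omega
  refine ⟨I, ?_, ?_⟩
  · rintro _ ⟨r, hr, hneg, rfl⟩
    rcases h.rules r hr with ⟨z, hz, hb⟩ | ⟨-, ⟨a, ha⟩, hlt⟩ | ⟨hh, -, -⟩ | ⟨a, ha, hlt⟩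
    · exact Or.inl ⟨_, hmem z hz, Or.inl (hb _)⟩
    · exact Or.inl ⟨a, Or.inl (hlt a ha), Or.inl ha⟩
    · exact Or.inl ⟨0, Or.inl (by omega), Or.inl (by simp [Rule.dropNeg, hh])⟩
    -- All atoms below `2 * D + 1` are in `I`, so rules that negate one of them vanish from the
    -- reduct. Padding rules of this kind are therefore harmless.
    · exact absurd (Or.inl hlt) (hneg a ha)
  · intro J hJ hJI
    have hguess : ∀ z < Z, ∃ b, litAtom z b ∈ J := by
      intro z hz
      obtain ⟨r, hr, h1, h2, h3⟩ := h.guess z hz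
      rcases hJ r.dropNeg ⟨r, hr, by simp [h3], rfl⟩ with ⟨a, haJ, ha⟩ | ⟨a, ha, -⟩
      · rcases ha with ha | ha
        · rcases (h1 a).1 ha with rfl | rfl
          exacts [⟨_, haJ⟩, ⟨_, haJ⟩]
        · simp [Rule.dropNeg] at ha
      · simp [Rule.dropNeg, h2] at ha
    have hex : ∀ z, D ≤ z → z < Z → litAtom z (ξ z) ∈ J := by
      intro z hD hz
      obtain ⟨b, hb⟩ := hguess z hz
      rwa [← hhigh z hD hz b (hJI hb)]
    by_cases h0 : 0 ∈ J
    · rintro a (ha | ⟨z, hD, hz, rfl⟩)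
      · rcases eq_or_ne a 0 with rfl | hne
        · exact h0
        obtain ⟨z, b, rfl⟩ := exists_litAtom hne
        obtain ⟨r, hr, h1, h2, h3⟩ := h.saturate z (by simp [litAtom] at ha; omega) b
        rcases hJ r.dropNeg ⟨r, hr, by simp [h3], rfl⟩ with ⟨c, hcJ, hc⟩ | ⟨c, hc, hcJ⟩
        · simp [Rule.dropNeg, h1] at hc
          exact hc ▸ hcJ
        · simp [Rule.dropNeg, h2] at hc
          exact absurd h0 (hc ▸ hcJ)
      · exact hex z hD hz
    · exfalso
      choose! g hg using hguess
      -- `J` may contain both literals of a universal variable; any choice `g` will do, as the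
      -- bodies of the term rules are monotone.
      obtain ⟨T, hT, hTl⟩ := hξ (fun z => if z < D then g z else ξ z) (by
        intro z hz; rw [if_neg (by omega)])
      obtain ⟨r, hr, h1, h2, h3⟩ := h.term T hT
      rcases hJ r.dropNeg ⟨r, hr, by simp [h3], rfl⟩ with ⟨c, hcJ, hc⟩ | ⟨c, hc, hcJ⟩
      · simp [Rule.dropNeg, h1] at hc
        exact h0 (hc ▸ hcJ)
      · have hcT : c ∈ T := by rw [← h2]; exact hc
        obtain ⟨z, rfl⟩ := hTl c hcT
        obtain ⟨z', hz', b', he⟩ := h.lits T hT _ hcT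
        obtain ⟨rfl, -⟩ := litAtom_inj he
        apply hcJ
        by_cases hD : z < D
        · rw [if_pos hD]; exact hg z hz'
        · rw [if_neg hD]; exact hex z (by omega) hz'

/-- The constraint puts `0` into an answer set `I`, hence `I` is saturated, and `ξ` is read off its
existential literals. If some `η` made every term false, the literals of `η` alone would be a model
of the reduct inside `I` that lacks `0`, against minimality. -/
theorem Saturates.exists_of_consistent (h : Saturates P D Z terms) (hP : P.Consistent) :
    ∃ ξ : ℕ → Bool, ∀ η : ℕ → Bool, (∀ z ≥ D, η z = ξ z) →
      ∃ T ∈ terms, ∀ a ∈ T, ∃ z, a = litAtom z (η z) := by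
  classical
  obtain ⟨I, hI, hmin⟩ := hP
  have h0 : 0 ∈ I := by
    by_contra h0
    obtain ⟨r, hr, h1, h2, h3⟩ := h.constr
    rcases hI r.dropNeg ⟨r, hr, by simp [h3, h0], rfl⟩ with ⟨a, -, ha⟩ | ⟨a, ha, -⟩
    · simp [Rule.dropNeg, h1] at ha
    · simp [Rule.dropNeg, h2] at ha
  have hsat : ∀ z < D, ∀ b, litAtom z b ∈ I := by
    intro z hz b
    obtain ⟨r, hr, h1, h2, h3⟩ := h.saturate z hz b
    rcases hI r.dropNeg ⟨r, hr, by simp [h3], rfl⟩ with ⟨c, hc, hc'⟩ | ⟨c, hc, hc'⟩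
    · simp [Rule.dropNeg, h1] at hc'
      exact hc' ▸ hc
    · simp [Rule.dropNeg, h2] at hc
      exact absurd h0 (hc ▸ hc')
  have hlow : ∀ a < 2 * D + 1, a ∈ I := by
    intro a ha
    rcases eq_or_ne a 0 with rfl | hne
    · exact h0
    obtain ⟨z, b, rfl⟩ := exists_litAtom hne
    exact hsat z (by simp [litAtom] at ha; omega) b
  -- Should both literals of a variable be in `I`, the value `true` is taken; all that matters is
  -- that the literals of `η` lie in `I`.
  refine ⟨fun z => decide (litAtom z true ∈ I), fun η hη => ?_⟩
  by_contra! hno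
  have hηI : ∀ z < Z, litAtom z (η z) ∈ I := by
    intro z hz
    by_cases hD : z < D
    · exact hsat z hD _
    rw [hη z (by omega)]
    by_cases ht : litAtom z true ∈ I
    · simp [ht]
    obtain ⟨r, hr, h1, h2, h3⟩ := h.guess z hz
    rcases hI r.dropNeg ⟨r, hr, by simp [h3], rfl⟩ with ⟨a, haI, ha⟩ | ⟨a, ha, -⟩
    · rcases ha with ha | ha
      · rcases (h1 a).1 ha with rfl | rfl
        · simpa [ht] using haI
        · exact absurd haI ht
      · simp [Rule.dropNeg] at ha
    · simp [Rule.dropNeg, h2] at ha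
  have hJ : IsModel (P.reduct I) {a | ∃ z < Z, a = litAtom z (η z)} := by
    rintro _ ⟨r, hr, hneg, rfl⟩
    rcases h.rules r hr with ⟨z, hz, hb⟩ | ⟨hz, -⟩ | ⟨hh, hT, -⟩ | ⟨a, ha, hlt⟩
    · exact Or.inl ⟨_, ⟨z, hz, rfl⟩, Or.inl (hb _)⟩
    · refine Or.inr ⟨0, hz, ?_⟩
      rintro ⟨z, -, hz⟩
      simp [litAtom] at hz
      omega
    · obtain ⟨a, ha, hne⟩ := hno _ hT
      exact Or.inr ⟨a, ha, fun ⟨z, _, hz⟩ => hne z hz⟩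
    · exact absurd (hlow a hlt) (hneg a ha)
  obtain ⟨z, -, hz⟩ := hmin hJ (by rintro _ ⟨z, hz, rfl⟩; exact hηI z hz) h0
  simp [litAtom] at hz
  omega

theorem Saturates.consistent_iff (h : Saturates P D Z terms) :
    P.Consistent ↔ ∃ ξ : ℕ → Bool, ∀ η : ℕ → Bool, (∀ z ≥ D, η z = ξ z) →
      ∃ T ∈ terms, ∀ a ∈ T, ∃ z, a = litAtom z (η z) :=
  ⟨h.exists_of_consistent, fun ⟨ξ, hξ⟩ => h.consistent ξ hξ⟩

end ASP

/-! ### Graph theory: almost paths from ranks, lower bounds from stars -/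

namespace ASP

/-! ### Graphs in which every vertex has at most one neighbour of higher rank -/

section Ranked

variable {V : Type} {G : SimpleGraph V} {rank : V → ℕ}

/-- On a cycle, both neighbours of a vertex of least rank have higher rank, so they coincide. -/
theorem isAcyclic_of_rank (hne : ∀ u v, G.Adj u v → rank u ≠ rank v)
    (huniq : ∀ u v w, G.Adj u v → G.Adj u w → rank u < rank v → rank u < rank w → v = w) :
    G.IsAcyclic := by
  classical
  intro v c hc
  obtain ⟨u, hu, hmin⟩ := c.support.toFinset.exists_min_image rank ⟨v, by simp⟩
  rw [List.mem_toFinset] at hu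
  have hc' := hc.rotate hu
  have hlt : ∀ w, G.Adj u w → w ∈ (c.rotate u hu).support → rank u < rank w := by
    intro w huw hw
    refine lt_of_le_of_ne (hmin w ?_) (hne u w huw)
    rw [List.mem_toFinset]
    exact (c.mem_support_rotate_iff u hu).1 hw
  have h1 := (c.rotate u hu).adj_snd hc'.not_nil
  have h2 := ((c.rotate u hu).adj_penultimate hc'.not_nil).symm
  exact hc'.snd_ne_penultimate (huniq u _ _ h1 h2 (hlt _ h1 (SimpleGraph.Walk.getVert_mem_support _ _))
    (hlt _ h2 (SimpleGraph.Walk.getVert_mem_support _ _)))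

/-- A path that has stepped down cannot turn upwards again: the only higher neighbour of the current
vertex is the one it came from. So the rank drops in every further step. -/
theorem length_le_of_rank_descends (hne : ∀ u v, G.Adj u v → rank u ≠ rank v)
    (huniq : ∀ u v w, G.Adj u v → G.Adj u w → rank u < rank v → rank u < rank w → v = w)
    {v t : V} (q : G.Walk v t) :
    ∀ {u : V} (h : G.Adj u v), (SimpleGraph.Walk.cons h q).IsPath → rank v < rank u →
      q.length + 1 ≤ rank u := by
  induction q with
  | nil => intro u _ _ hlt; simp; omega
  | @cons v w t h' q ih =>
    intro u h hp hlt
    have hvw : rank w < rank v := by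
      rcases lt_trichotomy (rank w) (rank v) with hl | he | hg
      · exact hl
      · exact absurd he.symm (hne _ _ h')
      · have huw := huniq v u w h.symm h' hlt hg
        subst huw
        simp [SimpleGraph.Walk.cons_isPath_iff] at hp
    have := ih h' hp.of_cons hvw
    simp only [SimpleGraph.Walk.length_cons]
    omega

/-- Every path climbs first and descends afterwards, and each of the two phases has at most `R`
steps. -/
theorem pathLengthLE_of_rank {R : ℕ} (hR : ∀ v, rank v ≤ R)
    (hne : ∀ u v, G.Adj u v → rank u ≠ rank v)
    (huniq : ∀ u v w, G.Adj u v → G.Adj u w → rank u < rank v → rank u < rank w → v = w) :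
    PathLengthLE G (2 * R) := by
  have key : ∀ (u v : V) (q : G.Walk u v), q.IsPath → q.length + rank u ≤ 2 * R := by
    intro u v q
    induction q with
    | @nil u => intro _; have := hR u; simp; omega
    | @cons u v w h q ih =>
      intro hp
      rcases lt_or_gt_of_ne (hne _ _ h) with hlt | hgt
      · have := ih hp.of_cons
        simp only [SimpleGraph.Walk.length_cons]
        omega
      · have := length_le_of_rank_descends hne huniq q h hp hgt
        have := hR u
        simp only [SimpleGraph.Walk.length_cons]
        omega
  intro u v q hq
  have := key u v q hq
  omega

end Ranked

/-! ### Bounds for the distance to almost paths -/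

theorem IsAlmostPaths.encard_le {V : Type} {G : SimpleGraph V} (h : IsAlmostPaths G) (v : V) :
    (G.neighborSet v).encard ≤ 3 := by
  obtain ⟨P, -, h2, h3, h4⟩ := h
  by_cases hv : v ∈ P
  · rw [← Set.inter_union_sdiff (G.neighborSet v) P]
    calc _ ≤ _ := Set.encard_union_le _ _
      _ ≤ 2 + 1 := add_le_add (h2 v hv) (h3 v hv)
      _ = 3 := by norm_num
  · obtain ⟨u, -, hu⟩ := h4 v hv
    rw [hu, Set.encard_singleton]
    norm_num

theorem isAlmostPaths_of_rank {V : Type} {G : SimpleGraph V} {rank : V → ℕ}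
    (hne : ∀ u v, G.Adj u v → rank u ≠ rank v)
    (huniq : ∀ u v w, G.Adj u v → G.Adj u w → rank u < rank v → rank u < rank w → v = w)
    (hdeg : ∀ v, ∃ x y, ∀ u, G.Adj v u → u = x ∨ u = y) : IsAlmostPaths G := by
  -- All vertices serve as path vertices; pendant neighbours are not needed.
  refine ⟨Set.univ, ?_, ?_, by simp, by simp⟩
  · refine isAcyclic_of_rank (rank := fun v => rank v.1) (fun u v h => hne _ _ h) ?_
    intro u v w h1 h2 h3 h4
    exact Subtype.ext (huniq _ _ _ h1 h2 h3 h4)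
  · intro v _
    obtain ⟨x, y, h⟩ := hdeg v
    refine (Set.encard_le_encard (t := {x, y}) ?_).trans
      ((Set.encard_insert_le _ _).trans (by rw [Set.encard_singleton]; norm_num))
    rintro u ⟨hu, -⟩
    exact h u hu

/-- Disjoint stars with four leaves bound the distance to almost paths from below. -/
theorem card_le_of_stars {V ι : Type} [Fintype ι] {G : SimpleGraph V} (S : Finset V)
    (hS : IsAlmostPaths (removeVertices G S)) (centre : ι → V) (leaf : ι → Fin 4 → V)
    (hadj : ∀ i j, G.Adj (centre i) (leaf i j)) (hleaf : ∀ i, (leaf i).Injective)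
    (hcc : centre.Injective) (hcl : ∀ i i' j, centre i ≠ leaf i' j)
    (hll : ∀ i i' j j', leaf i j = leaf i' j' → i = i') : Fintype.card ι ≤ S.card := by
  -- The centre of an untouched star would keep degree four. As the stars are disjoint, choosing a
  -- removed vertex in each of them is injective.
  have hit : ∀ i, ∃ v ∈ S, v = centre i ∨ ∃ j, v = leaf i j := by
    intro i
    by_contra! hno
    have hc : centre i ∉ S := fun h => (hno _ h).1 rfl
    have hl : ∀ j, leaf i j ∉ S := fun j h => (hno _ h).2 j rfl
    have h3 := hS.encard_le ⟨centre i, hc⟩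
    have h4 : (Set.range fun j => (⟨leaf i j, hl j⟩ : ((S : Set V)ᶜ : Set V))).encard = 4 := by
      rw [← Set.image_univ, Function.Injective.encard_image, Set.encard_univ]
      · simp
      · intro a b hab
        exact hleaf i (congrArg Subtype.val hab)
    have hsub : (Set.range fun j => (⟨leaf i j, hl j⟩ : ((S : Set V)ᶜ : Set V))) ⊆
        (removeVertices G S).neighborSet ⟨centre i, hc⟩ := by
      rintro _ ⟨j, rfl⟩
      exact hadj i j
    have := (Set.encard_le_encard hsub).trans h3
    rw [h4] at this
    exact absurd this (by norm_num)
  choose f hf hf' using hit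
  rw [← Finset.card_univ]
  refine Finset.card_le_card_of_injOn f (fun i _ => hf i) ?_
  intro i _ i' _ he
  rcases hf' i with h | ⟨j, h⟩ <;> rcases hf' i' with h' | ⟨j', h'⟩ <;> rw [h, h'] at he
  · exact hcc he
  · exact absurd he (hcl _ _ _)
  · exact absurd he.symm (hcl _ _ _)
  · exact hll _ _ _ _ he

theorem distAlmostPaths_eq {V : Type} {G : SimpleGraph V} (S : Finset V)
    (hS : IsAlmostPaths (removeVertices G S))
    (hmin : ∀ S' : Finset V, IsAlmostPaths (removeVertices G S') → S.card ≤ S'.card) :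
    distAlmostPaths G = S.card := by
  refine le_antisymm (Nat.sInf_le ⟨S, rfl, hS⟩) (le_csInf ⟨_, S, rfl, hS⟩ ?_)
  rintro _ ⟨S', rfl, hS'⟩
  exact hmin S' hS'

end ASP

namespace ASP

/-! ### Programs whose incidence graph is close to a union of short paths -/

open Classical in
/-- The rank of a vertex of the incidence graph: atoms have rank one, and a rule has rank two if
there is an atom `a ≥ K` in its head, and rank zero otherwise. -/
noncomputable def vertexRank (P : Program ℕ) (K : ℕ) :
    {a // a ∈ P.atoms} ⊕ {r // r ∈ P} → ℕ
  | .inl _ => 1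
  | .inr r => if ∃ a ∈ r.1.head, K ≤ a then 2 else 0

/-- The atoms below `K`, as vertices of the incidence graph. -/
def lowAtoms (P : Program ℕ) (K : ℕ) : Finset ({a // a ∈ P.atoms} ⊕ {r // r ∈ P}) :=
  (Finset.univ.filter fun a : {a // a ∈ P.atoms} => a.1 < K).map Function.Embedding.inl

theorem inl_mem_lowAtoms {P : Program ℕ} {K : ℕ} {a : {a // a ∈ P.atoms}} :
    (Sum.inl a) ∈ lowAtoms P K ↔ a.1 < K := by
  simp [lowAtoms]

theorem inr_notMem_lowAtoms {P : Program ℕ} {K : ℕ} {r : {r // r ∈ P}} :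
    (Sum.inr r) ∉ lowAtoms P K := by
  simp [lowAtoms]

theorem card_lowAtoms {P : Program ℕ} {K n : ℕ} (hP : P.atoms = Finset.range n) (hK : K ≤ n) :
    (lowAtoms P K).card = K := by
  rw [lowAtoms, Finset.card_map, ← Finset.card_map (Function.Embedding.subtype _)]
  conv_rhs => rw [← Finset.card_range K]
  congr 1
  ext a
  simp [hP]
  omega

/-- Above `K`, the program consists of disjoint paths: a rule with an atom `a ≥ K` in its head has at
most two such atoms, any other rule has at most one, and every atom `a ≥ K` occurs in at most one rule
of each of these two kinds. -/
structure PathsAbove (P : Program ℕ) (K : ℕ) : Prop where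
  two : ∀ r ∈ P, ∃ x y, ∀ a ∈ r.atoms, K ≤ a → a = x ∨ a = y
  one : ∀ r ∈ P, (¬ ∃ a ∈ r.head, K ≤ a) → ∀ a ∈ r.atoms, ∀ b ∈ r.atoms, K ≤ a → K ≤ b → a = b
  unique : ∀ r ∈ P, ∀ r' ∈ P, ∀ a ≥ K, a ∈ r.atoms → a ∈ r'.atoms →
    ((∃ a ∈ r.head, K ≤ a) ↔ ∃ a ∈ r'.head, K ≤ a) → r = r'

section

variable {P : Program ℕ} {K : ℕ}

theorem vertexRank_ne (u v : ((lowAtoms P K : Set _)ᶜ : Set ({a // a ∈ P.atoms} ⊕ {r // r ∈ P})))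
    (h : (removeVertices P.incidenceGraph (lowAtoms P K)).Adj u v) :
    vertexRank P K u.1 ≠ vertexRank P K v.1 := by
  obtain ⟨u | u, hu⟩ := u <;> obtain ⟨v | v, hv⟩ := v
  · exact h.elim
  · simp only [vertexRank]; split_ifs <;> omega
  · simp only [vertexRank]; split_ifs <;> omega
  · exact h.elim

/-- Above an atom there are only rules with a high head atom, and `unique` allows one of them; above
a rule without high head atom there are only its high atoms, and `one` allows one of these; rules of
rank two have nothing above them. -/
theorem PathsAbove.rank_unique (h : PathsAbove P K)
    (u v w : ((lowAtoms P K : Set _)ᶜ : Set ({a // a ∈ P.atoms} ⊕ {r // r ∈ P})))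
    (h1 : (removeVertices P.incidenceGraph (lowAtoms P K)).Adj u v)
    (h2 : (removeVertices P.incidenceGraph (lowAtoms P K)).Adj u w)
    (h3 : vertexRank P K u.1 < vertexRank P K v.1)
    (h4 : vertexRank P K u.1 < vertexRank P K w.1) : v = w := by
  obtain ⟨u | u, hu⟩ := u <;> obtain ⟨v | v, hv⟩ := v <;> obtain ⟨w | w, hw⟩ := w
  · exact h1.elim
  · exact h1.elim
  · exact h2.elim
  · have hu' : K ≤ u.1 := not_lt.1 fun hl => hu (inl_mem_lowAtoms.2 hl)
    simp only [vertexRank] at h3 h4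
    have hv2 : ∃ a ∈ v.1.head, K ≤ a := by by_contra hn; simp [if_neg hn] at h3
    have hw2 : ∃ a ∈ w.1.head, K ≤ a := by by_contra hn; simp [if_neg hn] at h4
    have := h.unique v.1 v.2 w.1 w.2 u.1 hu' h1 h2 (iff_of_true hv2 hw2)
    simp [Subtype.ext this]
  · have hv' : K ≤ v.1 := not_lt.1 fun hl => hv (inl_mem_lowAtoms.2 hl)
    have hw' : K ≤ w.1 := not_lt.1 fun hl => hw (inl_mem_lowAtoms.2 hl)
    have hn : ¬ ∃ a ∈ u.1.head, K ≤ a := by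
      intro hn
      simp [vertexRank, if_pos hn] at h3
    have := h.one u.1 u.2 hn v.1 h1 w.1 h2 hv' hw'
    simp [Subtype.ext this]
  · exact h2.elim
  · exact h1.elim
  · exact h1.elim

theorem PathsAbove.degree_le (h : PathsAbove P K)
    (v : ((lowAtoms P K : Set _)ᶜ : Set ({a // a ∈ P.atoms} ⊕ {r // r ∈ P}))) :
    ∃ x y, ∀ u, (removeVertices P.incidenceGraph (lowAtoms P K)).Adj v u → u = x ∨ u = y := by
  classical
  obtain ⟨v | v, hv⟩ := v
  · have hv' : K ≤ v.1 := not_lt.1 fun hl => hv (inl_mem_lowAtoms.2 hl)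
    -- One neighbour for each of the two kinds of rules; if there is no rule of the kind, the vertex
    -- itself serves as a dummy value.
    have key : ∀ p : Prop,
        ∃ x : ((lowAtoms P K : Set _)ᶜ : Set ({a // a ∈ P.atoms} ⊕ {r // r ∈ P})),
        ∀ (r : {r // r ∈ P}) (hr : _), v.1 ∈ r.1.atoms → ((∃ a ∈ r.1.head, K ≤ a) ↔ p) →
          x = ⟨Sum.inr r, hr⟩ := by
      intro p
      by_cases hp : ∃ r : {r // r ∈ P}, v.1 ∈ r.1.atoms ∧ ((∃ a ∈ r.1.head, K ≤ a) ↔ p)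
      · obtain ⟨r, h1, h2⟩ := hp
        refine ⟨⟨.inr r, inr_notMem_lowAtoms⟩, fun r' _ h1' h2' => ?_⟩
        have := h.unique r'.1 r'.2 r.1 r.2 v.1 hv' h1' h1 (h2'.trans h2.symm)
        simp [Subtype.ext this]
      · exact ⟨⟨.inl v, hv⟩, fun r _ h1 h2 => absurd ⟨r, h1, h2⟩ hp⟩
    obtain ⟨x, hx⟩ := key True
    obtain ⟨y, hy⟩ := key False
    refine ⟨x, y, ?_⟩
    rintro ⟨u | u, hu⟩ huv
    · exact huv.elim
    · by_cases hb : ∃ a ∈ u.1.head, K ≤ a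
      · exact Or.inl (hx u hu huv (iff_of_true hb trivial)).symm
      · exact Or.inr (hy u hu huv (iff_of_false hb not_false)).symm
  · obtain ⟨x, y, hxy⟩ := h.two v.1 v.2
    have key : ∀ x : ℕ,
        ∃ x' : ((lowAtoms P K : Set _)ᶜ : Set ({a // a ∈ P.atoms} ⊕ {r // r ∈ P})),
        ∀ (a : {a // a ∈ P.atoms}) (ha : _), a.1 = x →
          x' = ⟨Sum.inl a, ha⟩ := by
      intro x
      by_cases hx : ∃ a : {a // a ∈ P.atoms}, Sum.inl a ∉ lowAtoms P K ∧ a.1 = x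
      · obtain ⟨a, ha, rfl⟩ := hx
        exact ⟨⟨.inl a, ha⟩, fun b _ hb => by simp [Subtype.ext hb]⟩
      · exact ⟨⟨.inr v, hv⟩, fun a ha hax => absurd ⟨a, ha, hax⟩ hx⟩
    obtain ⟨x', hx'⟩ := key x
    obtain ⟨y', hy'⟩ := key y
    refine ⟨x', y', ?_⟩
    rintro ⟨u | u, hu⟩ huv
    · have hu' : K ≤ u.1 := not_lt.1 fun hl => hu (inl_mem_lowAtoms.2 hl)
      exact (hxy u.1 huv hu').imp (fun he => (hx' u hu he).symm) fun he => (hy' u hu he).symm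
    · exact huv.elim

theorem PathsAbove.isAlmostPaths (h : PathsAbove P K) :
    IsAlmostPaths (removeVertices P.incidenceGraph (lowAtoms P K)) :=
  isAlmostPaths_of_rank (rank := fun v => vertexRank P K v.1) vertexRank_ne h.rank_unique
    h.degree_le

theorem PathsAbove.pathLengthLE (h : PathsAbove P K) :
    PathLengthLE (removeVertices P.incidenceGraph (lowAtoms P K)) (2 * 2) := by
  refine pathLengthLE_of_rank (rank := fun v => vertexRank P K v.1) ?_ vertexRank_ne h.rank_unique
  rintro ⟨v | v, hv⟩
  · simp [vertexRank]
  · simp only [vertexRank]; split_ifs <;> omega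

/-- Removing the low atoms gives the upper bound `K`, and the four private rules of each low atom
give the matching lower bound. Since `4 ≤ K`, the constant path length `2 * 2` is at most `1 * K`.
-/
theorem PathsAbove.mem_shortPathPrograms {n : ℕ} (h : PathsAbove P K)
    (hP : P.atoms = Finset.range n) (hK : K ≤ n) (hK4 : 4 ≤ K)
    (leaf : Fin K → Fin 4 → Rule ℕ) (hmem : ∀ i j, leaf i j ∈ P)
    (hadj : ∀ i j, i.1 ∈ (leaf i j).atoms)
    (hleaf : ∀ i i' j j', leaf i j = leaf i' j' → i = i' ∧ j = j') :
    P.dist = K ∧ P ∈ shortPathPrograms 1 := by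
  have hdist : P.dist = K := by
    refine (distAlmostPaths_eq (lowAtoms P K) h.isAlmostPaths ?_).trans (card_lowAtoms hP hK)
    intro S' hS'
    rw [card_lowAtoms hP hK]
    conv_lhs => rw [← Fintype.card_fin K]
    refine card_le_of_stars S' hS'
      (fun i => .inl ⟨i.1, by rw [hP, Finset.mem_range]; omega⟩)
      (fun i j => .inr ⟨leaf i j, hmem i j⟩) hadj ?_ ?_ ?_ ?_
    · intro i j j' he
      simp only [Sum.inr.injEq, Subtype.mk.injEq] at he
      exact (hleaf _ _ _ _ he).2
    · intro i i' he
      simpa [Fin.ext_iff] using he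
    · intro i i' j
      simp
    · intro i i' j j' he
      simp only [Sum.inr.injEq, Subtype.mk.injEq] at he
      exact (hleaf _ _ _ _ he).1
  refine ⟨hdist, ⟨n, hP⟩, lowAtoms P K, ?_, h.isAlmostPaths, ?_⟩
  · rw [hdist, card_lowAtoms hP hK]
  · intro u v q hq
    have := h.pathLengthLE u v q hq
    omega

end

end ASP

/-! ### The reduction: rules, terms and their syntactic properties -/

namespace ASP

/-! ### Rules as lists of atoms -/

/-- A rule whose atoms are given as lists. -/
@[ext]
structure ListRule where
  head : List ℕ
  pos : List ℕ
  neg : List ℕ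

/-- The string that represents a rule. -/
def ListRule.code (r : ListRule) : List ProgramSymbol :=
  .rule :: (r.head.flatMap (fun a => .head :: List.replicate a .one) ++
    r.pos.flatMap (fun a => .pos :: List.replicate a .one) ++
    r.neg.flatMap (fun a => .neg :: List.replicate a .one))

/-- The rule with the given lists of atoms. -/
def ListRule.toRule (r : ListRule) : Rule ℕ where
  head := r.head.toFinset
  pos := r.pos.toFinset \ r.head.toFinset
  neg := r.neg.toFinset \ (r.head.toFinset ∪ r.pos.toFinset)
  head_pos := Finset.disjoint_sdiff
  head_neg := Finset.disjoint_sdiff.mono_right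
    (Finset.sdiff_subset_sdiff le_rfl Finset.subset_union_left)
  pos_neg := Finset.disjoint_sdiff.mono Finset.sdiff_subset
    (Finset.sdiff_subset_sdiff le_rfl Finset.subset_union_right)

/-- The lists are strictly increasing and disjoint. -/
structure ListRule.Canonical (r : ListRule) : Prop where
  head : r.head.Pairwise (· < ·)
  pos : r.pos.Pairwise (· < ·)
  neg : r.neg.Pairwise (· < ·)
  head_pos : ∀ a ∈ r.head, a ∉ r.pos
  head_neg : ∀ a ∈ r.head, a ∉ r.neg
  pos_neg : ∀ a ∈ r.pos, a ∉ r.neg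

namespace ListRule.Canonical

variable {r r' : ListRule}

/-- The set differences in `toRule` only make it total; on canonical lists they remove nothing. -/
theorem toRule_pos (h : r.Canonical) : r.toRule.pos = r.pos.toFinset := by
  ext a
  simp only [toRule, Finset.mem_sdiff, List.mem_toFinset, and_iff_left_iff_imp]
  exact fun h1 h2 => h.head_pos a h2 h1

theorem toRule_neg (h : r.Canonical) : r.toRule.neg = r.neg.toFinset := by
  ext a
  simp only [toRule, Finset.mem_sdiff, List.mem_toFinset, and_iff_left_iff_imp, Finset.mem_union]
  rintro h1 (h2 | h2)
  exacts [h.head_neg a h2 h1, h.pos_neg a h2 h1]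

theorem sort_toFinset {l : List ℕ} (h : l.Pairwise (· < ·)) : l.toFinset.sort (· ≤ ·) = l :=
  (List.toFinset_sort _ (h.imp fun h => h.ne)).2 (h.imp fun h => h.le)

/-- Links what the machine writes, plain lists, with the official string, which sorts the sets of
atoms: a strictly increasing list is its own sorting. -/
theorem code_toRule (h : r.Canonical) : r.toRule.code = r.code := by
  rw [Rule.code, h.toRule_pos, h.toRule_neg, sort_toFinset h.pos, sort_toFinset h.neg]
  change _ :: ((r.head.toFinset.sort _).flatMap _ ++ _ ++ _) = _
  rw [sort_toFinset h.head]
  rfl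

/-- Transfers distinctness from lists to rules, both for writing every rule only once and for
counting the leaves of the stars. -/
theorem toRule_injective (h : r.Canonical) (h' : r'.Canonical) (he : r.toRule = r'.toRule) :
    r = r' := by
  have h1 : r.head.toFinset = r'.head.toFinset := congrArg Rule.head he
  have h2 : r.toRule.pos = r'.toRule.pos := congrArg Rule.pos he
  have h3 : r.toRule.neg = r'.toRule.neg := congrArg Rule.neg he
  rw [h.toRule_pos, h'.toRule_pos] at h2
  rw [h.toRule_neg, h'.toRule_neg] at h3
  ext1
  · rw [← sort_toFinset h.head, h1, sort_toFinset h'.head]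
  · rw [← sort_toFinset h.pos, h2, sort_toFinset h'.pos]
  · rw [← sort_toFinset h.neg, h3, sort_toFinset h'.neg]

theorem mem_atoms (h : r.Canonical) {a : ℕ} :
    a ∈ r.toRule.atoms ↔ a ∈ r.head ∨ a ∈ r.pos ∨ a ∈ r.neg := by
  rw [Rule.atoms, h.toRule_pos, h.toRule_neg]
  simp [toRule]

end ListRule.Canonical

/-! ### The rules for a formula

A formula is given by the list `cls` of its clauses, a clause by the list of its literals, and a
literal by its sign and the index of its variable; `a` is a number of bits that suffices for the
indices of clauses and variables.

The universal variables are `0` and `1` (the position of a literal in its clause), `2` (the sign of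
the literal), `3 + b` for `b < a` (the index of the clause) and `3 + a + b` for `b < a` (the index
of the variable). The existential variables are the truth value `varIdx a i 0` of the `i`-th
variable of the formula, and the bits `varIdx a i 1` and `varIdx a i 2` of the position of a
satisfied literal in the `i`-th clause. -/

/-- The index of the `c`-th existential variable of the `i`-th group. -/
def varIdx (a i c : ℕ) : ℕ := 3 + 2 * a + 3 * i + c

/-- The literals that say that the bits of `j` are the values of `d, …, d + a - 1`. -/
def bitLits (a d j : ℕ) : List ℕ := (List.range a).map fun b => litAtom (d + b) (j.testBit b)

/-- The literals that say that the position is `t`. -/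
def posLits (t : ℕ) : List ℕ := [litAtom 0 (t.testBit 0), litAtom 1 (t.testBit 1)]

/-- The existential variable with index `varIdx a i c` has value `b` and this refutes the choice of
the universal variables. -/
def varTerm (a i : ℕ) : ℕ × Bool → List ℕ
  | (0, b) => litAtom 2 b :: (bitLits a (3 + a) i ++ [litAtom (varIdx a i 0) b])
  | (c + 1, b) => litAtom c (!b) :: (bitLits a 3 i ++ [litAtom (varIdx a i (c + 1)) b])

/-- The `t`-th literal of the `j`-th clause is `l`, and the universal variables say otherwise. -/
def literalTerms (a j t : ℕ) (l : Bool × ℕ) : List (List ℕ) :=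
  (posLits t ++ litAtom 2 (!l.1) :: bitLits a 3 j) ::
    (List.range a).map fun b =>
      posLits t ++ (bitLits a 3 j ++ [litAtom (3 + a + b) (!l.2.testBit b)])

/-- The terms for the `j`-th clause; a single one if there is no such clause. -/
def clauseTerms (a j : ℕ) : Option (List (Bool × ℕ)) → List (List ℕ)
  | none => [bitLits a 3 j]
  | some c => c.zipIdx.flatMap fun p => literalTerms a j p.2 p.1

/-- The pairs of `c < 3` and a truth value. -/
def varLits : List (ℕ × Bool) :=
  [(0, false), (0, true), (1, false), (1, true), (2, false), (2, true)]

/-- The terms of the `j`-th group. -/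
def groupTerms (a : ℕ) (cls : List (List (Bool × ℕ))) (j : ℕ) : List (List ℕ) :=
  varLits.map (varTerm a j) ++ clauseTerms a j cls[j]?

/-- The bound for the number of variables. -/
def numVars (a : ℕ) : ℕ := 3 + 2 * a + 3 * 2 ^ a

/-- The rule that guesses the value of `z`. -/
def guessRule (z : ℕ) : ListRule := ⟨[litAtom z false, litAtom z true], [], []⟩

/-- The rule that derives `0` from a set of literals. -/
def termRule (T : List ℕ) : ListRule := ⟨[0], T, []⟩

/-- The rules in which only the atom `0` and the atom `y` of a universal literal occur. -/
def starRules (y : ℕ) : List ListRule :=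
  [⟨[y], [0], []⟩, ⟨[], [], [y]⟩, ⟨[0], [], [y]⟩, ⟨[], [0], [y]⟩]

/-- The rules for a universal variable. -/
def univRules (z : ℕ) : List ListRule :=
  guessRule z :: (starRules (litAtom z false) ++ starRules (litAtom z true))

/-- The rules in which the atom `0` is negated. -/
def negZeroRules : List ListRule :=
  [⟨[], [], [0]⟩, ⟨[1], [], [0]⟩, ⟨[2], [], [0]⟩, ⟨[], [1], [0]⟩]

/-- The rules of the `j`-th group. -/
def groupRules (a : ℕ) (cls : List (List (Bool × ℕ))) (j : ℕ) : List ListRule :=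
  (List.range 3).map (fun c => guessRule (varIdx a j c)) ++ (groupTerms a cls j).map termRule

/-- The list of all rules. -/
def listRules (a : ℕ) (cls : List (List (Bool × ℕ))) : List ListRule :=
  negZeroRules ++ (List.range (3 + 2 * a)).flatMap univRules ++
    (List.range (2 ^ a)).flatMap (groupRules a cls)

/-- The number `a` of bits suffices for the formula, and the clauses have at most three literals. -/
structure FitsIn (cls : List (List (Bool × ℕ))) (a : ℕ) : Prop where
  length_le : cls.length ≤ 2 ^ a
  clause_length : ∀ c ∈ cls, c.length ≤ 3
  index_lt : ∀ c ∈ cls, ∀ l ∈ c, l.2 < 2 ^ a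

variable {a j : ℕ} {cls : List (List (Bool × ℕ))}

theorem mem_bitLits {d x : ℕ} :
    x ∈ bitLits a d j ↔ ∃ b < a, x = litAtom (d + b) (j.testBit b) := by
  simp [bitLits, eq_comm]

theorem litAtom_mem_bitLits {d b : ℕ} {β : Bool} (hb : b < a) :
    litAtom (d + b) β ∈ bitLits a d j ↔ β = j.testBit b := by
  rw [mem_bitLits]
  constructor
  · rintro ⟨b', -, h⟩
    obtain ⟨h1, h2⟩ := litAtom_inj h
    obtain rfl : b = b' := by omega
    exact h2
  · rintro rfl
    exact ⟨b, hb, rfl⟩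

theorem le_litAtom (z : ℕ) (b : Bool) : 1 + 2 * z ≤ litAtom z b := by simp [litAtom]

theorem litAtom_le (z : ℕ) (b : Bool) : litAtom z b ≤ 2 + 2 * z := by
  have := Bool.toNat_le b
  simp only [litAtom]
  omega

theorem litAtom_lt {z z' : ℕ} (b b' : Bool) (h : z < z') : litAtom z b < litAtom z' b' := by
  have := litAtom_le z b
  have := le_litAtom z' b'
  omega

theorem pairwise_bitLits (a d j : ℕ) : (bitLits a d j).Pairwise (· < ·) := by
  rw [bitLits, List.pairwise_map]
  exact List.pairwise_lt_range.imp fun h => litAtom_lt _ _ (by omega)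

theorem eq_of_testBit_eq {j j' : ℕ} (hj : j < 2 ^ a) (hj' : j' < 2 ^ a)
    (h : ∀ b < a, j.testBit b = j'.testBit b) : j = j' := by
  refine Nat.eq_of_testBit_eq fun b => ?_
  by_cases hb : b < a
  · exact h b hb
  · have : 2 ^ a ≤ 2 ^ b := Nat.pow_le_pow_right (by omega) (by omega)
    rw [Nat.testBit_lt_two_pow (by omega), Nat.testBit_lt_two_pow (by omega)]

theorem mem_groupTerms_iff {T : List ℕ} : T ∈ groupTerms a cls j ↔
    (∃ c < 3, ∃ b, T = varTerm a j (c, b)) ∨ T ∈ clauseTerms a j cls[j]? := by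
  rw [groupTerms, List.mem_append]
  refine or_congr_left ?_
  simp only [varLits, List.map_cons, List.map_nil, List.mem_cons, List.not_mem_nil, or_false]
  constructor
  · rintro (h | h | h | h | h | h)
    exacts [⟨0, by omega, _, h⟩, ⟨0, by omega, _, h⟩, ⟨1, by omega, _, h⟩, ⟨1, by omega, _, h⟩,
      ⟨2, by omega, _, h⟩, ⟨2, by omega, _, h⟩]
  · rintro ⟨c, hc, b, rfl⟩
    interval_cases c <;> cases b <;> simp

/-- A term of the `j`-th group is one of the following kinds. -/
theorem mem_groupTerms {T : List ℕ} : T ∈ groupTerms a cls j ↔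
    (∃ c < 3, ∃ b, T = varTerm a j (c, b)) ∨ (cls[j]? = none ∧ T = bitLits a 3 j) ∨
    ∃ cl, cls[j]? = some cl ∧ ∃ t l, cl[t]? = some l ∧ T ∈ literalTerms a j t l := by
  rw [mem_groupTerms_iff]
  refine or_congr_right ?_
  cases hc : cls[j]? with
  | none => simp [clauseTerms]
  | some c =>
    simp only [clauseTerms, List.mem_flatMap, reduceCtorEq, false_and, false_or,
      Option.some.injEq, exists_eq_left', List.mem_zipIdx_iff_getElem?]
    exact ⟨fun ⟨p, h⟩ => ⟨p.2, p.1, h⟩, fun ⟨t, l, h⟩ => ⟨(l, t), h⟩⟩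

theorem mem_varTerm {c x : ℕ} {b : Bool} (hc : c < 3) (h : x ∈ varTerm a j (c, b)) :
    x = litAtom (varIdx a j c) b ∨ ∃ z < 3 + 2 * a, ∃ b', x = litAtom z b' := by
  rcases c with _ | c
  · simp only [varTerm, List.mem_cons, List.mem_append, mem_bitLits, List.not_mem_nil,
      or_false] at h
    rcases h with rfl | ⟨b', hb', rfl⟩ | rfl
    · exact Or.inr ⟨2, by omega, _, rfl⟩
    · exact Or.inr ⟨_, by omega, _, rfl⟩
    · exact Or.inl rfl
  · simp only [varTerm, List.mem_cons, List.mem_append, mem_bitLits, List.not_mem_nil,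
      or_false] at h
    rcases h with rfl | ⟨b', hb', rfl⟩ | rfl
    · exact Or.inr ⟨c, by omega, _, rfl⟩
    · exact Or.inr ⟨_, by omega, _, rfl⟩
    · exact Or.inl rfl

theorem litAtom_mem_varTerm (a j c : ℕ) (b : Bool) :
    litAtom (varIdx a j c) b ∈ varTerm a j (c, b) := by
  rcases c with _ | c <;> simp [varTerm]

theorem mem_literalTerms {t : ℕ} {l : Bool × ℕ} {T : List ℕ} : T ∈ literalTerms a j t l ↔
    T = posLits t ++ litAtom 2 (!l.1) :: bitLits a 3 j ∨
    ∃ b < a, T = posLits t ++ (bitLits a 3 j ++ [litAtom (3 + a + b) (!l.2.testBit b)]) := by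
  simp [literalTerms, eq_comm]

/-- The terms that do not contain an existential literal determine the index of the clause. -/
theorem mem_clauseTerms {o : Option (List (Bool × ℕ))} {T : List ℕ} (h : T ∈ clauseTerms a j o) :
    (∀ x ∈ T, ∃ z < 3 + 2 * a, ∃ b, x = litAtom z b) ∧
    ∀ b < a, ∀ β, litAtom (3 + b) β ∈ T ↔ β = j.testBit b := by
  have hlit : ∀ z b z' b', z ≠ z' → litAtom z b ≠ litAtom z' b' :=
    fun z b z' b' hz he => hz (litAtom_inj he).1
  rcases o with _ | c
  · simp only [clauseTerms, List.mem_cons, List.not_mem_nil, or_false] at h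
    subst h
    refine ⟨?_, fun b hb β => litAtom_mem_bitLits hb⟩
    intro x hx
    obtain ⟨b, hb, rfl⟩ := mem_bitLits.1 hx
    exact ⟨_, by omega, _, rfl⟩
  · simp only [clauseTerms, List.mem_flatMap] at h
    obtain ⟨⟨l, t⟩, -, hT⟩ := h
    rcases mem_literalTerms.1 hT with rfl | ⟨b', hb', rfl⟩
    · constructor
      · intro x hx
        simp only [posLits, List.mem_cons, List.mem_append, mem_bitLits, List.not_mem_nil,
          or_false] at hx
        rcases hx with (rfl | rfl) | rfl | ⟨b', hb', rfl⟩
        exacts [⟨0, by omega, _, rfl⟩, ⟨1, by omega, _, rfl⟩, ⟨2, by omega, _, rfl⟩,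
          ⟨_, by omega, _, rfl⟩]
      · intro b hb β
        simp only [posLits, List.mem_cons, List.mem_append, List.not_mem_nil, or_false]
        rw [litAtom_mem_bitLits hb]
        simp [hlit (3 + b) β 0 _ (by omega), hlit (3 + b) β 1 _ (by omega),
          hlit (3 + b) β 2 _ (by omega)]
    · constructor
      · intro x hx
        simp only [posLits, List.mem_cons, List.mem_append, mem_bitLits, List.not_mem_nil,
          or_false] at hx
        rcases hx with (rfl | rfl) | ⟨b', hb', rfl⟩ | rfl
        exacts [⟨0, by omega, _, rfl⟩, ⟨1, by omega, _, rfl⟩,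
          ⟨_, by omega, _, rfl⟩, ⟨_, by omega, _, rfl⟩]
      · intro b hb β
        simp only [posLits, List.mem_cons, List.mem_append, List.not_mem_nil, or_false]
        rw [litAtom_mem_bitLits hb]
        simp [hlit (3 + b) β 0 _ (by omega), hlit (3 + b) β 1 _ (by omega),
          hlit (3 + b) β (3 + a + b') _ (by omega)]

theorem varIdx_inj {i i' c c' : ℕ} (hc : c < 3) (hc' : c' < 3)
    (h : varIdx a i c = varIdx a i' c') : i = i' ∧ c = c' := by
  simp only [varIdx] at h
  omega

/-- Only the terms `varTerm` contain an existential literal. Each contains a single one, and that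
literal names the group, the component and the value. This is what makes existential atoms occur in
only one term rule. -/
theorem high_mem_groupTerms {T : List ℕ} {z : ℕ} {b : Bool} (hT : T ∈ groupTerms a cls j)
    (hz : 3 + 2 * a ≤ z) (h : litAtom z b ∈ T) :
    ∃ c < 3, z = varIdx a j c ∧ T = varTerm a j (c, b) := by
  rcases mem_groupTerms_iff.1 hT with ⟨c, hc, b', rfl⟩ | hT
  · rcases mem_varTerm hc h with he | ⟨z', hz', b', he⟩
    · obtain ⟨rfl, rfl⟩ := litAtom_inj he
      exact ⟨c, hc, rfl, rfl⟩
    · have := (litAtom_inj he).1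
      omega
  · obtain ⟨z', hz', b', he⟩ := (mem_clauseTerms hT).1 _ h
    have := (litAtom_inj he).1
    omega

/-- A term reveals its group, either through its existential literal or through the bits of the
clause index that it contains. -/
theorem groupTerms_disjoint {j' : ℕ} {T : List ℕ} (hj : j < 2 ^ a) (hj' : j' < 2 ^ a)
    (h : T ∈ groupTerms a cls j) (h' : T ∈ groupTerms a cls j') : j = j' := by
  have key : ∀ {i i' : ℕ}, T ∈ groupTerms a cls i' → (∃ c < 3, ∃ b, T = varTerm a i (c, b)) →
      i = i' := by
    rintro i i' h' ⟨c, hc, b, rfl⟩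
    obtain ⟨c', hc', h1, -⟩ := high_mem_groupTerms h' (by simp only [varIdx]; omega)
      (litAtom_mem_varTerm a i c b)
    exact (varIdx_inj hc hc' h1).1
  rcases mem_groupTerms_iff.1 h with h1 | h1
  · exact key h' h1
  rcases mem_groupTerms_iff.1 h' with h2 | h2
  · exact (key h h2).symm
  refine eq_of_testBit_eq hj hj' fun b hb => ?_
  have := ((mem_clauseTerms h1).2 b hb (j.testBit b)).2 rfl
  exact ((mem_clauseTerms h2).2 b hb _).1 this

/-- The first term mentions the sign variable `2`, which no other one does; the remaining ones end
in literals of different variables. -/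
theorem nodup_literalTerms (a j t : ℕ) (l : Bool × ℕ) : (literalTerms a j t l).Nodup := by
  rw [literalTerms, List.nodup_cons]
  constructor
  · intro h
    simp only [List.mem_map, List.mem_range, List.append_cancel_left_eq] at h
    obtain ⟨b, hb, h⟩ := h
    have h2 : litAtom 2 (!l.1) ∈ bitLits a 3 j ++ [litAtom (3 + a + b) (!l.2.testBit b)] := by
      rw [h]; simp
    rcases List.mem_append.1 h2 with h2 | h2
    · obtain ⟨b', -, h2⟩ := mem_bitLits.1 h2
      have := (litAtom_inj h2).1
      omega
    · rw [List.mem_singleton] at h2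
      have := (litAtom_inj h2).1
      omega
  · refine List.Nodup.map_on ?_ List.nodup_range
    intro b _ b' _ h
    simp only [List.append_cancel_left_eq, List.cons.injEq, and_true] at h
    have := (litAtom_inj h).1
    omega

/-- The first two entries of a term spell the position of the literal in binary. Positions are below
three, so two bits tell them apart. -/
theorem nodup_clauseTerms {o : Option (List (Bool × ℕ))} (ho : ∀ c ∈ o, c.length ≤ 3) :
    (clauseTerms a j o).Nodup := by
  rcases o with _ | c
  · simp [clauseTerms]
  have hc := ho c rfl
  rw [clauseTerms, List.nodup_flatMap]
  refine ⟨fun p _ => nodup_literalTerms _ _ _ _, ?_⟩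
  have hnd : (c.zipIdx.map Prod.snd).Nodup := by
    rw [List.zipIdx_map_snd]; exact List.nodup_range'
  have hlt : ∀ p ∈ c.zipIdx, p.2 < 3 := by
    rintro ⟨l, t⟩ h
    have := List.mem_zipIdx h
    simp only
    omega
  have hpre : ∀ t l T, T ∈ literalTerms a j t l → T.take 2 = posLits t := by
    intro t l T hT
    rcases mem_literalTerms.1 hT with rfl | ⟨b', hb', rfl⟩ <;> simp [posLits]
  rw [List.Nodup, List.pairwise_map] at hnd
  refine hnd.imp_of_mem ?_
  rintro ⟨l, t⟩ ⟨l', t'⟩ h h' hne T hT hT'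
  have he := (hpre _ _ _ hT).symm.trans (hpre _ _ _ hT')
  have ht := hlt _ h
  have ht' := hlt _ h'
  simp only [posLits, List.cons.injEq, and_true] at he ht ht'
  have h0 := (litAtom_inj he.1).2
  have h1 := (litAtom_inj he.2).2
  apply hne
  simp only
  interval_cases t <;> interval_cases t' <;> simp_all [Nat.testBit]

theorem nodup_groupTerms (h : FitsIn cls a) : (groupTerms a cls j).Nodup := by
  rw [groupTerms, List.nodup_append]
  refine ⟨?_, nodup_clauseTerms fun c hc => h.clause_length c (List.mem_of_getElem? hc), ?_⟩
  · refine List.Nodup.map_on ?_ (by simp [varLits])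
    have hlt : ∀ p ∈ varLits, p.1 < 3 := by simp [varLits]
    rintro ⟨c, b⟩ hcb ⟨c', b'⟩ hcb' he
    have hm := litAtom_mem_varTerm a j c b
    rw [he] at hm
    rcases mem_varTerm (hlt _ hcb') hm with h | ⟨z, hz, b'', h⟩
    · obtain ⟨h1, rfl⟩ := litAtom_inj h
      exact Prod.ext (varIdx_inj (hlt _ hcb) (hlt _ hcb') h1).2 rfl
    · have := (litAtom_inj h).1
      simp only [varIdx] at this
      omega
  · rintro T hT _ hT' rfl
    obtain ⟨⟨c, b⟩, -, rfl⟩ := List.mem_map.1 hT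
    obtain ⟨z, hz, b', h⟩ := (mem_clauseTerms hT').1 _ (litAtom_mem_varTerm a j c b)
    have := (litAtom_inj h).1
    simp only [varIdx] at this
    omega

/-- The variables are numbered in the order in which terms list them: position, sign, clause index,
variable index, existential variables. Hence the terms are sorted as they stand and the machine
never has to sort. -/
theorem pairwise_groupTerms {T : List ℕ} (h : T ∈ groupTerms a cls j) : T.Pairwise (· < ·) := by
  have hl : ∀ {z z' : ℕ} (b b' : Bool), z < z' → litAtom z b < litAtom z' b' := litAtom_lt
  have hcons : ∀ {z d : ℕ} (b : Bool) (j : ℕ), z < d → ∀ x ∈ bitLits a d j, litAtom z b < x := by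
    intro z d b j hz x hx
    obtain ⟨b', -, rfl⟩ := mem_bitLits.1 hx
    exact hl _ _ (by omega)
  have hsnoc : ∀ {z d : ℕ} (b : Bool) (j : ℕ), d + a ≤ z → ∀ x ∈ bitLits a d j, x < litAtom z b := by
    intro z d b j hz x hx
    obtain ⟨b', hb', rfl⟩ := mem_bitLits.1 hx
    exact hl _ _ (by omega)
  rcases mem_groupTerms.1 h with ⟨c, hc, b, rfl⟩ | ⟨-, rfl⟩ | ⟨c, -, t, l, -, hT⟩
  · rcases c with _ | c
    · rw [varTerm, List.pairwise_cons, List.pairwise_append]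
      refine ⟨?_, pairwise_bitLits _ _ _, List.pairwise_singleton _ _, ?_⟩
      · intro x hx
        rcases List.mem_append.1 hx with hx | hx
        · exact hcons _ _ (by omega) x hx
        · rw [List.mem_singleton.1 hx]
          exact hl _ _ (by simp only [varIdx]; omega)
      · intro x hx y hy
        rw [List.mem_singleton.1 hy]
        exact hsnoc _ _ (by simp only [varIdx]; omega) x hx
    · rw [varTerm, List.pairwise_cons, List.pairwise_append]
      refine ⟨?_, pairwise_bitLits _ _ _, List.pairwise_singleton _ _, ?_⟩
      · intro x hx
        rcases List.mem_append.1 hx with hx | hx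
        · exact hcons _ _ (by omega) x hx
        · rw [List.mem_singleton.1 hx]
          exact hl _ _ (by simp only [varIdx]; omega)
      · intro x hx y hy
        rw [List.mem_singleton.1 hy]
        exact hsnoc _ _ (by simp only [varIdx]; omega) x hx
  · exact pairwise_bitLits _ _ _
  · rcases mem_literalTerms.1 hT with rfl | ⟨b', hb', rfl⟩
    · simp only [posLits, List.cons_append, List.nil_append, List.pairwise_cons, List.mem_cons]
      refine ⟨?_, ?_, fun x hx => hcons _ _ (by omega) x hx, pairwise_bitLits _ _ _⟩
      · rintro x (rfl | rfl | hx)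
        exacts [hl _ _ (by omega), hl _ _ (by omega), hcons _ _ (by omega) x hx]
      · rintro x (rfl | hx)
        exacts [hl _ _ (by omega), hcons _ _ (by omega) x hx]
    · simp only [posLits, List.cons_append, List.nil_append, List.pairwise_cons, List.mem_cons,
        List.pairwise_append, List.mem_append, List.not_mem_nil, or_false]
      refine ⟨?_, ?_, pairwise_bitLits _ _ _, ⟨by simp, List.Pairwise.nil⟩, ?_⟩
      · rintro x (rfl | hx | rfl)
        exacts [hl _ _ (by omega), hcons _ _ (by omega) x hx, hl _ _ (by omega)]
      · rintro x (hx | rfl)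
        exacts [hcons _ _ (by omega) x hx, hl _ _ (by omega)]
      · rintro x hx y rfl
        exact hsnoc _ _ (by omega) x hx

theorem exists_of_mem_groupTerms {T : List ℕ} {x : ℕ} (hj : j < 2 ^ a)
    (h : T ∈ groupTerms a cls j) (hx : x ∈ T) : ∃ z < numVars a, ∃ b, x = litAtom z b := by
  rcases mem_groupTerms_iff.1 h with ⟨c, hc, b, rfl⟩ | h
  · rcases mem_varTerm hc hx with rfl | ⟨z, hz, b', rfl⟩
    · exact ⟨_, by simp only [varIdx, numVars]; omega, _, rfl⟩
    · exact ⟨z, by simp only [numVars]; omega, _, rfl⟩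
  · obtain ⟨z, hz, b', rfl⟩ := (mem_clauseTerms h).1 x hx
    exact ⟨z, by simp only [numVars]; omega, _, rfl⟩

end ASP

/-! ### The program of a formula: distinct rules, distance, correctness -/

namespace ASP

variable {a j : ℕ} {cls : List (List (Bool × ℕ))}

theorem litAtom_pos (z : ℕ) (b : Bool) : 0 < litAtom z b := by simp only [litAtom]; omega

theorem mem_univRules {z : ℕ} {r : ListRule} : r ∈ univRules z ↔
    r = guessRule z ∨ ∃ b, r ∈ starRules (litAtom z b) := by
  simp only [univRules, List.mem_cons, List.mem_append, Bool.exists_bool]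

theorem mem_groupRules {r : ListRule} : r ∈ groupRules a cls j ↔
    (∃ c < 3, r = guessRule (varIdx a j c)) ∨ ∃ T ∈ groupTerms a cls j, r = termRule T := by
  simp [groupRules, eq_comm]

theorem mem_listRules {r : ListRule} : r ∈ listRules a cls ↔ r ∈ negZeroRules ∨
    (∃ z < 3 + 2 * a, r ∈ univRules z) ∨ ∃ j < 2 ^ a, r ∈ groupRules a cls j := by
  simp [listRules]

theorem mem_starRules {y : ℕ} {r : ListRule} : r ∈ starRules y ↔
    r = ⟨[y], [0], []⟩ ∨ r = ⟨[], [], [y]⟩ ∨ r = ⟨[0], [], [y]⟩ ∨ r = ⟨[], [0], [y]⟩ := by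
  simp [starRules]

theorem mem_negZeroRules {r : ListRule} : r ∈ negZeroRules ↔
    r = ⟨[], [], [0]⟩ ∨ r = ⟨[1], [], [0]⟩ ∨ r = ⟨[2], [], [0]⟩ ∨ r = ⟨[], [1], [0]⟩ := by
  simp [negZeroRules]

theorem canonical_guessRule (z : ℕ) : (guessRule z).Canonical := by
  constructor <;> simp [guessRule, litAtom]

theorem canonical_starRules {y : ℕ} (hy : 0 < y) {r : ListRule} (h : r ∈ starRules y) :
    r.Canonical := by
  rcases mem_starRules.1 h with rfl | rfl | rfl | rfl <;> constructor <;> simp <;> omega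

theorem canonical_of_mem {r : ListRule} (h : r ∈ listRules a cls) : r.Canonical := by
  rcases mem_listRules.1 h with h | ⟨z, -, h⟩ | ⟨j, hj, h⟩
  · rcases mem_negZeroRules.1 h with rfl | rfl | rfl | rfl <;> constructor <;> simp
  · rcases mem_univRules.1 h with rfl | ⟨b, h⟩
    · exact canonical_guessRule z
    · exact canonical_starRules (litAtom_pos z b) h
  · rcases mem_groupRules.1 h with ⟨c, -, rfl⟩ | ⟨T, hT, rfl⟩
    · exact canonical_guessRule _
    · refine ⟨by simp [termRule], pairwise_groupTerms hT, by simp [termRule], ?_, by simp [termRule],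
        by simp [termRule]⟩
      intro x hx hxT
      rw [termRule, List.mem_singleton] at hx
      obtain ⟨z, -, b, h⟩ := exists_of_mem_groupTerms hj hT hxT
      have := litAtom_pos z b
      omega

theorem guessRule_injective : guessRule.Injective := by
  intro z z' h
  simp only [guessRule, ListRule.mk.injEq, List.cons.injEq] at h
  exact (litAtom_inj h.1.1).1

theorem univRules_disjoint {z z' : ℕ} {r : ListRule} (h : r ∈ univRules z)
    (h' : r ∈ univRules z') : z = z' := by
  rw [mem_univRules] at h h'
  simp only [mem_starRules] at h h'
  have h0 : ∀ b, litAtom z b ≠ 0 := fun b => (litAtom_pos z b).ne'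
  have h0' : ∀ b, litAtom z' b ≠ 0 := fun b => (litAtom_pos z' b).ne'
  rcases h with rfl | ⟨b, rfl | rfl | rfl | rfl⟩ <;>
    rcases h' with h' | ⟨b', h' | h' | h' | h'⟩ <;>
    simp [guessRule, h0, (h0' _).symm] at h' <;>
    first
    | exact (litAtom_inj h').1
    | exact (litAtom_inj h'.1).1

theorem nodup_univRules (z : ℕ) : (univRules z).Nodup := by
  simp [univRules, starRules, guessRule, litAtom]

theorem nodup_groupRules (h : FitsIn cls a) : (groupRules a cls j).Nodup := by
  rw [groupRules, List.nodup_append]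
  refine ⟨?_, (nodup_groupTerms h).map ?_, ?_⟩
  · refine List.Nodup.map_on ?_ List.nodup_range
    intro c hc c' hc' he
    exact (varIdx_inj (List.mem_range.1 hc) (List.mem_range.1 hc') (guessRule_injective he)).2
  · intro T T' he
    simpa [termRule] using he
  · intro r hr r' hr' he
    subst he
    obtain ⟨c, -, rfl⟩ := List.mem_map.1 hr
    obtain ⟨T, -, hT⟩ := List.mem_map.1 hr'
    simp [termRule, guessRule] at hT

theorem groupRules_disjoint {j' : ℕ} {r : ListRule} (hj : j < 2 ^ a) (hj' : j' < 2 ^ a)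
    (h : r ∈ groupRules a cls j) (h' : r ∈ groupRules a cls j') : j = j' := by
  rcases mem_groupRules.1 h with ⟨c, hc, rfl⟩ | ⟨T, hT, rfl⟩ <;>
    rcases mem_groupRules.1 h' with ⟨c', hc', he⟩ | ⟨T', hT', he⟩
  · exact (varIdx_inj hc hc' (guessRule_injective he)).1
  · simp [termRule, guessRule] at he
  · simp [termRule, guessRule] at he
  · simp only [termRule, ListRule.mk.injEq, true_and, and_true] at he
    subst he
    exact groupTerms_disjoint hj hj' hT hT'

/-- A string of a program must list every rule once; the machine does not check for repetitions, so
the construction must avoid them. -/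
theorem nodup_listRules (h : FitsIn cls a) : (listRules a cls).Nodup := by
  rw [listRules, List.nodup_append, List.nodup_append, List.nodup_flatMap, List.nodup_flatMap]
  refine ⟨⟨by simp [negZeroRules], ⟨fun z _ => nodup_univRules z, ?_⟩, ?_⟩,
    ⟨fun j _ => nodup_groupRules h, ?_⟩, ?_⟩
  · exact List.nodup_range.imp fun hne r hr hr' => hne (univRules_disjoint hr hr')
  · rintro r hr _ hr' rfl
    obtain ⟨z, -, hz⟩ := List.mem_flatMap.1 hr'
    rw [mem_univRules] at hz
    have h0 : ∀ b, 0 ≠ litAtom z b := fun b => (litAtom_pos z b).ne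
    rcases mem_negZeroRules.1 hr with rfl | rfl | rfl | rfl <;>
      simp [mem_starRules, guessRule, h0] at hz
  · refine List.nodup_range.imp_of_mem fun hj hj' hne r hr hr' => hne ?_
    exact groupRules_disjoint (List.mem_range.1 hj) (List.mem_range.1 hj') hr hr'
  · rintro r hr _ hr' rfl
    obtain ⟨j, -, hj⟩ := List.mem_flatMap.1 hr'
    rcases List.mem_append.1 hr with hr | hr
    · rcases mem_groupRules.1 hj with ⟨c, -, rfl⟩ | ⟨T, hT, rfl⟩ <;>
        simp [mem_negZeroRules, guessRule, termRule] at hr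
    · obtain ⟨z, hz, hr⟩ := List.mem_flatMap.1 hr
      rcases mem_groupRules.1 hj with ⟨c, -, rfl⟩ | ⟨T, hT, rfl⟩
      · rcases mem_univRules.1 hr with he | ⟨b, hs⟩
        · have := guessRule_injective he
          simp only [varIdx, List.mem_range] at this hz
          omega
        · simp [mem_starRules, guessRule] at hs
      · have h0 : ∀ b, 0 ≠ litAtom z b := fun b => (litAtom_pos z b).ne
        simp [mem_univRules, mem_starRules, guessRule, termRule, h0] at hr

open Classical in
/-- The program for a formula. -/
noncomputable def reduction (a : ℕ) (cls : List (List (Bool × ℕ))) : Program ℕ :=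
  ((listRules a cls).map ListRule.toRule).toFinset

theorem mem_reduction {r : Rule ℕ} :
    r ∈ reduction a cls ↔ ∃ r' ∈ listRules a cls, r'.toRule = r := by
  simp [reduction]

theorem flatMap_code_mem_codes (h : FitsIn cls a) :
    (listRules a cls).flatMap ListRule.code ∈ (reduction a cls).codes := by
  refine ⟨(listRules a cls).map ListRule.toRule, ?_, ?_, ?_⟩
  · refine List.Nodup.map_on ?_ (nodup_listRules h)
    intro r hr r' hr' he
    exact (canonical_of_mem hr).toRule_injective (canonical_of_mem hr') he
  · intro r
    simp [mem_reduction]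
  · rw [List.flatMap_map]
    refine List.flatMap_congr fun r hr => ?_
    exact (canonical_of_mem hr).code_toRule.symm

theorem exists_varIdx {z : ℕ} (h1 : 3 + 2 * a ≤ z) (h2 : z < numVars a) :
    ∃ j < 2 ^ a, ∃ c < 3, z = varIdx a j c := by
  simp only [numVars] at h2
  refine ⟨(z - (3 + 2 * a)) / 3, by omega, (z - (3 + 2 * a)) % 3, by omega, ?_⟩
  simp only [varIdx]
  omega

theorem varIdx_lt {c : ℕ} (hj : j < 2 ^ a) (hc : c < 3) : varIdx a j c < numVars a := by
  simp only [varIdx, numVars]; omega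

theorem guessRule_mem {z : ℕ} (hz : z < numVars a) : guessRule z ∈ listRules a cls := by
  rw [mem_listRules]
  by_cases h : z < 3 + 2 * a
  · exact Or.inr (Or.inl ⟨z, h, mem_univRules.2 (Or.inl rfl)⟩)
  · obtain ⟨j, hj, c, hc, rfl⟩ := exists_varIdx (not_lt.1 h) hz
    exact Or.inr (Or.inr ⟨j, hj, mem_groupRules.2 (Or.inl ⟨c, hc, rfl⟩)⟩)

theorem starRules_mem {z : ℕ} {b : Bool} {r : ListRule} (hz : z < 3 + 2 * a)
    (hr : r ∈ starRules (litAtom z b)) : r ∈ listRules a cls :=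
  mem_listRules.2 (Or.inr (Or.inl ⟨z, hz, mem_univRules.2 (Or.inr ⟨b, hr⟩)⟩))

theorem termRule_mem {T : List ℕ} (hj : j < 2 ^ a) (hT : T ∈ groupTerms a cls j) :
    termRule T ∈ listRules a cls :=
  mem_listRules.2 (Or.inr (Or.inr ⟨j, hj, mem_groupRules.2 (Or.inr ⟨T, hT, rfl⟩)⟩))

/-- The rules are of five kinds. -/
theorem listRules_cases {r : ListRule} (h : r ∈ listRules a cls) : r ∈ negZeroRules ∨
    (∃ z < 3 + 2 * a, ∃ b, r ∈ starRules (litAtom z b)) ∨ (∃ z < numVars a, r = guessRule z) ∨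
    ∃ j < 2 ^ a, ∃ T ∈ groupTerms a cls j, r = termRule T := by
  rcases mem_listRules.1 h with h | ⟨z, hz, h⟩ | ⟨j, hj, h⟩
  · exact Or.inl h
  · rcases mem_univRules.1 h with rfl | ⟨b, h⟩
    · exact Or.inr (Or.inr (Or.inl ⟨z, by simp only [numVars]; omega, rfl⟩))
    · exact Or.inr (Or.inl ⟨z, hz, b, h⟩)
  · rcases mem_groupRules.1 h with ⟨c, hc, rfl⟩ | ⟨T, hT, rfl⟩
    · exact Or.inr (Or.inr (Or.inl ⟨_, varIdx_lt hj hc, rfl⟩))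
    · exact Or.inr (Or.inr (Or.inr ⟨j, hj, T, hT, rfl⟩))

/-- The sets of literals of the terms. -/
def termSets (a : ℕ) (cls : List (List (Bool × ℕ))) : Set (Set ℕ) :=
  {T | ∃ j < 2 ^ a, ∃ T' ∈ groupTerms a cls j, T = {x | x ∈ T'}}

/-- The first rule of each `starRules` list saturates, and the first of `negZeroRules` is the
constraint. The other rules of these lists exist only to create stars; they negate a low atom and
fall under the last case of `rules`. -/
theorem saturates_reduction (a : ℕ) (cls : List (List (Bool × ℕ))) :
    Saturates (reduction a cls) (3 + 2 * a) (numVars a) (termSets a cls) where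
  guess z hz := by
    refine ⟨_, mem_reduction.2 ⟨_, guessRule_mem hz, rfl⟩, ?_, ?_, ?_⟩ <;>
      simp [ListRule.toRule, guessRule]
  saturate z hz b := by
    refine ⟨_, mem_reduction.2 ⟨⟨[litAtom z b], [0], []⟩, starRules_mem hz (b := b)
      (mem_starRules.2 (Or.inl rfl)), rfl⟩, ?_, ?_, ?_⟩ <;>
      simp [ListRule.toRule, (litAtom_pos z b).ne]
  constr := by
    refine ⟨_, mem_reduction.2 ⟨⟨[], [], [0]⟩, mem_listRules.2 (Or.inl
      (mem_negZeroRules.2 (Or.inl rfl))), rfl⟩, ?_, ?_, ?_⟩ <;> simp [ListRule.toRule]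
  term := by
    rintro _ ⟨j, hj, T, hT, rfl⟩
    have hm := termRule_mem hj hT
    refine ⟨_, mem_reduction.2 ⟨_, hm, rfl⟩, ?_, ?_, ?_⟩
    · simp [ListRule.toRule, termRule]
    · rw [(canonical_of_mem hm).toRule_pos]
      ext; simp [termRule]
    · simp [ListRule.toRule, termRule]
  rules r hr := by
    obtain ⟨r, hm, rfl⟩ := mem_reduction.1 hr
    have hc := canonical_of_mem hm
    rcases listRules_cases hm with h | ⟨z, hz, b, h⟩ | ⟨z, hz, rfl⟩ | ⟨j, hj, T, hT, rfl⟩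
    · refine Or.inr (Or.inr (Or.inr ⟨0, ?_, by omega⟩))
      rw [hc.toRule_neg]
      rcases mem_negZeroRules.1 h with rfl | rfl | rfl | rfl <;> simp
    · have hlt : litAtom z b < 2 * (3 + 2 * a) + 1 := by
        have := litAtom_le z b
        omega
      rcases mem_starRules.1 h with rfl | h
      · refine Or.inr (Or.inl ⟨?_, ⟨litAtom z b, by simp [ListRule.toRule]⟩, ?_⟩)
        · rw [hc.toRule_pos]; simp
        · simpa [ListRule.toRule] using hlt
      · refine Or.inr (Or.inr (Or.inr ⟨litAtom z b, ?_, hlt⟩))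
        rw [hc.toRule_neg]
        rcases h with rfl | rfl | rfl <;> simp
    · refine Or.inl ⟨z, hz, fun b => ?_⟩
      cases b <;> simp [ListRule.toRule, guessRule]
    · refine Or.inr (Or.inr (Or.inl ⟨?_, ⟨j, hj, T, hT, ?_⟩, ?_⟩))
      · simp [ListRule.toRule, termRule]
      · rw [hc.toRule_pos]
        ext; simp [termRule]
      · simp [ListRule.toRule, termRule]
  lits := by
    rintro _ ⟨j, hj, T, hT, rfl⟩ x hx
    exact exists_of_mem_groupTerms hj hT hx

/-! ### Distance to almost paths of the program -/

theorem mem_atoms_listRules {r : ListRule} {x : ℕ} (h : r ∈ listRules a cls)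
    (hx : x ∈ r.toRule.atoms) : x = 0 ∨ ∃ z < numVars a, ∃ b, x = litAtom z b := by
  have h12 : ∀ x, x = 1 ∨ x = 2 → ∃ z < numVars a, ∃ b, x = litAtom z b := by
    have : 0 < numVars a := by simp only [numVars]; omega
    rintro x (rfl | rfl)
    exacts [⟨0, this, false, rfl⟩, ⟨0, this, true, rfl⟩]
  rw [(canonical_of_mem h).mem_atoms] at hx
  rcases listRules_cases h with h | ⟨z, hz, b, h⟩ | ⟨z, hz, rfl⟩ | ⟨j, hj, T, hT, rfl⟩
  · rcases mem_negZeroRules.1 h with rfl | rfl | rfl | rfl <;> simp at hx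
    · exact Or.inl hx
    · exact hx.symm.imp id fun h => h12 _ (Or.inl h)
    · exact hx.symm.imp id fun h => h12 _ (Or.inr h)
    · exact hx.symm.imp id fun h => h12 _ (Or.inl h)
  · have hz' : z < numVars a := by simp only [numVars]; omega
    rcases mem_starRules.1 h with rfl | rfl | rfl | rfl <;> simp at hx
    · exact hx.symm.imp id fun h => ⟨z, hz', b, h⟩
    · exact Or.inr ⟨z, hz', b, hx⟩
    · exact hx.imp id fun h => ⟨z, hz', b, h⟩
    · exact hx.imp id fun h => ⟨z, hz', b, h⟩
  · simp [guessRule] at hx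
    rcases hx with rfl | rfl
    exacts [Or.inr ⟨z, hz, _, rfl⟩, Or.inr ⟨z, hz, _, rfl⟩]
  · simp [termRule] at hx
    exact hx.imp id fun h => exists_of_mem_groupTerms hj hT h

/-- The guess rules use both literals of every variable, so there is no gap in the numbering, as
`programs` requires. -/
theorem atoms_reduction (a : ℕ) (cls : List (List (Bool × ℕ))) :
    (reduction a cls).atoms = Finset.range (1 + 2 * numVars a) := by
  ext x
  simp only [Program.atoms, Finset.mem_biUnion, mem_reduction, Finset.mem_range]
  constructor
  · rintro ⟨_, ⟨r, hr, rfl⟩, hx⟩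
    rcases mem_atoms_listRules hr hx with rfl | ⟨z, hz, b, rfl⟩
    · omega
    · have := litAtom_le z b
      omega
  · intro hx
    rcases eq_or_ne x 0 with rfl | hne
    · have hm : (⟨[], [], [0]⟩ : ListRule) ∈ listRules a cls :=
        mem_listRules.2 (Or.inl (mem_negZeroRules.2 (Or.inl rfl)))
      refine ⟨_, ⟨_, hm, rfl⟩, ?_⟩
      rw [(canonical_of_mem hm).mem_atoms]
      simp
    · obtain ⟨z, b, rfl⟩ := exists_litAtom hne
      have := le_litAtom z b
      have hm : guessRule z ∈ listRules a cls := guessRule_mem (by omega)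
      refine ⟨_, ⟨_, hm, rfl⟩, ?_⟩
      rw [(canonical_of_mem hm).mem_atoms]
      cases b <;> simp [guessRule]

/-- The atoms from `7 + 4 * a = 2 * (3 + 2 * a) + 1` on belong to the existential literals. Such a
literal can occur only in the guess rule of its variable and in the one term that
`high_mem_groupTerms` determines. -/
theorem high_atom {r : ListRule} {x : ℕ} (h : r ∈ listRules a cls)
    (hx : x ∈ r.toRule.atoms) (hK : 7 + 4 * a ≤ x) :
    (∃ z ≥ 3 + 2 * a, ∃ b, x = litAtom z b ∧ r = guessRule z) ∨
    ∃ j c, c < 3 ∧ ∃ b, x = litAtom (varIdx a j c) b ∧ r = termRule (varTerm a j (c, b)) := by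
  rw [(canonical_of_mem h).mem_atoms] at hx
  rcases listRules_cases h with h | ⟨z, hz, b, h⟩ | ⟨z, hz, rfl⟩ | ⟨j, hj, T, hT, rfl⟩
  · rcases mem_negZeroRules.1 h with rfl | rfl | rfl | rfl <;> simp at hx <;> omega
  · have := litAtom_le z b
    rcases mem_starRules.1 h with rfl | rfl | rfl | rfl <;> simp at hx <;> omega
  · left
    simp [guessRule] at hx
    rcases hx with rfl | rfl
    · have := litAtom_le z false
      exact ⟨z, by omega, _, rfl, rfl⟩
    · have := litAtom_le z true
      exact ⟨z, by omega, _, rfl, rfl⟩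
  · right
    simp [termRule] at hx
    rcases hx with rfl | hx
    · omega
    obtain ⟨z, hz, b, rfl⟩ := exists_of_mem_groupTerms hj hT hx
    have := litAtom_le z b
    obtain ⟨c, hc, rfl, rfl⟩ := high_mem_groupTerms hT (by omega) hx
    exact ⟨j, c, hc, b, rfl, rfl⟩

theorem not_high_head_termRule (T : List ℕ) :
    ¬ ∃ x ∈ (termRule T).toRule.head, 7 + 4 * a ≤ x := by
  simp [ListRule.toRule, termRule]

theorem high_head_guessRule {z : ℕ} (hz : 3 + 2 * a ≤ z) :
    ∃ x ∈ (guessRule z).toRule.head, 7 + 4 * a ≤ x :=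
  ⟨litAtom z false, by simp [ListRule.toRule, guessRule], by
    have := le_litAtom z false
    omega⟩

/-- High atoms occur only in guess rules, which have them in the head, and in rules of `varTerm`
terms, which have head `0`. These are the two kinds of rules that `PathsAbove` distinguishes. -/
theorem pathsAbove_reduction (a : ℕ) (cls : List (List (Bool × ℕ))) :
    PathsAbove (reduction a cls) (7 + 4 * a) where
  two r hr := by
    obtain ⟨r, hm, rfl⟩ := mem_reduction.1 hr
    by_cases hx : ∃ x ∈ r.toRule.atoms, 7 + 4 * a ≤ x
    · obtain ⟨x, hx, hK⟩ := hx
      rcases high_atom hm hx hK with ⟨z, hz, b, rfl, rfl⟩ | ⟨j, c, hc, b, rfl, rfl⟩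
      · refine ⟨litAtom z false, litAtom z true, fun y hy _ => ?_⟩
        rw [(canonical_guessRule z).mem_atoms] at hy
        simpa [guessRule] using hy
      · refine ⟨litAtom (varIdx a j c) b, litAtom (varIdx a j c) b, fun y hy hyK => ?_⟩
        rw [or_self]
        rw [(canonical_of_mem hm).mem_atoms] at hy
        simp [termRule] at hy
        rcases hy with rfl | hy
        · omega
        rcases mem_varTerm hc hy with h | ⟨z, hz, b', h⟩
        · exact h
        · have := litAtom_le z b'
          omega
    · push Not at hx
      exact ⟨0, 0, fun y hy hyK => absurd (hx y hy) (by omega)⟩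
  one r hr hn x hx y hy hxK hyK := by
    obtain ⟨r, hm, rfl⟩ := mem_reduction.1 hr
    rcases high_atom hm hx hxK with ⟨z, hz, b, rfl, rfl⟩ | ⟨j, c, hc, b, rfl, rfl⟩
    · exact absurd (high_head_guessRule hz) hn
    · rw [(canonical_of_mem hm).mem_atoms] at hy
      simp [termRule] at hy
      rcases hy with rfl | hy
      · omega
      rcases mem_varTerm hc hy with h | ⟨z, hz, b', h⟩
      · exact h.symm
      · have := litAtom_le z b'
        omega
  unique r hr r' hr' x hK hx hx' hiff := by
    obtain ⟨r, hm, rfl⟩ := mem_reduction.1 hr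
    obtain ⟨r', hm', rfl⟩ := mem_reduction.1 hr'
    rcases high_atom hm hx hK with ⟨z, hz, b, rfl, rfl⟩ | ⟨j, c, hc, b, rfl, rfl⟩ <;>
      rcases high_atom hm' hx' hK with ⟨z', hz', b', h, rfl⟩ | ⟨j', c', hc', b', h, rfl⟩
    · rw [(litAtom_inj h).1]
    · exact absurd (hiff.1 (high_head_guessRule hz)) (not_high_head_termRule _)
    · exact absurd (hiff.2 (high_head_guessRule hz')) (not_high_head_termRule _)
    · obtain ⟨h1, rfl⟩ := litAtom_inj h
      obtain ⟨rfl, rfl⟩ := varIdx_inj hc hc' h1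
      rfl

/-- Four rules that contain the atom `i`, and otherwise only rules that are chosen for no other
atom. -/
def leafRule : ℕ → Fin 4 → ListRule
  | 0, k => negZeroRules.get (k.cast rfl)
  | i + 1, k => (starRules (i + 1)).get (k.cast rfl)

/-- The rules chosen for `0` negate `0` and those in `starRules` do not; a star rule shows its atom
and its place in the list. -/
theorem leafRule_injective {i i' : ℕ} {k k' : Fin 4} (h : leafRule i k = leafRule i' k') :
    i = i' ∧ k = k' := by
  rcases i with _ | i <;> rcases i' with _ | i' <;> fin_cases k <;> fin_cases k' <;>
    simp [leafRule, negZeroRules, starRules] at h ⊢ <;> exact h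

theorem leafRule_mem {i : ℕ} (hi : i < 7 + 4 * a) (k : Fin 4) :
    leafRule i k ∈ listRules a cls ∧ i ∈ (leafRule i k).toRule.atoms := by
  have hm : leafRule i k ∈ listRules a cls := by
    rcases i with _ | i
    · exact mem_listRules.2 (Or.inl (List.get_mem _ _))
    · obtain ⟨z, b, h⟩ := exists_litAtom (Nat.succ_ne_zero i)
      have := le_litAtom z b
      have hz : z < 3 + 2 * a := by omega
      refine starRules_mem hz (b := b) ?_
      rw [← h]
      exact List.get_mem _ _
  refine ⟨hm, ?_⟩
  rw [(canonical_of_mem hm).mem_atoms]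
  rcases i with _ | i <;> fin_cases k <;> simp [leafRule, negZeroRules, starRules]

theorem dist_reduction (a : ℕ) (cls : List (List (Bool × ℕ))) :
    (reduction a cls).dist = 7 + 4 * a ∧ reduction a cls ∈ shortPathPrograms 1 := by
  refine (pathsAbove_reduction a cls).mem_shortPathPrograms (atoms_reduction a cls)
    (by simp only [numVars]; omega) (by omega) (fun i k => (leafRule i k).toRule)
    (fun i k => mem_reduction.2 ⟨_, (leafRule_mem i.2 k).1, rfl⟩)
    (fun i k => (leafRule_mem (cls := cls) i.2 k).2) ?_
  intro i i' k k' h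
  have := leafRule_injective ((canonical_of_mem (leafRule_mem (cls := cls) i.2 k).1).toRule_injective
    (canonical_of_mem (leafRule_mem (cls := cls) i'.2 k').1) h)
  exact ⟨Fin.ext this.1, this.2⟩

/-! ### Correctness -/

/-- All literals in the list are true. -/
def Holds (η : ℕ → Bool) (T : List ℕ) : Prop := ∀ x ∈ T, ∃ z, x = litAtom z (η z)

@[simp]
theorem holds_cons {η : ℕ → Bool} {z : ℕ} {b : Bool} {T : List ℕ} :
    Holds η (litAtom z b :: T) ↔ η z = b ∧ Holds η T := by
  simp only [Holds, List.mem_cons, forall_eq_or_imp]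
  refine and_congr_left fun _ => ⟨?_, ?_⟩
  · rintro ⟨z', h⟩
    obtain ⟨rfl, h2⟩ := litAtom_inj h
    exact h2.symm
  · rintro rfl
    exact ⟨z, rfl⟩

@[simp]
theorem holds_nil {η : ℕ → Bool} : Holds η [] := by simp [Holds]

@[simp]
theorem holds_append {η : ℕ → Bool} {T T' : List ℕ} :
    Holds η (T ++ T') ↔ Holds η T ∧ Holds η T' := by
  simp only [Holds, List.mem_append]
  exact ⟨fun h => ⟨fun x hx => h x (Or.inl hx), fun x hx => h x (Or.inr hx)⟩,
    fun h x hx => hx.elim (h.1 x) (h.2 x)⟩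

@[simp]
theorem holds_bitLits {η : ℕ → Bool} {d : ℕ} :
    Holds η (bitLits a d j) ↔ ∀ b < a, η (d + b) = j.testBit b := by
  simp only [Holds, mem_bitLits]
  constructor
  · intro h b hb
    obtain ⟨z, hz⟩ := h _ ⟨b, hb, rfl⟩
    obtain ⟨rfl, h2⟩ := litAtom_inj hz
    exact h2.symm
  · rintro h _ ⟨b, hb, rfl⟩
    exact ⟨d + b, by rw [h b hb]⟩

@[simp]
theorem holds_posLits {η : ℕ → Bool} {t : ℕ} :
    Holds η (posLits t) ↔ η 0 = t.testBit 0 ∧ η 1 = t.testBit 1 := by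
  simp [posLits]

theorem exists_bits (a : ℕ) (g : ℕ → Bool) : ∃ j < 2 ^ a, ∀ b < a, g b = j.testBit b :=
  ⟨Nat.ofBits fun b : Fin a => g b, Nat.ofBits_lt_two_pow _, fun b hb => by
    rw [Nat.testBit_ofBits_lt _ _ hb]⟩

/-- The witness `ξ` consists of `x` and, for each clause, the position `t` of a literal that `x`
satisfies. Given `η`, the clause index `j` is decoded and the challenge is tested in turn: existence
of the clause, position, sign, bits of the variable index. The first failure yields a true term; if
there is none, the challenge names a true literal. -/
theorem consistent_reduction_of_satisfiable (hf : FitsIn cls a) (x : ℕ → Bool)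
    (hx : ∀ cl ∈ cls, ∃ l ∈ cl, x l.2 = l.1) : (reduction a cls).Consistent := by
  rw [(saturates_reduction a cls).consistent_iff]
  have hpos : ∀ j : ℕ, ∃ t : ℕ, ∀ cl : List (Bool × ℕ), cls[j]? = some cl →
      ∃ l, cl[t]? = some l ∧ x l.2 = l.1 := by
    intro j
    cases h : cls[j]? with
    | none => simp
    | some cl =>
      obtain ⟨l, hl, hl'⟩ := hx cl (List.mem_of_getElem? h)
      obtain ⟨t, ht⟩ := List.mem_iff_getElem?.1 hl
      refine ⟨t, fun cl' h' => ?_⟩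
      cases h'
      exact ⟨l, ht, hl'⟩
  choose t ht using hpos
  -- Inverts `varIdx`: remainder `0` is a truth value, remainders `1` and `2` are the bits of a
  -- position. The values below `3 + 2 * a`, where the subtraction truncates, are irrelevant.
  refine ⟨fun z => if (z - (3 + 2 * a)) % 3 = 0 then x ((z - (3 + 2 * a)) / 3)
    else (t ((z - (3 + 2 * a)) / 3)).testBit ((z - (3 + 2 * a)) % 3 - 1), fun η hη => ?_⟩
  have hη0 : ∀ i, η (varIdx a i 0) = x i := by
    intro i
    rw [hη _ (by simp only [varIdx]; omega)]
    have h1 : varIdx a i 0 - (3 + 2 * a) = 3 * i := by simp only [varIdx]; omega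
    simp [h1]
  have hη1 : ∀ i, ∀ c < 2, η (varIdx a i (c + 1)) = (t i).testBit c := by
    intro i c hc
    rw [hη _ (by simp only [varIdx]; omega)]
    have h1 : (varIdx a i (c + 1) - (3 + 2 * a)) % 3 = c + 1 := by simp only [varIdx]; omega
    have h2 : (varIdx a i (c + 1) - (3 + 2 * a)) / 3 = i := by simp only [varIdx]; omega
    simp [h1, h2]
  suffices h : ∃ j < 2 ^ a, ∃ T ∈ groupTerms a cls j, Holds η T by
    obtain ⟨j, hj, T, hT, h⟩ := h
    exact ⟨_, ⟨j, hj, T, hT, rfl⟩, h⟩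
  obtain ⟨j, hj, hbj⟩ := exists_bits a fun b => η (3 + b)
  cases hcl : cls[j]? with
  | none => exact ⟨j, hj, _, mem_groupTerms.2 (Or.inr (Or.inl ⟨hcl, rfl⟩)), holds_bitLits.2 hbj⟩
  | some cl =>
    by_cases hsel : ∃ c < 2, η c ≠ (t j).testBit c
    · obtain ⟨c, hc, hne⟩ := hsel
      refine ⟨j, hj, _, mem_groupTerms.2 (Or.inl ⟨c + 1, by omega, (t j).testBit c, rfl⟩), ?_⟩
      simp only [varTerm, holds_cons, holds_append, holds_bitLits, holds_nil, and_true]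
      exact ⟨Bool.eq_not.2 hne, hbj, hη1 j c hc⟩
    push Not at hsel
    obtain ⟨l, hl, hxl⟩ := ht j cl hcl
    have hmem : ∀ T ∈ literalTerms a j (t j) l, T ∈ groupTerms a cls j := fun T hT =>
      mem_groupTerms.2 (Or.inr (Or.inr ⟨cl, hcl, t j, l, hl, hT⟩))
    have hlt := hf.index_lt cl (List.mem_of_getElem? hcl) l (List.mem_of_getElem? hl)
    by_cases hs : η 2 = l.1
    · by_cases hv : ∃ b < a, η (3 + a + b) ≠ l.2.testBit b
      · obtain ⟨b, hb, hne⟩ := hv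
        refine ⟨j, hj, _, hmem _ (mem_literalTerms.2 (Or.inr ⟨b, hb, rfl⟩)), ?_⟩
        simp only [holds_posLits, holds_cons, holds_append, holds_bitLits, holds_nil, and_true]
        exact ⟨⟨hsel 0 (by omega), hsel 1 (by omega)⟩, hbj, Bool.eq_not.2 hne⟩
      · push Not at hv
        -- The challenge describes the literal faithfully, so the term comes from the group of its
        -- variable `l.2` and not from the group `j` of the clause.
        refine ⟨l.2, hlt, _, mem_groupTerms.2 (Or.inl ⟨0, by omega, l.1, rfl⟩), ?_⟩
        simp only [varTerm, holds_cons, holds_append, holds_bitLits, holds_nil, and_true]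
        exact ⟨hs, hv, (hη0 _).trans hxl⟩
    · refine ⟨j, hj, _, hmem _ (mem_literalTerms.2 (Or.inl rfl)), ?_⟩
      simp only [holds_posLits, holds_cons, holds_append, holds_bitLits]
      exact ⟨⟨hsel 0 (by omega), hsel 1 (by omega)⟩, Bool.eq_not.2 hs, hbj⟩

/-- If the assignment read off `ξ` makes clause `j` false, the challenge that states the truth about
`j`, namely the position selected by `ξ` and the literal there, falsifies every term. -/
theorem exists_assignment_of_consistent (hf : FitsIn cls a)
    (h : (reduction a cls).Consistent) :
    ∃ x : ℕ → Bool, ∀ cl ∈ cls, ∃ l ∈ cl, x l.2 = l.1 := by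
  rw [(saturates_reduction a cls).consistent_iff] at h
  obtain ⟨ξ, hξ⟩ := h
  refine ⟨fun i => ξ (varIdx a i 0), fun cl hcl => ?_⟩
  by_contra! hno
  obtain ⟨j, hcl'⟩ := List.mem_iff_getElem?.1 hcl
  have hj : j < 2 ^ a := by
    have := (List.getElem?_eq_some_iff.1 hcl').1
    have := hf.length_le
    omega
  obtain ⟨t, ht4, ht⟩ := exists_bits 2 fun c => ξ (varIdx a j (c + 1))
  obtain ⟨s, i, hi, hsi, hget⟩ : ∃ s i, i < 2 ^ a ∧ ξ (varIdx a i 0) ≠ s ∧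
      ∀ l, cl[t]? = some l → l = (s, i) := by
    cases hl : cl[t]? with
    -- When the selected position lies beyond the end of the clause, no literal term applies to it,
    -- and variable `0` with the wrong sign is a valid challenge.
    | none => exact ⟨!ξ (varIdx a 0 0), 0, by positivity, by simp, by simp⟩
    | some l =>
      have hm := List.mem_of_getElem? hl
      exact ⟨l.1, l.2, hf.index_lt cl hcl l hm, hno l hm, by simp⟩
  obtain ⟨η, hη⟩ : ∃ η : ℕ → Bool, ∀ z, η z = if z < 2 then t.testBit z
    else if z = 2 then s else if z < 3 + a then j.testBit (z - 3)
    else if z < 3 + 2 * a then i.testBit (z - (3 + a)) else ξ z := ⟨_, fun _ => rfl⟩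
  have h6 : ∀ z ≥ 3 + 2 * a, η z = ξ z := by
    intro z hz
    rw [hη, if_neg (by omega), if_neg (by omega), if_neg (by omega), if_neg (by omega)]
  obtain ⟨_, ⟨j', hj', T, hT, rfl⟩, hH⟩ := hξ η h6
  replace hH : Holds η T := hH
  have h0 : ∀ c < 2, η c = t.testBit c := by
    intro c hc; rw [hη, if_pos hc]
  have h2 : η 2 = s := by simp [hη]
  have h3 : ∀ b < a, η (3 + b) = j.testBit b := by
    intro b hb
    rw [hη, if_neg (by omega), if_neg (by omega), if_pos (by omega)]
    congr 1; omega
  have h4 : ∀ b < a, η (3 + a + b) = i.testBit b := by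
    intro b hb
    rw [hη, if_neg (by omega), if_neg (by omega), if_neg (by omega), if_pos (by omega)]
    congr 1; omega
  have h5 : ∀ i c, η (varIdx a i c) = ξ (varIdx a i c) := by
    intro i c
    exact h6 _ (by simp only [varIdx]; omega)
  have huniq : ∀ j' < 2 ^ a, (∀ b < a, η (3 + b) = j'.testBit b) → j' = j := fun j' hj' h =>
    eq_of_testBit_eq hj' hj fun b hb => (h b hb).symm.trans (h3 b hb)
  rcases mem_groupTerms.1 hT with ⟨c, hc, b, rfl⟩ | ⟨hnone, rfl⟩ | ⟨cl', hcl2, t', l, hl, hT⟩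
  · rcases c with _ | c
    · simp only [varTerm, holds_cons, holds_append, holds_bitLits, holds_nil, and_true, h5] at hH
      obtain ⟨e1, e2, e3⟩ := hH
      obtain rfl : j' = i := eq_of_testBit_eq hj' hi fun b hb => (e2 b hb).symm.trans (h4 b hb)
      exact hsi (e3.trans (e1.symm.trans h2))
    · simp only [varTerm, holds_cons, holds_append, holds_bitLits, holds_nil, and_true, h5] at hH
      obtain ⟨e1, e2, e3⟩ := hH
      obtain rfl := huniq j' hj' e2
      have := ht c (by omega)
      rw [h0 c (by omega), ← this, e3] at e1
      simp at e1
  · obtain rfl := huniq j' hj' (holds_bitLits.1 hH)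
    simp [hnone] at hcl'
  · have hpos : ∀ c < 2, η c = t'.testBit c := by
      rcases mem_literalTerms.1 hT with rfl | ⟨b', hb', rfl⟩ <;>
      · simp only [holds_append, holds_posLits] at hH
        intro c hc
        interval_cases c
        exacts [hH.1.1, hH.1.2]
    have hj3 : ∀ b < a, η (3 + b) = j'.testBit b := by
      rcases mem_literalTerms.1 hT with rfl | ⟨b', hb', rfl⟩ <;>
        simp only [holds_append, holds_cons, holds_bitLits] at hH
      exacts [hH.2.2, hH.2.1]
    obtain rfl := huniq j' hj' hj3
    rw [hcl'] at hcl2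
    cases hcl2
    -- Clauses have at most three literals, so the two position bits determine `t'`.
    have ht' : t' < 2 ^ 2 := by
      have := hf.clause_length cl hcl
      have := (List.getElem?_eq_some_iff.1 hl).1
      omega
    obtain rfl : t' = t := eq_of_testBit_eq ht' ht4 fun c hc => (hpos c hc).symm.trans (h0 c hc)
    obtain rfl := hget l hl
    rcases mem_literalTerms.1 hT with rfl | ⟨b', hb', rfl⟩ <;>
      simp only [holds_append, holds_cons, holds_bitLits] at hH
    · exact absurd (h2.symm.trans hH.2.1) (by simp)
    · exact absurd ((h4 b' hb').symm.trans hH.2.2.1) (by simp)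

theorem consistent_reduction_iff (hf : FitsIn cls a) :
    (reduction a cls).Consistent ↔ ∃ x : ℕ → Bool, ∀ cl ∈ cls, ∃ l ∈ cl, x l.2 = l.1 :=
  ⟨exists_assignment_of_consistent hf, fun ⟨x, hx⟩ => consistent_reduction_of_satisfiable hf x hx⟩

end ASP

/-! ### Computability: compiling structured programs and composing with a machine -/

namespace ASP

/-! ### Structured programs on stacks -/

section Machine

open Turing Turing.TM2 StateTransition

variable {κ : Type} {Δ : κ → Type}

/-- Structured programs that operate on stacks `Δ k`. -/
inductive Cmd (Δ : κ → Type) : Type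
  | skip : Cmd Δ
  | push (k : κ) (x : Δ k) : Cmd Δ
  | pop (k : κ) : Cmd Δ
  | seq (c d : Cmd Δ) : Cmd Δ
  | ite (k : κ) (p : Option (Δ k) → Bool) (c d : Cmd Δ) : Cmd Δ
  | loop (k : κ) (p : Option (Δ k) → Bool) (c : Cmd Δ) : Cmd Δ

/-- The program `c` transforms the stacks `S` into `S'` in at most `t` steps. -/
inductive Exec [DecidableEq κ] :
    Cmd Δ → (∀ k, List (Δ k)) → (∀ k, List (Δ k)) → ℕ → Prop
  | skip (S) : Exec .skip S S 1
  | push (k x S) : Exec (.push k x) S (Function.update S k (x :: S k)) 1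
  | pop (k S) : Exec (.pop k) S (Function.update S k (S k).tail) 1
  | seq {c d S S' S'' t t'} : Exec c S S' t → Exec d S' S'' t' → Exec (.seq c d) S S'' (t + t')
  | ite_true {k p c d S S' t} : p (S k).head? = true → Exec c S S' t →
      Exec (.ite k p c d) S S' (1 + t)
  | ite_false {k p c d S S' t} : p (S k).head? = false → Exec d S S' t →
      Exec (.ite k p c d) S S' (1 + t)
  | loop_true {k p c S S' S'' t t'} : p (S k).head? = true → Exec c S S' t →
      Exec (.loop k p c) S' S'' t' → Exec (.loop k p c) S S'' (1 + t + t')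
  | loop_false {k p c S} : p (S k).head? = false → Exec (.loop k p c) S S 1
  | mono {c S S' t t'} : Exec c S S' t → t ≤ t' → Exec c S S' t'

/-- The labels of the machine code of a program. -/
def Cmd.Label : Cmd Δ → Type
  | .skip => Unit
  | .push _ _ => Unit
  | .pop _ => Unit
  | .seq c d => c.Label ⊕ d.Label
  | .ite _ _ c d => Option (c.Label ⊕ d.Label)
  | .loop _ _ c => Option c.Label

/-- There are finitely many labels. -/
@[reducible]
def Cmd.fintypeLabel : (c : Cmd Δ) → Fintype c.Label
  | .skip => inferInstanceAs (Fintype Unit)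
  | .push _ _ => inferInstanceAs (Fintype Unit)
  | .pop _ => inferInstanceAs (Fintype Unit)
  | .seq c d =>
    letI := c.fintypeLabel
    letI := d.fintypeLabel
    inferInstanceAs (Fintype (c.Label ⊕ d.Label))
  | .ite _ _ c d =>
    letI := c.fintypeLabel
    letI := d.fintypeLabel
    inferInstanceAs (Fintype (Option (c.Label ⊕ d.Label)))
  | .loop _ _ c =>
    letI := c.fintypeLabel
    inferInstanceAs (Fintype (Option c.Label))

/-- The label at which a program starts. -/
def Cmd.entry : (c : Cmd Δ) → c.Label
  | .skip => ()
  | .push _ _ => ()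
  | .pop _ => ()
  | .seq c _ => Sum.inl c.entry
  | .ite _ _ _ _ => none
  | .loop _ _ _ => none

variable {κ' : Type} {Δ' : κ' → Type} {τ Λ : Type}

/-- The alphabets of two families of stacks side by side. -/
@[reducible]
def SumAlphabet (Δ : κ → Type) (Δ' : κ' → Type) : κ ⊕ κ' → Type
  | .inl k => Δ k
  | .inr k => Δ' k

/-- The machine code of a program, for a machine that has further stacks and whose states have a
further component. -/
def Cmd.code : (c : Cmd Δ) → (c.Label → Λ) → Λ → c.Label → Stmt (SumAlphabet Δ Δ') Λ (Bool × τ)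
  | .skip, _, exit, _ => .goto fun _ => exit
  | .push k x, _, exit, _ => .push (Sum.inl k) (fun _ => x) (.goto fun _ => exit)
  | .pop k, _, exit, _ => .pop (Sum.inl k) (fun v _ => v) (.goto fun _ => exit)
  | .seq c d, emb, exit, l =>
    match (l : c.Label ⊕ d.Label) with
    | .inl l => c.code (fun l => emb (Sum.inl l)) (emb (Sum.inr d.entry)) l
    | .inr l => d.code (fun l => emb (Sum.inr l)) exit l
  | .ite k p c d, emb, exit, l =>
    match (l : Option (c.Label ⊕ d.Label)) with
    | none => .peek (Sum.inl k) (fun v o => (p o, v.2)) (.branch (fun v => v.1)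
        (.goto fun _ => emb (some (Sum.inl c.entry))) (.goto fun _ => emb (some (Sum.inr d.entry))))
    | some (.inl l) => c.code (fun l => emb (some (Sum.inl l))) exit l
    | some (.inr l) => d.code (fun l => emb (some (Sum.inr l))) exit l
  | .loop k p c, emb, exit, l =>
    match (l : Option c.Label) with
    | none => .peek (Sum.inl k) (fun v o => (p o, v.2)) (.branch (fun v => v.1)
        (.goto fun _ => emb (some c.entry)) (.goto fun _ => exit))
    | some l => c.code (fun l => emb (some l)) (emb none) l

/-- Two families of stacks side by side. -/
def sumStacks (S : ∀ k, List (Δ k)) (S' : ∀ k, List (Δ' k)) :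
    ∀ k : κ ⊕ κ', List (SumAlphabet Δ Δ' k)
  | .inl k => S k
  | .inr k => S' k

variable [DecidableEq κ] [DecidableEq κ']

theorem update_sumStacks_inl (S : ∀ k, List (Δ k)) (S' : ∀ k, List (Δ' k)) (k : κ)
    (l : List (Δ k)) : Function.update (sumStacks S S') (Sum.inl k) l =
      sumStacks (Function.update S k l) S' := by
  funext x
  rcases x with x | x
  · by_cases h : x = k
    · subst h
      exact (Function.update_self ..).trans (Function.update_self x l S).symm
    · exact (Function.update_of_ne (by simpa using h) ..).trans (Function.update_of_ne h ..).symm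
  · exact Function.update_of_ne (by simp) ..

theorem update_sumStacks_inr (S : ∀ k, List (Δ k)) (S' : ∀ k, List (Δ' k)) (k : κ')
    (l : List (Δ' k)) : Function.update (sumStacks S S') (Sum.inr k) l =
      sumStacks S (Function.update S' k l) := by
  funext x
  rcases x with x | x
  · exact Function.update_of_ne (by simp) ..
  · by_cases h : x = k
    · subst h
      exact (Function.update_self ..).trans (Function.update_self x l S').symm
    · exact (Function.update_of_ne (by simpa using h) ..).trans (Function.update_of_ne h ..).symm

/-- The machine gets from one configuration to another in at most `t` steps. -/
def ReachesIn {K : Type} [DecidableEq K] {Γ : K → Type} {Λ σ : Type} (M : Λ → Stmt Γ Λ σ)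
    (c c' : Cfg Γ Λ σ) (t : ℕ) : Prop :=
  Nonempty (EvalsToInTime (step M) c (some c') t)

section

variable {K : Type} [DecidableEq K] {Γ : K → Type} {Λ σ : Type} {M : Λ → Stmt Γ Λ σ}
  {c c' c'' : Cfg Γ Λ σ} {t t' : ℕ}

theorem ReachesIn.trans (h : ReachesIn M c c' t) (h' : ReachesIn M c' c'' t') :
    ReachesIn M c c'' (t + t') := by
  obtain ⟨h⟩ := h
  obtain ⟨h'⟩ := h'
  rw [add_comm]
  exact ⟨EvalsToInTime.trans _ _ _ _ _ _ h h'⟩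

theorem ReachesIn.mono (h : ReachesIn M c c' t) (ht : t ≤ t') : ReachesIn M c c' t' := by
  obtain ⟨h⟩ := h
  exact ⟨⟨h.toEvalsTo, h.steps_le_m.trans ht⟩⟩

theorem ReachesIn.single (h : step M c = some c') : ReachesIn M c c' 1 :=
  ⟨⟨⟨1, h⟩, le_rfl⟩⟩

end

theorem stepAux_test (k : κ) (p : Option (Δ k) → Bool) (l l' : Λ) (b : Bool) (v : τ)
    (S : ∀ k, List (Δ k)) (R : ∀ k, List (Δ' k)) :
    stepAux (Γ := SumAlphabet Δ Δ') (.peek (Sum.inl k) (fun v o => (p o, v.2))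
      (.branch (fun v => v.1) (.goto fun _ => l) (.goto fun _ => l'))) (b, v) (sumStacks S R) =
      ⟨some (bif p (S k).head? then l else l'), (p (S k).head?, v), sumStacks S R⟩ := by
  change (bif p (S k).head? then (⟨some l, (p (S k).head?, v), _⟩ : Cfg _ _ _)
    else ⟨some l', (p (S k).head?, v), _⟩) = _
  cases p (S k).head? <;> rfl

/-- Simulation by induction on the execution. The embedding of labels and the exit label are
arbitrary, so that the code of a subprogram can be placed inside a larger one. The Boolean in the
state only carries the result of the last test, so its final value is left open. -/
theorem reachesIn_of_exec {c : Cmd Δ} {S S' : ∀ k, List (Δ k)} {t : ℕ} (h : Exec c S S' t)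
    (M : Λ → Stmt (SumAlphabet Δ Δ') Λ (Bool × τ)) (v : τ) (R : ∀ k, List (Δ' k)) :
    ∀ (emb : c.Label → Λ) (exit : Λ), (∀ l, M (emb l) = c.code emb exit l) →
    ∀ b, ∃ b', ReachesIn M ⟨some (emb c.entry), (b, v), sumStacks S R⟩
      ⟨some exit, (b', v), sumStacks S' R⟩ t := by
  induction h with
  | skip S =>
    intro emb exit hM b
    refine ⟨b, .single ?_⟩
    rw [step, hM]
    simp only [Cmd.code, stepAux]
  | push k x S =>
    intro emb exit hM b
    refine ⟨b, .single ?_⟩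
    rw [step, hM]
    simp only [Cmd.code, stepAux]
    rw [← update_sumStacks_inl]
    rfl
  | pop k S =>
    intro emb exit hM b
    refine ⟨b, .single ?_⟩
    rw [step, hM]
    simp only [Cmd.code, stepAux]
    rw [← update_sumStacks_inl]
    rfl
  | @seq c d S S' S'' t t' _ _ ih1 ih2 =>
    intro emb exit hM b
    obtain ⟨b', h1⟩ := ih1 (fun l => emb (Sum.inl l)) (emb (Sum.inr d.entry))
      (fun l => hM (Sum.inl l)) b
    obtain ⟨b'', h2⟩ := ih2 (fun l => emb (Sum.inr l)) exit (fun l => hM (Sum.inr l)) b'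
    exact ⟨b'', h1.trans h2⟩
  | @ite_true k p c d S S' t hp _ ih =>
    intro emb exit hM b
    obtain ⟨b', h⟩ := ih (fun l => emb (some (Sum.inl l))) exit
      (fun l => hM (some (Sum.inl l))) true
    refine ⟨b', ReachesIn.trans (.single ?_) h⟩
    rw [step, hM]
    refine congrArg some ((stepAux_test k p _ _ b v S R).trans ?_)
    rw [hp]
    rfl
  | @ite_false k p c d S S' t hp _ ih =>
    intro emb exit hM b
    obtain ⟨b', h⟩ := ih (fun l => emb (some (Sum.inr l))) exit
      (fun l => hM (some (Sum.inr l))) false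
    refine ⟨b', ReachesIn.trans (.single ?_) h⟩
    rw [step, hM]
    refine congrArg some ((stepAux_test k p _ _ b v S R).trans ?_)
    rw [hp]
    rfl
  | @loop_true k p c S S' S'' t t' hp _ _ ih1 ih2 =>
    intro emb exit hM b
    obtain ⟨b', h1⟩ := ih1 (fun l => emb (some l)) (emb none) (fun l => hM (some l)) true
    obtain ⟨b'', h2⟩ := ih2 emb exit hM b'
    refine ⟨b'', ReachesIn.trans (ReachesIn.trans (.single ?_) h1) h2⟩
    rw [step, hM]
    refine congrArg some ((stepAux_test k p _ _ b v S R).trans ?_)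
    rw [hp]
    rfl
  | @loop_false k p c S hp =>
    intro emb exit hM b
    refine ⟨false, .single ?_⟩
    rw [step, hM]
    refine congrArg some ((stepAux_test k p _ _ b v S R).trans ?_)
    rw [hp]
    rfl
  | mono _ hle ih =>
    intro emb exit hM b
    obtain ⟨b', h⟩ := ih emb exit hM b
    exact ⟨b', h.mono hle⟩

/-! ### A structured program followed by a machine -/

/-- A statement of a machine, for a machine that has further stacks and whose states have further
components. -/
def liftStmt {σ Λ' : Type} (emb : Λ → Λ') :
    Stmt Δ' Λ σ → Stmt (SumAlphabet Δ Δ') Λ' (Bool × τ × σ)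
  | .push k f q => .push (Sum.inr k) (fun v => f v.2.2) (liftStmt emb q)
  | .peek k f q => .peek (Sum.inr k) (fun v o => (v.1, v.2.1, f v.2.2 o)) (liftStmt emb q)
  | .pop k f q => .pop (Sum.inr k) (fun v o => (v.1, v.2.1, f v.2.2 o)) (liftStmt emb q)
  | .load f q => .load (fun v => (v.1, v.2.1, f v.2.2)) (liftStmt emb q)
  | .branch f q q' => .branch (fun v => f v.2.2) (liftStmt emb q) (liftStmt emb q')
  | .goto f => .goto fun v => emb (f v.2.2)
  | .halt => .halt

/-- A configuration of a machine, as a configuration of a machine with further stacks. -/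
def liftCfg {σ Λ' : Type} (emb : Λ → Λ') (b : Bool) (x : τ) (S : ∀ k, List (Δ k))
    (c : Cfg Δ' Λ σ) : Cfg (SumAlphabet Δ Δ') Λ' (Bool × τ × σ) :=
  ⟨c.l.map emb, (b, x, c.var), sumStacks S c.stk⟩

theorem stepAux_liftStmt {σ Λ' : Type} (emb : Λ → Λ') (b : Bool) (x : τ) (S : ∀ k, List (Δ k))
    (q : Stmt Δ' Λ σ) : ∀ (v : σ) (R : ∀ k, List (Δ' k)),
    stepAux (liftStmt emb q) (b, x, v) (sumStacks S R) = liftCfg emb b x S (stepAux q v R) := by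
  induction q with
  | push k f q ih =>
    intro v R
    simp only [liftStmt, stepAux]
    rw [← ih, ← update_sumStacks_inr]
    rfl
  | peek k f q ih =>
    intro v R
    simp only [liftStmt, stepAux]
    rw [← ih]
    rfl
  | pop k f q ih =>
    intro v R
    simp only [liftStmt, stepAux]
    rw [← ih, ← update_sumStacks_inr]
    rfl
  | load f q ih =>
    intro v R
    simp only [liftStmt, stepAux]
    rw [← ih]
  | branch f q q' ih ih' =>
    intro v R
    simp only [liftStmt, stepAux]
    cases f v
    · exact ih' v R
    · exact ih v R
  | goto f => intro v R; rfl
  | halt => intro v R; rfl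

/-- The iteration runs on optional configurations, so halting is covered as well and a whole run of
the second machine transfers at once. -/
theorem iterate_lift {σ Λ' : Type} {emb : Λ → Λ'} {b : Bool} {x : τ} {S : ∀ k, List (Δ k)}
    {M : Λ → Stmt Δ' Λ σ} {M' : Λ' → Stmt (SumAlphabet Δ Δ') Λ' (Bool × τ × σ)}
    (hM : ∀ l, M' (emb l) = liftStmt emb (M l)) (n : ℕ) (o : Option (Cfg Δ' Λ σ)) :
    (flip Bind.bind (step M'))^[n] (o.map (liftCfg emb b x S)) =
      ((flip Bind.bind (step M))^[n] o).map (liftCfg emb b x S) := by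
  induction n generalizing o with
  | zero => rfl
  | succ n ih =>
    rw [Function.iterate_succ_apply, Function.iterate_succ_apply, ← ih]
    congr 1
    rcases o with _ | ⟨_ | l, v, R⟩
    · rfl
    · rfl
    · change some (stepAux (M' (emb l)) _ _) = some _
      rw [hM]
      exact congrArg some (stepAux_liftStmt emb b x S (M l) v R)

/-- The code that moves the stack `k` to the stack `k'` of the second machine. -/
def moveStmt (k : κ) [Inhabited (Δ k)] (k' : κ') (e : Δ k → Δ' k') {σ : Type} (self next : Λ) :
    Stmt (SumAlphabet Δ Δ') Λ (Bool × Option (Δ k) × σ) :=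
  .pop (Sum.inl k) (fun v o => (o.isSome, o, v.2.2)) (.branch (fun v => v.1)
    (.push (Sum.inr k') (fun v => e (v.2.1.getD default)) (.goto fun _ => self))
    (.goto fun _ => next))

/-- Popping from one stack and pushing onto the other reverses the content. The auxiliary components
end as `false` and `none`, the values of the initial state, which a halting configuration has to
show again. -/
theorem reachesIn_move {k : κ} [Inhabited (Δ k)] {k' : κ'} {e : Δ k → Δ' k'} {σ : Type}
    {M : Λ → Stmt (SumAlphabet Δ Δ') Λ (Bool × Option (Δ k) × σ)} {self next : Λ}
    (hM : M self = moveStmt k k' e self next) (s : σ) (l : List (Δ k)) :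
    ∀ (b : Bool) (o : Option (Δ k)) (l' : List (Δ' k')),
    ReachesIn M
      ⟨some self, (b, o, s), sumStacks (Function.update (fun _ => []) k l)
        (Function.update (fun _ => []) k' l')⟩
      ⟨some next, (false, none, s), sumStacks (fun _ => [])
        (Function.update (fun _ => []) k' (l.reverse.map e ++ l'))⟩ (l.length + 1) := by
  induction l with
  | nil =>
    intro b o l'
    refine .single ?_
    rw [step, hM]
    have hk : sumStacks (Δ := Δ) (Δ' := Δ') (Function.update (fun _ => []) k [])
        (Function.update (fun _ => []) k' l') (Sum.inl k) = [] :=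
      Function.update_self (β := fun k => List (Δ k)) k [] fun _ => []
    simp only [moveStmt, stepAux]
    rw [hk]
    refine congrArg some (congrArg (Cfg.mk _ _) ?_)
    refine (update_sumStacks_inl _ _ _ _).trans ?_
    rw [Function.update_idem]
    exact congrArg₂ sumStacks (Function.update_eq_self_iff.2 rfl) rfl
  | cons x l ih =>
    intro b o l'
    have := ih true (some x) (e x :: l')
    rw [List.length_cons, add_comm _ 1]
    refine ReachesIn.trans (.single ?_) (by simpa using this)
    rw [step, hM]
    have hk : sumStacks (Δ := Δ) (Δ' := Δ') (Function.update (fun _ => []) k (x :: l))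
        (Function.update (fun _ => []) k' l') (Sum.inl k) = x :: l :=
      Function.update_self (β := fun k => List (Δ k)) k (x :: l) fun _ => []
    simp only [moveStmt, stepAux]
    rw [hk]
    refine congrArg some (congrArg (Cfg.mk _ _) ?_)
    have h1 := update_sumStacks_inl (Function.update (fun _ => []) k (x :: l))
      (Function.update (fun _ => []) k' l') k l
    have h2 := update_sumStacks_inr (Function.update (fun _ => []) k l)
      (Function.update (fun _ => []) k' l') k' (e x :: l')
    rw [Function.update_idem] at h1 h2
    rw [← h2]
    change Function.update (Function.update (sumStacks _ _) (Sum.inl k) l) _ _ = _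
    rw [h1]
    refine congrArg _ (congrArg (List.cons (e x)) ?_)
    exact (congrFun h1 (Sum.inr k')).trans
      (Function.update_self (β := fun k => List (Δ' k)) k' l' fun _ => [])

variable [Fintype κ]

/-- The machine that executes the program `c`, moves the stack `kout` to the input stack of the
machine `M` and then runs `M`. -/
def preMachine (c : Cmd Δ) (kin kout : κ) [Fintype (Δ kin)] [Fintype (Δ kout)] [Inhabited (Δ kout)]
    (M : FinTM2) (e : Δ kout → M.Γ M.k₀) : FinTM2 :=
  letI := M.kFin
  letI := M.ΛFin
  letI := M.σFin
  letI := c.fintypeLabel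
  { K := κ ⊕ M.K
    k₀ := Sum.inl kin
    k₁ := Sum.inr M.k₁
    Γ := SumAlphabet Δ M.Γ
    Λ := c.Label ⊕ Unit ⊕ M.Λ
    main := Sum.inl c.entry
    σ := Bool × Option (Δ kout) × M.σ
    initialState := (false, none, M.initialState)
    Γk₀Fin := inferInstanceAs (Fintype (Δ kin))
    m := fun l => match l with
      | .inl l => c.code Sum.inl (Sum.inr (Sum.inl ())) l
      | .inr (.inl _) => moveStmt kout M.k₀ e (Sum.inr (Sum.inl ())) (Sum.inr (Sum.inr M.main))
      | .inr (.inr l) => liftStmt (fun l => Sum.inr (Sum.inr l)) (M.m l) }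

theorem initList_eq (M : FinTM2) (s : List (M.Γ M.k₀)) :
    initList M s = ⟨some M.main, M.initialState, Function.update (fun _ => []) M.k₀ s⟩ := by
  unfold initList
  congr 1
  funext k
  by_cases h : k = M.k₀
  · subst h; simp
  · simp [h]

theorem haltList_eq (M : FinTM2) (s : List (M.Γ M.k₁)) :
    haltList M s = ⟨none, M.initialState, Function.update (fun _ => []) M.k₁ s⟩ := by
  unfold haltList
  congr 1
  funext k
  by_cases h : k = M.k₁
  · subst h; simp
  · simp [h]

/-- The three phases run one after the other. The program must leave all stacks but `kout` empty,
since initial and halting configurations of the machine `M` prescribe empty stacks; the reversal of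
`out` comes from the move. -/
theorem preMachine_outputs {c : Cmd Δ} {kin kout : κ} [Fintype (Δ kin)] [Fintype (Δ kout)]
    [Inhabited (Δ kout)] {M : FinTM2} {e : Δ kout → M.Γ M.k₀} {w : List (Δ kin)}
    {out : List (Δ kout)} {res : List (M.Γ M.k₁)} {t t' : ℕ}
    (hc : Exec c (Function.update (fun _ => []) kin w) (Function.update (fun _ => []) kout out) t)
    (hM : Nonempty (TM2OutputsInTime M (out.reverse.map e) (some res) t')) :
    Nonempty (TM2OutputsInTime (preMachine c kin kout M e) w (some res)
      (t + (out.length + 1) + t')) := by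
  obtain ⟨hM⟩ := hM
  set M' := preMachine c kin kout M e with hM'
  obtain ⟨b, h1⟩ := reachesIn_of_exec hc M'.m (none, M.initialState) (fun _ => []) Sum.inl
    (Sum.inr (Sum.inl ())) (fun _ => rfl) false
  have h2 := reachesIn_move (M := M'.m) (k := kout) (k' := M.k₀) (e := e)
    (self := Sum.inr (Sum.inl ())) (next := Sum.inr (Sum.inr M.main)) rfl M.initialState out b
    none []
  rw [Function.update_eq_self_iff.2 rfl, List.append_nil] at h2
  have h3 : ReachesIn M'.m (liftCfg (fun l => Sum.inr (Sum.inr l)) false none (fun _ => [])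
      (initList M (out.reverse.map e))) (liftCfg (fun l => Sum.inr (Sum.inr l)) false none
      (fun _ => []) (haltList M res)) t' := by
    refine ⟨⟨⟨hM.steps, ?_⟩, hM.steps_le_m⟩⟩
    have h := iterate_lift (M := M.m) (M' := M'.m) (emb := fun l => Sum.inr (Sum.inr l)) (b := false)
      (x := (none : Option (Δ kout))) (S := fun _ => []) (fun _ => rfl) hM.steps
      (some (initList M (out.reverse.map e)))
    refine h.trans ?_
    exact congrArg (Option.map _) hM.evals_in_steps
  rw [initList_eq, haltList_eq] at h3
  have e1 := update_sumStacks_inl (Δ := Δ) (Δ' := M.Γ) (fun _ => []) (fun _ => []) kin w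
  have e2 := update_sumStacks_inr (Δ := Δ) (Δ' := M.Γ) (fun _ => []) (fun _ => []) M.k₁ res
  have e3 : sumStacks (Δ := Δ) (Δ' := M.Γ) (fun _ => []) (fun _ => []) = fun _ => [] := by
    funext k; rcases k with k | k <;> rfl
  rw [e3] at e1 e2
  have h4 := (h1.trans h2).trans h3
  rw [← e1] at h4
  simp only [liftCfg] at h4
  rw [← e2] at h4
  have hi := initList_eq M' w
  have hh := haltList_eq M' res
  change Nonempty (EvalsToInTime (step M'.m) (initList M' w) (some (haltList M' res)) _)
  rw [hi, hh]
  exact h4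

end Machine

end ASP

/-! ### A calculus of polynomial-time stack programs -/

namespace ASP

/-! ### The stacks of the reduction -/

/-- The counters of the reduction: `bits`, `bits₁`, `bits₂` hold the number `a` of bits, `rest` and
`idx` the numbers of groups that are still to be written and that have been written, `lit` the index
of a variable; the other ones are auxiliary. -/
inductive Ctr
  | bits | bits₁ | done₁ | bits₂ | done₂ | rest | idx | copy | lit | half | flag | temp
  deriving DecidableEq

/-- The stacks of the reduction. -/
inductive Reg
  | inp | sav | out
  | ctr (c : Ctr)
  deriving DecidableEq

noncomputable instance : Fintype Reg := by
  classical
  exact Fintype.ofList ([.inp, .sav, .out] ++ List.map Reg.ctr [.bits, .bits₁, .done₁, .bits₂,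
    .done₂, .rest, .idx, .copy, .lit, .half, .flag, .temp]) (by
      rintro (_ | _ | _ | (_ | _)) <;> simp)

noncomputable instance : Fintype CNFSymbol := by
  classical
  exact Fintype.ofList [.clause, .pos, .neg, .one] (by rintro (_ | _) <;> simp)

noncomputable instance : Fintype ProgramSymbol := by
  classical
  exact Fintype.ofList [.rule, .head, .pos, .neg, .one] (by rintro (_ | _) <;> simp)

instance : Inhabited ProgramSymbol := ⟨.rule⟩

/-- The alphabets of the stacks. -/
@[reducible]
def RegAlphabet : Reg → Type
  | .inp => CNFSymbol
  | .sav => CNFSymbol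
  | .out => ProgramSymbol
  | .ctr _ => Unit

/-- The programs of the reduction. -/
abbrev Prog : Type := Cmd RegAlphabet

/-- The contents of the stacks other than the output. -/
@[ext]
structure Mem where
  inp : List CNFSymbol
  sav : List CNFSymbol
  ctr : Ctr → ℕ

namespace Mem

/-- The contents of the stacks, as a family. -/
def tapes (m : Mem) (o : List ProgramSymbol) : ∀ r, List (RegAlphabet r)
  | .inp => m.inp
  | .sav => m.sav
  | .out => o
  | .ctr c => List.replicate (m.ctr c) ()

/-- Change a counter. -/
def set (m : Mem) (c : Ctr) (n : ℕ) : Mem := { m with ctr := Function.update m.ctr c n }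

@[simp] theorem ctr_set (m : Mem) (c d : Ctr) (n : ℕ) :
    (m.set c n).ctr d = if d = c then n else m.ctr d := Function.update_apply ..

@[simp] theorem inp_set (m : Mem) (c : Ctr) (n : ℕ) : (m.set c n).inp = m.inp := rfl

@[simp] theorem sav_set (m : Mem) (c : Ctr) (n : ℕ) : (m.set c n).sav = m.sav := rfl

theorem ext_ctr {m m' : Mem} (h1 : m.inp = m'.inp) (h2 : m.sav = m'.sav)
    (h3 : ∀ c, m.ctr c = m'.ctr c) : m = m' := Mem.ext h1 h2 (funext h3)

/-- The stacks have at most `N` entries. -/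
structure Bdd (m : Mem) (N : ℕ) : Prop where
  inp : m.inp.length ≤ N
  sav : m.sav.length ≤ N
  ctr : ∀ c, m.ctr c ≤ N

theorem Bdd.mono {m : Mem} {N N' : ℕ} (h : m.Bdd N) (hN : N ≤ N') : m.Bdd N' :=
  ⟨h.inp.trans hN, h.sav.trans hN, fun c => (h.ctr c).trans hN⟩

theorem Bdd.set {m : Mem} {N n : ℕ} {c : Ctr} (h : m.Bdd N) (hn : n ≤ N) : (m.set c n).Bdd N :=
  ⟨h.inp, h.sav, fun d => by rw [ctr_set]; split_ifs; exacts [hn, h.ctr d]⟩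

theorem tapes_out (m : Mem) (o o' : List ProgramSymbol) :
    Function.update (m.tapes o) .out o' = m.tapes o' := by
  funext r
  rcases r with _ | _ | _ | c
  · exact Function.update_of_ne (by simp) ..
  · exact Function.update_of_ne (by simp) ..
  · exact Function.update_self (β := fun r => List (RegAlphabet r)) Reg.out o' (m.tapes o)
  · exact Function.update_of_ne (by simp) ..

theorem tapes_inp (m : Mem) (o : List ProgramSymbol) (w : List CNFSymbol) :
    Function.update (m.tapes o) .inp w = { m with inp := w }.tapes o := by
  funext r
  rcases r with _ | _ | _ | c
  · exact Function.update_self (β := fun r => List (RegAlphabet r)) Reg.inp w (m.tapes o)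
  all_goals exact Function.update_of_ne (by simp) ..

theorem tapes_sav (m : Mem) (o : List ProgramSymbol) (w : List CNFSymbol) :
    Function.update (m.tapes o) .sav w = { m with sav := w }.tapes o := by
  funext r
  rcases r with _ | _ | _ | c
  · exact Function.update_of_ne (by simp) ..
  · exact Function.update_self (β := fun r => List (RegAlphabet r)) Reg.sav w (m.tapes o)
  all_goals exact Function.update_of_ne (by simp) ..

theorem tapes_set (m : Mem) (o : List ProgramSymbol) (c : Ctr) (n : ℕ) :
    Function.update (m.tapes o) (.ctr c) (List.replicate n ()) = (m.set c n).tapes o := by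
  funext r
  rcases r with _ | _ | _ | d
  · exact Function.update_of_ne (by simp) ..
  · exact Function.update_of_ne (by simp) ..
  · exact Function.update_of_ne (by simp) ..
  · by_cases h : d = c
    · subst h
      rw [Function.update_self]
      simp [tapes]
    · rw [Function.update_of_ne (by simpa using h)]
      simp [tapes, h]

theorem tapes_of_ne (m : Mem) (o o' : List ProgramSymbol) {r : Reg} (hr : r ≠ .out) :
    m.tapes o r = m.tapes o' r := by
  rcases r with _ | _ | _ | c <;> first | rfl | exact absurd rfl hr

theorem isSome_head_ctr (m : Mem) (o : List ProgramSymbol) (c : Ctr) :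
    (m.tapes o (.ctr c)).head?.isSome = decide (m.ctr c ≠ 0) := by
  change (List.replicate (m.ctr c) ()).head?.isSome = _
  cases m.ctr c <;> simp [List.replicate_succ]

/-- Increase counters. -/
def add (m : Mem) (D : List Ctr) (n : ℕ) : Mem :=
  { m with ctr := fun c => m.ctr c + if c ∈ D then n else 0 }

@[simp] theorem ctr_add (m : Mem) (D : List Ctr) (c : Ctr) (n : ℕ) :
    (m.add D n).ctr c = m.ctr c + if c ∈ D then n else 0 := rfl

end Mem

/-- A relation between the initial and final stacks and the string that is written. -/
abbrev Spec : Type := Mem → Mem → List ProgramSymbol → Prop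

/-- The program `c` fulfils the specification `R`, in polynomial time. -/
def Does (c : Prog) (R : Spec) : Prop :=
  ∃ p : Polynomial ℕ, ∀ N m m' w, R m m' w → m.Bdd N →
    (∀ o, Exec c (m.tapes o) (m'.tapes (w.reverse ++ o)) (p.eval N)) ∧
    m'.Bdd (p.eval N) ∧ w.length ≤ p.eval N

/-- The program `c` writes `g` and leaves the other stacks as they are. -/
def Emits (c : Prog) (P : Mem → Prop) (g : Mem → List ProgramSymbol) : Prop :=
  Does c fun m m' w => P m ∧ m' = m ∧ w = g m

theorem eval_mono (p : Polynomial ℕ) {m n : ℕ} (h : m ≤ n) : p.eval m ≤ p.eval n := by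
  rw [Polynomial.eval_eq_sum, Polynomial.eval_eq_sum]
  exact Finset.sum_le_sum fun i _ => Nat.mul_le_mul_left _ (Nat.pow_le_pow_left h i)

variable {c d : Prog} {R R' S : Spec} {P Q : Mem → Prop} {g g' : Mem → List ProgramSymbol}

theorem Does.weaken (h : Does c R) (hS : ∀ m m' w, S m m' w → R m m' w) : Does c S := by
  obtain ⟨p, hp⟩ := h
  exact ⟨p, fun N m m' w hw => hp N m m' w (hS m m' w hw)⟩

/-- The second program starts from stacks of size `p N` instead of `N`, which is why its bound is
composed with `p`. -/
theorem Does.seq (hc : Does c R) (hd : Does d R')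
    (hS : ∀ m m'' w, S m m'' w → ∃ m' w₁ w₂, R m m' w₁ ∧ R' m' m'' w₂ ∧ w = w₁ ++ w₂) :
    Does (.seq c d) S := by
  obtain ⟨p, hp⟩ := hc
  obtain ⟨q, hq⟩ := hd
  refine ⟨p + q.comp p, fun N m m'' w hw hm => ?_⟩
  obtain ⟨m', w₁, w₂, h1, h2, rfl⟩ := hS m m'' w hw
  obtain ⟨e1, b1, l1⟩ := hp N m m' w₁ h1 hm
  obtain ⟨e2, b2, l2⟩ := hq _ m' m'' w₂ h2 b1
  simp only [Polynomial.eval_add, Polynomial.eval_comp]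
  refine ⟨fun o => ?_, b2.mono (by omega), by rw [List.length_append]; omega⟩
  rw [List.reverse_append, List.append_assoc]
  exact (e1 o).seq (e2 _)

/-- Specifications do not see the output stack, so tests on it are excluded, and the test may be
evaluated with an empty output. -/
theorem Does.ite {r : Reg} {p : Option (RegAlphabet r) → Bool} (hr : r ≠ .out)
    (hc : Does c R) (hd : Does d R')
    (hS : ∀ m m' w, S m m' w → (p (m.tapes [] r).head? = true ∧ R m m' w) ∨
      (p (m.tapes [] r).head? = false ∧ R' m m' w)) : Does (.ite r p c d) S := by
  obtain ⟨q, hq⟩ := hc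
  obtain ⟨q', hq'⟩ := hd
  refine ⟨1 + q + q', fun N m m' w hw hm => ?_⟩
  simp only [Polynomial.eval_add, Polynomial.eval_one]
  rcases hS m m' w hw with ⟨h1, h2⟩ | ⟨h1, h2⟩
  · obtain ⟨e1, b1, l1⟩ := hq N m m' w h2 hm
    exact ⟨fun o => (Exec.ite_true (by rwa [m.tapes_of_ne o [] hr]) (e1 o)).mono (by omega),
      b1.mono (by omega), by omega⟩
  · obtain ⟨e1, b1, l1⟩ := hq' N m m' w h2 hm
    exact ⟨fun o => (Exec.ite_false (by rwa [m.tapes_of_ne o [] hr]) (e1 o)).mono (by omega),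
      b1.mono (by omega), by omega⟩

theorem exec_loop {r : Reg} {p : Option (RegAlphabet r) → Bool} {T : ℕ} (n : ℕ) :
    ∀ σ : ℕ → ∀ k, List (RegAlphabet k), (∀ k < n, p ((σ k) r).head? = true) →
    p ((σ n) r).head? = false → (∀ k < n, Exec c (σ k) (σ (k + 1)) T) →
    Exec (.loop r p c) (σ 0) (σ n) (n * (T + 1) + 1) := by
  induction n with
  | zero =>
    intro σ _ h0 _
    exact (Exec.loop_false h0).mono (by omega)
  | succ n ih =>
    intro σ h1 h0 hb
    have := ih (fun k => σ (k + 1)) (fun k hk => h1 _ (by omega)) h0 fun k hk => hb _ (by omega)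
    refine (Exec.loop_true (h1 0 (by omega)) (hb 0 (by omega)) this).mono ?_
    ring_nf
    omega

/-- Composing the bound of the body once per round would not stay polynomial. Hence the whole run
`σ` is given explicitly, with one polynomial `q` that bounds the number of rounds and all
intermediate stacks. -/
theorem Does.loop {r : Reg} {p : Option (RegAlphabet r) → Bool} (hr : r ≠ .out) (hc : Does c R)
    (q : Polynomial ℕ)
    (hS : ∀ m m' w, S m m' w → ∃ (n : ℕ) (σ : ℕ → Mem) (ω : ℕ → List ProgramSymbol),
      m = σ 0 ∧ m' = σ n ∧ w = (List.range n).flatMap ω ∧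
      (∀ k < n, p ((σ k).tapes [] r).head? = true ∧ R (σ k) (σ (k + 1)) (ω k)) ∧
      p ((σ n).tapes [] r).head? = false ∧
      ∀ N, m.Bdd N → n ≤ q.eval N ∧ ∀ k ≤ n, (σ k).Bdd (q.eval N)) :
    Does (.loop r p c) S := by
  obtain ⟨t, ht⟩ := hc
  refine ⟨q * (t.comp q + 1) + 1 + q, fun N m m' w hw hm => ?_⟩
  obtain ⟨n, σ, ω, rfl, rfl, rfl, h1, h2, h3⟩ := hS m m' w hw
  obtain ⟨hn, hb⟩ := h3 N hm
  simp only [Polynomial.eval_add, Polynomial.eval_comp, Polynomial.eval_mul, Polynomial.eval_one]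
  have key := fun k (hk : k < n) => ht _ _ _ _ (h1 k hk).2 (hb k hk.le)
  have hle : n * (t.eval (q.eval N) + 1) ≤ q.eval N * (t.eval (q.eval N) + 1) :=
    Nat.mul_le_mul_right _ hn
  refine ⟨fun o => ?_, (hb n le_rfl).mono (by omega), ?_⟩
  · have := exec_loop (c := c) (r := r) (p := p) (T := t.eval (q.eval N)) n
      (fun k => (σ k).tapes (((List.range k).flatMap ω).reverse ++ o))
      (fun k hk => by rw [(σ k).tapes_of_ne _ [] hr]; exact (h1 k hk).1)
      (by rw [(σ n).tapes_of_ne _ [] hr]; exact h2)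
      (fun k hk => by
        have := (key k hk).1 (((List.range k).flatMap ω).reverse ++ o)
        simpa [List.range_succ] using this)
    exact this.mono (by omega)
  · have : ((List.range n).flatMap ω).length ≤ n * t.eval (q.eval N) := by
      rw [List.length_flatMap]
      refine (List.sum_le_card_nsmul _ (t.eval (q.eval N)) ?_).trans (by simp)
      intro x hx
      obtain ⟨k, hk, rfl⟩ := List.mem_map.1 hx
      exact (key k (List.mem_range.1 hk)).2.2
    have : n * t.eval (q.eval N) ≤ n * (t.eval (q.eval N) + 1) := Nat.mul_le_mul_left _ (by omega)
    omega

theorem Emits.weaken (h : Emits c P g) (hQ : ∀ m, Q m → P m ∧ g' m = g m) : Emits c Q g' :=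
  Does.weaken h fun m _ _ ⟨h1, h2, h3⟩ => ⟨(hQ m h1).1, h2, h3.trans (hQ m h1).2⟩

theorem Emits.seq (h : Emits c P g) (h' : Emits d P g') :
    Emits (.seq c d) P fun m => g m ++ g' m :=
  Does.seq h h' fun m _ _ ⟨h1, h2, h3⟩ => ⟨m, _, _, ⟨h1, rfl, rfl⟩, ⟨h1, h2, rfl⟩, h3⟩

theorem Emits.does (h : Emits c P g) : Does c fun m m' w => P m ∧ m' = m ∧ w = g m := h

theorem does_skip : Does .skip fun m m' w => m' = m ∧ w = [] := by
  refine ⟨Polynomial.X + 1, ?_⟩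
  rintro N _ m _ ⟨rfl, rfl⟩ hm
  simp only [Polynomial.eval_add, Polynomial.eval_X, Polynomial.eval_one]
  exact ⟨fun o => (Exec.skip _).mono (by omega), hm.mono (by omega), by simp⟩

theorem emits_push (x : ProgramSymbol) : Emits (.push .out x) (fun _ => True) fun _ => [x] := by
  refine ⟨Polynomial.X + 1, ?_⟩
  rintro N _ m _ ⟨-, rfl, rfl⟩ hm
  simp only [Polynomial.eval_add, Polynomial.eval_X, Polynomial.eval_one]
  refine ⟨fun o => ?_, hm.mono (by omega), by simp⟩
  have := Exec.push (Δ := RegAlphabet) .out x (m.tapes o)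
  rw [Mem.tapes_out] at this
  exact this.mono (by omega)

/-- Increase a counter. -/
def inc (c : Ctr) : Prog := .push (.ctr c) ()

/-- Decrease a counter. -/
def dec (c : Ctr) : Prog := .pop (.ctr c)

theorem does_inc (c : Ctr) : Does (inc c) fun m m' w => m' = m.set c (m.ctr c + 1) ∧ w = [] := by
  refine ⟨Polynomial.X + 1, ?_⟩
  rintro N m _ _ ⟨rfl, rfl⟩ hm
  simp only [Polynomial.eval_add, Polynomial.eval_X, Polynomial.eval_one]
  refine ⟨fun o => ?_, (hm.mono (by omega)).set (by have := hm.ctr c; omega), by simp⟩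
  have : Exec (inc c) (m.tapes o) ((m.set c (m.ctr c + 1)).tapes o) 1 := by
    rw [← Mem.tapes_set, List.replicate_succ]
    exact Exec.push _ _ _
  exact this.mono (by omega)

theorem does_dec (c : Ctr) : Does (dec c) fun m m' w => m' = m.set c (m.ctr c - 1) ∧ w = [] := by
  refine ⟨Polynomial.X + 1, ?_⟩
  rintro N m _ _ ⟨rfl, rfl⟩ hm
  simp only [Polynomial.eval_add, Polynomial.eval_X, Polynomial.eval_one]
  refine ⟨fun o => ?_, (hm.mono (by omega)).set (by have := hm.ctr c; omega), by simp⟩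
  have : Exec (dec c) (m.tapes o) ((m.set c (m.ctr c - 1)).tapes o) 1 := by
    rw [← Mem.tapes_set, ← List.tail_replicate]
    exact Exec.pop _ _
  exact this.mono (by omega)

/-- Repeat while a counter is positive. -/
def whilePos (c : Ctr) (body : Prog) : Prog := .loop (.ctr c) Option.isSome body

/-- Branch on whether a counter is positive. -/
def ifPos (c : Ctr) (p q : Prog) : Prog := .ite (.ctr c) Option.isSome p q

theorem Does.ifPos {x : Ctr} (hc : Does c R) (hd : Does d R')
    (hS : ∀ m m' w, S m m' w → (m.ctr x ≠ 0 ∧ R m m' w) ∨ (m.ctr x = 0 ∧ R' m m' w)) :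
    Does (ifPos x c d) S := by
  refine Does.ite (by simp) hc hd fun m m' w h => ?_
  rw [m.isSome_head_ctr]
  simpa using hS m m' w h

theorem Does.whilePos {x : Ctr} (hc : Does c R) (q : Polynomial ℕ)
    (hS : ∀ m m' w, S m m' w → ∃ (n : ℕ) (σ : ℕ → Mem) (ω : ℕ → List ProgramSymbol),
      m = σ 0 ∧ m' = σ n ∧ w = (List.range n).flatMap ω ∧
      (∀ k < n, (σ k).ctr x ≠ 0 ∧ R (σ k) (σ (k + 1)) (ω k)) ∧ (σ n).ctr x = 0 ∧
      ∀ N, m.Bdd N → n ≤ q.eval N ∧ ∀ k ≤ n, (σ k).Bdd (q.eval N)) :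
    Does (whilePos x c) S := by
  refine Does.loop (by simp) hc q fun m m' w h => ?_
  obtain ⟨n, σ, ω, h1, h2, h3, h4, h5, h6⟩ := hS m m' w h
  exact ⟨n, σ, ω, h1, h2, h3, fun k hk => ⟨(Mem.isSome_head_ctr _ _ _).trans
    (by simpa using (h4 k hk).1), (h4 k hk).2⟩,
    (Mem.isSome_head_ctr _ _ _).trans (by simpa using h5), h6⟩

/-! ### Basic programs -/

/-- Move a counter to others: `body` is executed for every unit. -/
def drain (c : Ctr) (body : Prog) : Prog := whilePos c (.seq (dec c) body)

/-- Set a counter to zero. -/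
def clear (c : Ctr) : Prog := drain c .skip

theorem does_clear (c : Ctr) : Does (clear c) fun m m' w => m' = m.set c 0 ∧ w = [] := by
  refine Does.whilePos (Does.seq (S := fun m m' w => m' = m.set c (m.ctr c - 1) ∧ w = [])
    (does_dec c) does_skip fun m _ _ ⟨h1, h2⟩ => ⟨_, _, _, ⟨rfl, rfl⟩, ⟨h1, rfl⟩, h2⟩)
    .X ?_
  rintro m _ _ ⟨rfl, rfl⟩
  refine ⟨m.ctr c, fun k => m.set c (m.ctr c - k), fun _ => [],
    Mem.ext_ctr rfl rfl fun d => ?_, by simp, by simp, fun k hk => ⟨by simp; omega, ?_, rfl⟩,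
    by simp, fun N hN => ⟨by simpa using hN.ctr c, fun k _ => ?_⟩⟩
  · simp +contextual
  · refine Mem.ext_ctr rfl rfl fun d => ?_
    simp only [Mem.ctr_set]
    split_ifs <;> omega
  · rw [Polynomial.eval_X]
    exact hN.set (by have := hN.ctr c; omega)

theorem does_drain {x : Ctr} {D : List Ctr} {v : List ProgramSymbol} (hx : x ∉ D)
    (hc : Does c fun m m' w => m' = m.add D 1 ∧ w = v) : Does (drain x c) fun m m' w =>
      m' = (m.set x 0).add D (m.ctr x) ∧ w = (List.range (m.ctr x)).flatMap fun _ => v := by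
  refine Does.whilePos (Does.seq (S := fun m m' w => m' = (m.set x (m.ctr x - 1)).add D 1 ∧ w = v)
    -- A counter in `D` can grow from `N` by another `N`.
    (does_dec x) hc fun m _ _ ⟨h1, h2⟩ => ⟨_, _, _, ⟨rfl, rfl⟩, ⟨h1, rfl⟩, h2⟩) (2 * .X) ?_
  rintro m _ _ ⟨rfl, rfl⟩
  refine ⟨m.ctr x, fun k => (m.set x (m.ctr x - k)).add D k, fun _ => v,
    Mem.ext_ctr rfl rfl fun d => ?_, by simp, rfl, fun k hk => ⟨?_, ?_, rfl⟩, ?_,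
    fun N hN => ⟨?_, fun k hk => ?_⟩⟩
  · simp +contextual
  · simp [hx]; omega
  · refine Mem.ext_ctr rfl rfl fun d => ?_
    by_cases e : d = x
    · subst e; simp [hx]; omega
    · by_cases e' : d ∈ D <;> simp [e, e', add_assoc]
  · simp [hx]
  · have := hN.ctr x
    simp
    omega
  · have := hN.ctr x
    have h2 : Polynomial.eval N (2 * .X : Polynomial ℕ) = 2 * N := by simp
    rw [h2]
    refine ⟨hN.inp.trans (by omega), hN.sav.trans (by omega), fun d => ?_⟩
    have := hN.ctr d
    simp only [Mem.ctr_add, Mem.ctr_set]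
    split_ifs <;> omega

theorem does_inc_add (x : Ctr) : Does (inc x) fun m m' w => m' = m.add [x] 1 ∧ w = [] :=
  (does_inc x).weaken fun m m' w ⟨h1, h2⟩ => ⟨h1.trans (Mem.ext_ctr rfl rfl fun d => by
    by_cases h : d = x <;> simp [h]), h2⟩

/-- Write the value of a counter in unary. -/
def writeCtr (c : Ctr) : Prog :=
  .seq (drain c (.seq (inc .temp) (.push .out .one))) (drain .temp (inc c))

/-- Reading a counter destroys it; `temp` keeps a copy, from which it is restored. -/
theorem emits_writeCtr {x : Ctr} (hx : x ≠ .temp) :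
    Emits (writeCtr x) (fun m => m.ctr .temp = 0) fun m => List.replicate (m.ctr x) .one := by
  have h1 : Does (.seq (inc .temp) (.push .out .one)) fun m m' w =>
      m' = m.add [.temp] 1 ∧ w = [.one] :=
    (does_inc_add .temp).seq (emits_push .one).does fun m _ _ ⟨h1, h2⟩ =>
      ⟨_, _, _, ⟨rfl, rfl⟩, ⟨trivial, h1, rfl⟩, h2⟩
  refine (does_drain (by simpa using hx) h1).seq
    (does_drain (x := .temp) (by simpa using hx.symm) (does_inc_add x)) ?_
  rintro m _ _ ⟨h, rfl, rfl⟩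
  refine ⟨_, _, _, ⟨rfl, rfl⟩, ⟨?_, rfl⟩, ?_⟩
  · refine Mem.ext_ctr rfl rfl fun d => ?_
    by_cases h1 : d = x
    · subst h1; simp [hx, h]
    · by_cases h2 : d = .temp
      · subst h2; simp [hx.symm, h]
      · simp [h1, h2]
  · have : ∀ n, (List.range n).flatMap (fun _ => [ProgramSymbol.one]) = List.replicate n .one :=
      fun n => by induction n <;> simp_all [List.range_succ, List.replicate_succ']
    simp [this]

/-- Add a counter to another one. -/
def copyTo (c d : Ctr) : Prog :=
  .seq (drain c (.seq (inc .temp) (inc d))) (drain .temp (inc c))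

theorem does_copyTo {x y : Ctr} (hx : x ≠ .temp) (hy : y ≠ .temp) (hxy : x ≠ y) :
    Does (copyTo x y) fun m m' w => m.ctr .temp = 0 ∧ m' = m.set y (m.ctr y + m.ctr x) ∧
      w = [] := by
  have h1 : Does (.seq (inc .temp) (inc y)) fun m m' w =>
      m' = m.add [.temp, y] 1 ∧ w = [] :=
    (does_inc_add .temp).seq (does_inc_add y) fun m _ _ ⟨h1, h2⟩ =>
      ⟨_, _, _, ⟨rfl, rfl⟩, ⟨h1.trans (Mem.ext_ctr rfl rfl fun d => by
        by_cases h1 : d = y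
        · subst h1; simp [hy]
        · simp [h1]), rfl⟩, h2⟩
  refine (does_drain (by simp [hx, hxy]) h1).seq
    (does_drain (x := .temp) (by simpa using hx.symm) (does_inc_add x)) ?_
  rintro m _ _ ⟨h, rfl, rfl⟩
  refine ⟨_, _, _, ⟨rfl, rfl⟩, ⟨?_, rfl⟩, by simp⟩
  refine Mem.ext_ctr rfl rfl fun d => ?_
  by_cases h1 : d = x
  · subst h1; simp [hx, hxy, h]
  · by_cases h2 : d = .temp
    · subst h2; simp [hx.symm, hy.symm, h]
    · by_cases h3 : d = y
      · subst h3; simp [h2, hxy.symm]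
      · simp [h1, h2, h3]

/-- Divide a counter by two; the remainder is left in `flag`. -/
def halve (c : Ctr) : Prog :=
  .seq (drain c (ifPos .flag (.seq (dec .flag) (inc .half)) (inc .flag))) (drain .half (inc c))

/-- `flag` toggles with every unit taken from the counter, and each second unit goes to `half`:
after `k` units they hold `k % 2` and `k / 2`. -/
theorem does_halve {x : Ctr} (hx : x ≠ .half) (hx' : x ≠ .flag) :
    Does (halve x) fun m m' w => (m.ctr .half = 0 ∧ m.ctr .flag = 0) ∧
      m' = (m.set x (m.ctr x / 2)).set .flag (m.ctr x % 2) ∧ w = [] := by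
  have h1 : Does (ifPos .flag (.seq (dec .flag) (inc .half)) (inc .flag)) fun m m' w =>
      m' = (if m.ctr .flag ≠ 0 then (m.set .flag (m.ctr .flag - 1)).set .half (m.ctr .half + 1)
        else m.set .flag (m.ctr .flag + 1)) ∧ w = [] := by
    refine Does.ifPos (Does.seq (S := fun m m' w => m' =
      (m.set .flag (m.ctr .flag - 1)).set .half (m.ctr .half + 1) ∧ w = [])
      (does_dec .flag) (does_inc .half) fun m _ _ ⟨h1, h2⟩ =>
        ⟨_, _, _, ⟨rfl, rfl⟩, ⟨h1, rfl⟩, h2⟩) (does_inc .flag) ?_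
    rintro m _ _ ⟨rfl, rfl⟩
    by_cases h : m.ctr .flag = 0
    · exact Or.inr ⟨h, by simp [h], rfl⟩
    · exact Or.inl ⟨h, by simp [h], rfl⟩
  refine Does.seq (R := fun m m' w => (m.ctr .half = 0 ∧ m.ctr .flag = 0) ∧
    m' = ((m.set x 0).set .half (m.ctr x / 2)).set .flag (m.ctr x % 2) ∧ w = [])
    (Does.whilePos (Does.seq (S := fun m m' w => m' = (if m.ctr .flag ≠ 0 then
      ((m.set x (m.ctr x - 1)).set .flag (m.ctr .flag - 1)).set .half (m.ctr .half + 1)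
        else (m.set x (m.ctr x - 1)).set .flag (m.ctr .flag + 1)) ∧ w = [])
      (does_dec x) h1 ?_) .X ?_)
    (does_drain (x := .half) (by simpa using hx.symm) (does_inc_add x)) ?_
  · rintro m _ _ ⟨rfl, rfl⟩
    exact ⟨_, _, _, ⟨rfl, rfl⟩, ⟨by simp [hx.symm, hx'.symm], rfl⟩, rfl⟩
  · rintro m _ _ ⟨⟨h1, h2⟩, rfl, rfl⟩
    refine ⟨m.ctr x, fun k => ((m.set x (m.ctr x - k)).set .half (k / 2)).set .flag (k % 2),
      fun _ => [], Mem.ext_ctr rfl rfl fun d => ?_, by simp, by simp,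
      fun k hk => ⟨?_, ?_, rfl⟩, ?_, fun N hN => ⟨?_, fun k hk => ?_⟩⟩
    · by_cases e1 : d = .flag
      · subst e1; simp [h2]
      · by_cases e2 : d = .half
        · subst e2; simp [h1]
        · by_cases e3 : d = x
          · subst e3; simp [e1, e2]
          · simp [e1, e2, e3]
    · simp [hx, hx']; omega
    · by_cases hk : k % 2 = 0
      · simp only [Mem.ctr_set, if_true, hk, ne_eq, not_true_eq_false, if_false, hx, hx']
        refine Mem.ext_ctr rfl rfl fun d => ?_
        by_cases e1 : d = .flag
        · subst e1; simp; omega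
        · by_cases e2 : d = .half
          · subst e2; simp [hx.symm]; omega
          · by_cases e3 : d = x
            · subst e3; simp [e1, e2]; omega
            · simp [e1, e2, e3]
      · have hk : k % 2 = 1 := by omega
        simp only [Mem.ctr_set, if_true, hk, ne_eq, one_ne_zero, not_false_eq_true, if_false, hx,
          hx', reduceCtorEq]
        refine Mem.ext_ctr rfl rfl fun d => ?_
        by_cases e1 : d = .flag
        · subst e1; simp; omega
        · by_cases e2 : d = .half
          · subst e2; simp; omega
          · by_cases e3 : d = x
            · subst e3; simp [e1, e2]; omega
            · simp [e1, e2, e3]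
    · simp [hx, hx']
    · simpa using hN.ctr x
    · have := hN.ctr x
      rw [Polynomial.eval_X]
      exact ((hN.set (by omega)).set (by omega)).set (by omega)
  · rintro m _ _ ⟨⟨h1, h2⟩, rfl, rfl⟩
    refine ⟨_, _, _, ⟨⟨h1, h2⟩, rfl, rfl⟩, ⟨?_, rfl⟩, by simp⟩
    refine Mem.ext_ctr rfl rfl fun d => ?_
    by_cases e1 : d = .flag
    · subst e1; simp [hx'.symm]
    · by_cases e2 : d = .half
      · subst e2; simp [hx.symm, h1]
      · by_cases e3 : d = x
        · subst e3; simp [e1, e2]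
        · simp [e1, e2, e3]

end ASP

namespace ASP

/-! ### Writing rules -/

section

variable {c d : Prog} {P Q : Mem → Prop} {g g' : Mem → List ProgramSymbol}

theorem emits_skip : Emits .skip (fun _ => True) fun _ => [] :=
  does_skip.weaken fun _ _ _ ⟨_, h⟩ => h

theorem Emits.mono (h : Emits c P g) (hQ : ∀ m, Q m → P m) : Emits c Q g :=
  h.weaken fun m hm => ⟨hQ m hm, rfl⟩

/-- Write a string. -/
def emitList : List ProgramSymbol → Prog
  | [] => .skip
  | x :: l => .seq (.push .out x) (emitList l)

theorem emits_emitList (l : List ProgramSymbol) : Emits (emitList l) (fun _ => True) fun _ => l := by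
  induction l with
  | nil => exact emits_skip
  | cons x l ih => exact (emits_push x).seq ih

/-- Execute programs one after the other. -/
def seqs {ι : Type} (c : ι → Prog) : List ι → Prog
  | [] => .skip
  | x :: l => .seq (c x) (seqs c l)

theorem emits_seqs {ι : Type} {c : ι → Prog} {g : ι → Mem → List ProgramSymbol} (l : List ι)
    (h : ∀ x ∈ l, Emits (c x) P (g x)) : Emits (seqs c l) P fun m => l.flatMap fun x => g x m := by
  induction l with
  | nil => exact emits_skip.mono fun _ _ => trivial
  | cons x l ih => exact (h x (by simp)).seq (ih fun y hy => h y (by simp [hy]))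

/-- An atom whose index is the sum of a number and of counters. -/
abbrev Atom : Type := ℕ × List Ctr

/-- The index of an atom. -/
def Atom.eval (m : Mem) (t : Atom) : ℕ := t.1 + (t.2.map m.ctr).sum

/-- Write an atom with a mark. -/
def emitAtom (y : ProgramSymbol) (t : Atom) : Prog :=
  .seq (emitList (y :: List.replicate t.1 .one)) (seqs writeCtr t.2)

theorem emits_emitAtom (y : ProgramSymbol) (t : Atom) (ht : .temp ∉ t.2) :
    Emits (emitAtom y t) (fun m => m.ctr .temp = 0)
      fun m => y :: List.replicate (t.eval m) .one := by
  refine (((emits_emitList _).mono fun _ _ => trivial).seq (emits_seqs t.2 fun x hx =>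
    emits_writeCtr (by rintro rfl; exact ht hx))).weaken fun m hm => ⟨hm, ?_⟩
  obtain ⟨k, l⟩ := t
  have : (l.flatMap fun x => List.replicate (m.ctr x) ProgramSymbol.one) =
      List.replicate (l.map m.ctr).sum .one := by
    clear ht
    induction l with
    | nil => rfl
    | cons x l ih => simp [ih]
  simp [Atom.eval, this]

/-- A rule whose atoms are given by counters. -/
structure RuleTemplate where
  head : List Atom
  pos : List Atom
  neg : List Atom

/-- The rule that belongs to the values of the counters. -/
def RuleTemplate.eval (m : Mem) (r : RuleTemplate) : ListRule :=
  ⟨r.head.map (Atom.eval m), r.pos.map (Atom.eval m), r.neg.map (Atom.eval m)⟩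

/-- Write a rule. -/
def emitRule (r : RuleTemplate) : Prog :=
  .seq (.push .out .rule) (.seq (.seq (seqs (emitAtom .head) r.head) (seqs (emitAtom .pos) r.pos))
    (seqs (emitAtom .neg) r.neg))

/-- The auxiliary counter is not used. -/
def RuleTemplate.Valid (r : RuleTemplate) : Prop := ∀ t ∈ r.head ++ r.pos ++ r.neg, .temp ∉ t.2

theorem emits_emitRule (r : RuleTemplate) (hr : r.Valid) :
    Emits (emitRule r) (fun m => m.ctr .temp = 0) fun m => (r.eval m).code := by
  refine Emits.weaken (((emits_push _).mono fun _ _ => trivial).seq (((emits_seqs r.head fun t ht =>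
    emits_emitAtom _ t (hr t (by simp [ht]))).seq (emits_seqs r.pos fun t ht =>
    emits_emitAtom _ t (hr t (by simp [ht])))).seq (emits_seqs r.neg fun t ht =>
    emits_emitAtom _ t (hr t (by simp [ht]))))) fun m hm => ⟨hm, ?_⟩
  simp [RuleTemplate.eval, ListRule.code, List.flatMap_map]

/-- Write rules. -/
def emitRules (l : List RuleTemplate) : Prog := seqs emitRule l

theorem emits_emitRules (l : List RuleTemplate) (hl : ∀ r ∈ l, r.Valid) :
    Emits (emitRules l) (fun m => m.ctr .temp = 0)
      fun m => (l.map (RuleTemplate.eval m)).flatMap ListRule.code :=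
  (emits_seqs l fun r hr => emits_emitRule r (hl r hr)).weaken fun m hm =>
    ⟨hm, by rw [List.flatMap_map]⟩

/-- The string of the body of a rule without negated atoms. -/
def bodyCode (T : List ℕ) : List ProgramSymbol := T.flatMap fun x => .pos :: List.replicate x .one

@[simp] theorem bodyCode_nil : bodyCode [] = [] := rfl

@[simp] theorem bodyCode_cons (x : ℕ) (T : List ℕ) :
    bodyCode (x :: T) = (.pos :: List.replicate x .one) ++ bodyCode T := rfl

@[simp] theorem bodyCode_append (T T' : List ℕ) :
    bodyCode (T ++ T') = bodyCode T ++ bodyCode T' := List.flatMap_append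

theorem code_termRule (T : List ℕ) : (termRule T).code = [.rule, .head] ++ bodyCode T := by
  simp [termRule, ListRule.code, bodyCode]

/-- Write the start of a rule with head `0` whose body starts with the given atoms. -/
def emitStart (T : List ℕ) : Prog := emitList ([.rule, .head] ++ bodyCode T)

theorem emits_emitStart (T : List ℕ) :
    Emits (emitStart T) (fun _ => True) fun _ => [.rule, .head] ++ bodyCode T :=
  emits_emitList _

/-! ### Writing the bits of a number -/

/-- Write a bit in unary and delete it. -/
def emitBit : Prog := ifPos .flag (.seq (dec .flag) (.push .out .one)) .skip

theorem does_emitBit : Does emitBit fun m m' w => m.ctr .flag < 2 ∧ m' = m.set .flag 0 ∧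
    w = List.replicate (m.ctr .flag) .one := by
  refine Does.ifPos (Does.seq (S := fun m m' w => m' = m.set .flag (m.ctr .flag - 1) ∧ w = [.one])
      (does_dec .flag) (emits_push .one) fun m _ _ ⟨h1, h2⟩ =>
        ⟨_, _, _, ⟨rfl, rfl⟩, ⟨trivial, h1, rfl⟩, h2⟩) does_skip ?_
  rintro m _ _ ⟨h, rfl, rfl⟩
  by_cases h0 : m.ctr .flag = 0
  · exact Or.inr ⟨h0, Mem.ext_ctr rfl rfl fun d => by simp +contextual [h0], by simp [h0]⟩
  · have h1 : m.ctr .flag = 1 := by omega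
    exact Or.inl ⟨h0, by simp [h1], by simp [h1]⟩

/-- Write the complement of a bit in unary and delete the bit. -/
def emitNotBit : Prog := ifPos .flag (dec .flag) (.push .out .one)

theorem does_emitNotBit : Does emitNotBit fun m m' w => m.ctr .flag < 2 ∧ m' = m.set .flag 0 ∧
    w = List.replicate (1 - m.ctr .flag) .one := by
  refine Does.ifPos (does_dec .flag) (emits_push .one) ?_
  rintro m _ _ ⟨h, rfl, rfl⟩
  by_cases h0 : m.ctr .flag = 0
  · exact Or.inr ⟨h0, trivial, Mem.ext_ctr rfl rfl fun d => by simp +contextual [h0], by simp [h0]⟩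
  · have h1 : m.ctr .flag = 1 := by omega
    exact Or.inl ⟨h0, by simp [h1], by simp [h1]⟩

/-- The auxiliary counters have their initial values. -/
structure Ready (m : Mem) : Prop where
  temp : m.ctr .temp = 0
  half : m.ctr .half = 0
  flag : m.ctr .flag = 0
  copy : m.ctr .copy = 0
  done₂ : m.ctr .done₂ = 0
  bits₂ : m.ctr .bits₂ = m.ctr .bits

/-- One step of writing the bits of a number. -/
def bitsStep (l : List Ctr) : Prog :=
  .seq (emitAtom .pos (7, l ++ [.done₂, .done₂]))
    (.seq (halve .copy) (.seq emitBit (.seq (dec .bits₂) (inc .done₂))))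

/-- Write the bits of `idx`. -/
def emitBits (l : List Ctr) : Prog :=
  .seq (copyTo .idx .copy) (.seq (whilePos .bits₂ (bitsStep l))
    (.seq (clear .copy) (drain .done₂ (inc .bits₂))))

/-- The atom `litAtom (d + b) β` is `1 + 2 * d + 2 * b + β.toNat`. With `2 * d = 6 + (l.map
m.ctr).sum` and `b` in `done₂` this is `7` plus counters plus the bit, which is the lowest bit of
`copy`. -/
theorem does_bitsStep (l : List Ctr) (hl : .temp ∉ l) : Does (bitsStep l) fun m m' w =>
    (m.ctr .temp = 0 ∧ m.ctr .half = 0 ∧ m.ctr .flag = 0) ∧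
    m' = ((m.set .copy (m.ctr .copy / 2)).set .bits₂ (m.ctr .bits₂ - 1)).set .done₂
      (m.ctr .done₂ + 1) ∧
    w = .pos :: List.replicate (7 + (l.map m.ctr).sum + 2 * m.ctr .done₂ + m.ctr .copy % 2)
      .one := by
  have h1 : Does (.seq (dec .bits₂) (inc .done₂)) fun m m' w =>
      m' = (m.set .bits₂ (m.ctr .bits₂ - 1)).set .done₂ (m.ctr .done₂ + 1) ∧ w = [] :=
    (does_dec .bits₂).seq (does_inc .done₂) fun m _ _ ⟨h1, h2⟩ =>
      ⟨_, _, _, ⟨rfl, rfl⟩, ⟨h1, rfl⟩, h2⟩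
  have h2 : Does (.seq emitBit (.seq (dec .bits₂) (inc .done₂))) fun m m' w =>
      m.ctr .flag < 2 ∧ m' = ((m.set .flag 0).set .bits₂ (m.ctr .bits₂ - 1)).set .done₂
        (m.ctr .done₂ + 1) ∧ w = List.replicate (m.ctr .flag) .one :=
    does_emitBit.seq h1 fun m _ _ ⟨h1, h2, h3⟩ =>
      ⟨_, _, _, ⟨h1, rfl, rfl⟩, ⟨by simpa using h2, rfl⟩, by simpa using h3⟩
  have h3 : Does (.seq (halve .copy) (.seq emitBit (.seq (dec .bits₂) (inc .done₂))))
      fun m m' w => (m.ctr .half = 0 ∧ m.ctr .flag = 0) ∧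
      m' = ((m.set .copy (m.ctr .copy / 2)).set .bits₂ (m.ctr .bits₂ - 1)).set .done₂
        (m.ctr .done₂ + 1) ∧ w = List.replicate (m.ctr .copy % 2) .one := by
    refine (does_halve (x := .copy) (by simp) (by simp)).seq h2 ?_
    rintro m _ _ ⟨⟨h1, h2⟩, rfl, rfl⟩
    refine ⟨_, _, _, ⟨⟨h1, h2⟩, rfl, rfl⟩, ⟨by simp; omega, ?_, rfl⟩, by simp⟩
    refine Mem.ext_ctr rfl rfl fun d => ?_
    cases d <;> simp [h2]
  refine (emits_emitAtom .pos (7, l ++ [.done₂, .done₂]) (by simpa using hl)).does.seq h3 ?_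
  rintro m _ _ ⟨⟨h1, h2⟩, rfl, rfl⟩
  refine ⟨_, _, _, ⟨h1, rfl, rfl⟩, ⟨h2, rfl, rfl⟩, ?_⟩
  simp only [Atom.eval, List.map_append, List.sum_append, List.map_cons, List.map_nil,
    List.sum_cons, List.sum_nil, List.cons_append, List.replicate_append_replicate]
  congr 2
  omega

/-- After `k` rounds `copy` holds `idx / 2 ^ k` and `done₂` holds `k`. The offset `d` may depend
only on the counter `bits`, which no round changes, so it stays constant during the loop. -/
theorem emits_emitBits (l : List Ctr) (hl : ∀ x ∈ l, x = .bits) (d : Mem → ℕ)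
    (hd : ∀ m, 2 * d m = 6 + (l.map m.ctr).sum) :
    Emits (emitBits l) Ready fun m => bodyCode (bitLits (m.ctr .bits) (d m) (m.ctr .idx)) := by
  have h1 : Does (.seq (clear .copy) (drain .done₂ (inc .bits₂))) fun m m' w =>
      m' = ((m.set .copy 0).set .done₂ 0).set .bits₂ (m.ctr .bits₂ + m.ctr .done₂) ∧ w = [] := by
    refine (does_clear .copy).seq (does_drain (x := .done₂) (by simp) (does_inc_add .bits₂)) ?_
    rintro m _ _ ⟨rfl, rfl⟩
    refine ⟨_, _, _, ⟨rfl, rfl⟩, ⟨Mem.ext_ctr rfl rfl fun d => ?_, rfl⟩, by simp⟩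
    cases d <;> simp
  have h2 : Does (whilePos .bits₂ (bitsStep l)) fun m m' w =>
      (m.ctr .temp = 0 ∧ m.ctr .half = 0 ∧ m.ctr .flag = 0 ∧ m.ctr .done₂ = 0 ∧
        m.ctr .bits₂ = m.ctr .bits ∧ m.ctr .copy = m.ctr .idx) ∧
      m' = ((m.set .copy (m.ctr .idx / 2 ^ m.ctr .bits)).set .bits₂ 0).set .done₂ (m.ctr .bits) ∧
      w = bodyCode (bitLits (m.ctr .bits) (d m) (m.ctr .idx)) := by
    refine (does_bitsStep l fun h => by simpa using hl _ h).whilePos .X ?_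
    rintro m _ _ ⟨⟨e1, e2, e3, e4, e5, e6⟩, rfl, rfl⟩
    refine ⟨m.ctr .bits, fun k => ((m.set .copy (m.ctr .idx / 2 ^ k)).set .bits₂
      (m.ctr .bits - k)).set .done₂ k, fun k => .pos :: List.replicate (litAtom (d m + k)
      ((m.ctr .idx).testBit k)) .one, Mem.ext_ctr rfl rfl fun d => ?_, ?_, ?_,
      fun k hk => ⟨?_, ⟨by simpa using ⟨e1, e2, e3⟩, Mem.ext_ctr rfl rfl fun d => ?_, ?_⟩⟩, ?_,
      fun N hN => ⟨?_, fun k hk => ?_⟩⟩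
    · cases d <;> simp [e4, e5, e6]
    · simp
    · simp [bodyCode, bitLits, List.flatMap_map]
    · simp
      omega
    · cases d <;> simp [Nat.pow_succ, Nat.div_div_eq_div_mul]
      omega
    · have hs : (l.map (((m.set .copy (m.ctr .idx / 2 ^ k)).set .bits₂
          (m.ctr .bits - k)).set .done₂ k).ctr) = l.map m.ctr := by
        refine List.map_congr_left fun x hx => ?_
        rw [hl x hx]
        simp
      rw [hs]
      have hb : ((m.ctr .idx).testBit k).toNat = m.ctr .idx / 2 ^ k % 2 := by
        rw [Nat.toNat_testBit]
      have := hd m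
      simp only [litAtom, hb, Mem.ctr_set, if_true, reduceCtorEq, if_false]
      congr 2
      omega
    · simp
    · simpa using hN.ctr .bits
    · have := hN.ctr .bits
      have h3 := hN.ctr .idx
      rw [Polynomial.eval_X]
      exact ((hN.set ((Nat.div_le_self _ _).trans h3)).set (by omega)).set (by omega)
  have h3 : Does (.seq (whilePos .bits₂ (bitsStep l)) (.seq (clear .copy)
      (drain .done₂ (inc .bits₂)))) fun m m' w =>
      (m.ctr .temp = 0 ∧ m.ctr .half = 0 ∧ m.ctr .flag = 0 ∧ m.ctr .done₂ = 0 ∧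
        m.ctr .bits₂ = m.ctr .bits ∧ m.ctr .copy = m.ctr .idx) ∧
      m' = m.set .copy 0 ∧
      w = bodyCode (bitLits (m.ctr .bits) (d m) (m.ctr .idx)) := by
    refine h2.seq h1 ?_
    rintro m _ _ ⟨h, rfl, rfl⟩
    refine ⟨_, _, _, ⟨h, rfl, rfl⟩, ⟨Mem.ext_ctr rfl rfl fun d => ?_, rfl⟩, by simp⟩
    cases d <;> simp [h]
  refine (does_copyTo (x := .idx) (y := .copy) (by simp) (by simp) (by simp)).seq h3 ?_
  rintro _ m _ ⟨h, rfl, rfl⟩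
  refine ⟨_, _, _, ⟨h.temp, rfl, rfl⟩, ⟨by simpa using ⟨h.temp, h.half, h.flag, h.done₂, h.bits₂,
    h.copy⟩, Mem.ext_ctr rfl rfl fun d => ?_, rfl⟩, ?_⟩
  · cases d <;> simp [h.copy]
  · have : d (m.set .copy (m.ctr .copy + m.ctr .idx)) = d m := by
      have e1 := hd m
      have e2 := hd (m.set .copy (m.ctr .copy + m.ctr .idx))
      have e3 : l.map (m.set .copy (m.ctr .copy + m.ctr .idx)).ctr = l.map m.ctr := by
        refine List.map_congr_left fun x hx => ?_
        rw [hl x hx]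
        simp
      rw [e3] at e2
      omega
    simp [this]

end

end ASP

/-! ### Generating the rules of a group -/

namespace ASP

/-! ### Writing the groups of rules -/

/-- The string of a list of rules. -/
abbrev rulesCode (l : List ListRule) : List ProgramSymbol := l.flatMap ListRule.code

/-- A literal over an existential variable of the current group. -/
def varAtom (c : ℕ) (b : Bool) : Atom :=
  (7 + 2 * c + b.toNat, List.replicate 4 .bits ++ List.replicate 6 .idx)

/-- Since `1 + 2 * (3 + 2 * a + 3 * j + c) = 7 + 4 * a + 6 * j + 2 * c`, the template lists `bits`
four times and `idx` six times. -/
theorem eval_varAtom (m : Mem) (c : ℕ) (b : Bool) :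
    (varAtom c b).eval m = litAtom (varIdx (m.ctr .bits) (m.ctr .idx) c) b := by
  simp [varAtom, Atom.eval, litAtom, varIdx]
  omega

theorem temp_notMem_varAtom (c : ℕ) (b : Bool) : .temp ∉ (varAtom c b).2 := by simp [varAtom]

theorem emits_patU : Emits (emitBits []) Ready
    fun m => bodyCode (bitLits (m.ctr .bits) 3 (m.ctr .idx)) :=
  emits_emitBits [] (by simp) (fun _ => 3) (by simp)

theorem emits_patV : Emits (emitBits [.bits, .bits]) Ready
    fun m => bodyCode (bitLits (m.ctr .bits) (3 + m.ctr .bits) (m.ctr .idx)) :=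
  emits_emitBits _ (by simp) (fun m => 3 + m.ctr .bits) (by intro m; simp; omega)

/-- Write the rule for a literal over an existential variable. -/
def emitVarTerm : ℕ × Bool → Prog
  | (0, b) => .seq (emitStart [litAtom 2 b])
      (.seq (emitBits [.bits, .bits]) (emitAtom .pos (varAtom 0 b)))
  | (c + 1, b) => .seq (emitStart [litAtom c (!b)])
      (.seq (emitBits []) (emitAtom .pos (varAtom (c + 1) b)))

theorem emits_emitVarTerm (p : ℕ × Bool) : Emits (emitVarTerm p) Ready
    fun m => (termRule (varTerm (m.ctr .bits) (m.ctr .idx) p)).code := by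
  obtain ⟨_ | c, b⟩ := p
  · refine (((emits_emitStart _).mono fun _ _ => trivial).seq (emits_patV.seq
      ((emits_emitAtom .pos (varAtom 0 b) (temp_notMem_varAtom _ _)).mono
        fun m hm => hm.temp))).weaken fun m hm => ⟨hm, ?_⟩
    simp [code_termRule, varTerm, eval_varAtom]
  · refine (((emits_emitStart _).mono fun _ _ => trivial).seq (emits_patU.seq
      ((emits_emitAtom .pos (varAtom (c + 1) b) (temp_notMem_varAtom _ _)).mono
        fun m hm => hm.temp))).weaken fun m hm => ⟨hm, ?_⟩
    simp [code_termRule, varTerm, eval_varAtom]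

/-- Write the rules of a group that do not depend on the formula. -/
def emitVars : Prog :=
  .seq (emitRules ((List.range 3).map fun c => ⟨[varAtom c false, varAtom c true], [], []⟩))
    (seqs emitVarTerm varLits)

theorem emits_emitVars : Emits emitVars Ready fun m => rulesCode
    ((List.range 3).map (fun c => guessRule (varIdx (m.ctr .bits) (m.ctr .idx) c)) ++
      (varLits.map (varTerm (m.ctr .bits) (m.ctr .idx))).map termRule) := by
  refine Emits.weaken (((emits_emitRules _ ?_).mono fun m hm => hm.temp).seq
    (emits_seqs varLits fun p _ => emits_emitVarTerm p)) fun m hm => ⟨hm, ?_⟩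
  · intro r hr
    obtain ⟨c, -, rfl⟩ := List.mem_map.1 hr
    intro t ht
    simp only [List.append_nil, List.mem_cons, List.not_mem_nil, or_false] at ht
    rcases ht with rfl | rfl <;> exact temp_notMem_varAtom _ _
  · simp [rulesCode, List.flatMap_map, RuleTemplate.eval, eval_varAtom, guessRule]

/-- The stacks at the start of a group. -/
structure GroupReady (m : Mem) : Prop extends Ready m where
  done₁ : m.ctr .done₁ = 0
  bits₁ : m.ctr .bits₁ = m.ctr .bits

/-- Write the rule for a bit of a literal of the formula. -/
def literalStep (t : ℕ) : Prog :=
  .seq (.seq (emitStart (posLits t)) (.seq (emitBits [])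
    (emitAtom .pos (7, [.bits, .bits, .done₁, .done₁]))))
    (.seq (halve .lit) (.seq emitNotBit (.seq (dec .bits₁) (inc .done₁))))

/-- Write the rules for a literal of the formula. -/
def emitLiteral (t : ℕ) (s : Bool) : Prog :=
  .seq (.seq (emitStart (posLits t ++ [litAtom 2 (!s)])) (emitBits []))
    (.seq (whilePos .bits₁ (literalStep t)) (.seq (clear .lit) (drain .done₁ (inc .bits₁))))

/-- The loop over the bits of the variable has its own counters `bits₁` and `done₁`, as the clause
index written in every round uses `bits₂` and `done₂`. The final literal is the complementary bit
added to the atom of value `false`. -/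
theorem does_literalStep (t : ℕ) : Does (literalStep t) fun m m' w =>
    Ready m ∧ m' = ((m.set .lit (m.ctr .lit / 2)).set .bits₁ (m.ctr .bits₁ - 1)).set .done₁
      (m.ctr .done₁ + 1) ∧
    w = (termRule (posLits t ++ (bitLits (m.ctr .bits) 3 (m.ctr .idx) ++
      [litAtom (3 + m.ctr .bits + m.ctr .done₁) (!decide (m.ctr .lit % 2 = 1))]))).code := by
  have h1 : Does (.seq (dec .bits₁) (inc .done₁)) fun m m' w =>
      m' = (m.set .bits₁ (m.ctr .bits₁ - 1)).set .done₁ (m.ctr .done₁ + 1) ∧ w = [] :=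
    (does_dec .bits₁).seq (does_inc .done₁) fun m _ _ ⟨h1, h2⟩ =>
      ⟨_, _, _, ⟨rfl, rfl⟩, ⟨h1, rfl⟩, h2⟩
  have h2 : Does (.seq emitNotBit (.seq (dec .bits₁) (inc .done₁))) fun m m' w =>
      m.ctr .flag < 2 ∧ m' = ((m.set .flag 0).set .bits₁ (m.ctr .bits₁ - 1)).set .done₁
        (m.ctr .done₁ + 1) ∧ w = List.replicate (1 - m.ctr .flag) .one :=
    does_emitNotBit.seq h1 fun m _ _ ⟨h1, h2, h3⟩ =>
      ⟨_, _, _, ⟨h1, rfl, rfl⟩, ⟨by simpa using h2, rfl⟩, by simpa using h3⟩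
  have h3 : Does (.seq (halve .lit) (.seq emitNotBit (.seq (dec .bits₁) (inc .done₁))))
      fun m m' w => (m.ctr .half = 0 ∧ m.ctr .flag = 0) ∧
      m' = ((m.set .lit (m.ctr .lit / 2)).set .bits₁ (m.ctr .bits₁ - 1)).set .done₁
        (m.ctr .done₁ + 1) ∧ w = List.replicate (1 - m.ctr .lit % 2) .one := by
    refine (does_halve (x := .lit) (by simp) (by simp)).seq h2 ?_
    rintro m _ _ ⟨⟨h1, h2⟩, rfl, rfl⟩
    refine ⟨_, _, _, ⟨⟨h1, h2⟩, rfl, rfl⟩, ⟨by simp; omega, ?_, rfl⟩, by simp⟩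
    refine Mem.ext_ctr rfl rfl fun d => ?_
    cases d <;> simp [h2]
  refine (((emits_emitStart (posLits t)).mono fun _ _ => trivial).seq (emits_patU.seq
    ((emits_emitAtom .pos (7, [.bits, .bits, .done₁, .done₁]) (by simp)).mono
      fun m hm => hm.temp))).does.seq h3 ?_
  rintro m _ _ ⟨h, rfl, rfl⟩
  refine ⟨_, _, _, ⟨h, rfl, rfl⟩, ⟨⟨h.half, h.flag⟩, rfl, rfl⟩, ?_⟩
  have : litAtom (3 + m.ctr .bits + m.ctr .done₁) (!decide (m.ctr .lit % 2 = 1)) =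
      Atom.eval m (7, [.bits, .bits, .done₁, .done₁]) + (1 - m.ctr .lit % 2) := by
    have := Nat.mod_two_eq_zero_or_one (m.ctr .lit)
    rcases this with h | h <;> simp [litAtom, Atom.eval, h] <;> omega
  rw [this]
  simp [code_termRule]

theorem does_emitLiteral (t : ℕ) (s : Bool) : Does (emitLiteral t s) fun m m' w =>
    GroupReady m ∧ m' = m.set .lit 0 ∧
    w = rulesCode ((literalTerms (m.ctr .bits) (m.ctr .idx) t (s, m.ctr .lit)).map termRule) := by
  have h1 : Does (.seq (clear .lit) (drain .done₁ (inc .bits₁))) fun m m' w =>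
      m' = ((m.set .lit 0).set .done₁ 0).set .bits₁ (m.ctr .bits₁ + m.ctr .done₁) ∧ w = [] := by
    refine (does_clear .lit).seq (does_drain (x := .done₁) (by simp) (does_inc_add .bits₁)) ?_
    rintro m _ _ ⟨rfl, rfl⟩
    refine ⟨_, _, _, ⟨rfl, rfl⟩, ⟨Mem.ext_ctr rfl rfl fun d => ?_, rfl⟩, by simp⟩
    cases d <;> simp
  have h2 : Does (whilePos .bits₁ (literalStep t)) fun m m' w => GroupReady m ∧
      m' = ((m.set .lit (m.ctr .lit / 2 ^ m.ctr .bits)).set .bits₁ 0).set .done₁ (m.ctr .bits) ∧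
      w = rulesCode (((List.range (m.ctr .bits)).map fun b => posLits t ++
        (bitLits (m.ctr .bits) 3 (m.ctr .idx) ++
          [litAtom (3 + m.ctr .bits + b) (!(m.ctr .lit).testBit b)])).map termRule) := by
    refine (does_literalStep t).whilePos .X ?_
    rintro m _ _ ⟨h, rfl, rfl⟩
    refine ⟨m.ctr .bits, fun k => ((m.set .lit (m.ctr .lit / 2 ^ k)).set .bits₁
      (m.ctr .bits - k)).set .done₁ k, fun b => (termRule (posLits t ++
        (bitLits (m.ctr .bits) 3 (m.ctr .idx) ++
          [litAtom (3 + m.ctr .bits + b) (!(m.ctr .lit).testBit b)]))).code,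
      Mem.ext_ctr rfl rfl fun d => ?_, ?_, ?_,
      fun k hk => ⟨?_, ⟨?_, Mem.ext_ctr rfl rfl fun d => ?_, ?_⟩⟩, ?_,
      fun N hN => ⟨?_, fun k hk => ?_⟩⟩
    · cases d <;> simp [h.bits₁, h.done₁]
    · simp
    · simp [rulesCode, List.flatMap_map]
    · simp
      omega
    · exact ⟨by simpa using h.temp, by simpa using h.half, by simpa using h.flag,
        by simpa using h.copy, by simpa using h.done₂, by simpa using h.bits₂⟩
    · cases d <;> simp [Nat.pow_succ, Nat.div_div_eq_div_mul]
      omega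
    · simp [Nat.testBit_eq_decide_div_mod_eq]
    · simp
    · simpa using hN.ctr .bits
    · have := hN.ctr .bits
      have h3 := hN.ctr .lit
      rw [Polynomial.eval_X]
      exact ((hN.set ((Nat.div_le_self _ _).trans h3)).set (by omega)).set (by omega)
  have h3 : Does (.seq (whilePos .bits₁ (literalStep t)) (.seq (clear .lit)
      (drain .done₁ (inc .bits₁)))) fun m m' w => GroupReady m ∧ m' = m.set .lit 0 ∧
      w = rulesCode (((List.range (m.ctr .bits)).map fun b => posLits t ++
        (bitLits (m.ctr .bits) 3 (m.ctr .idx) ++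
          [litAtom (3 + m.ctr .bits + b) (!(m.ctr .lit).testBit b)])).map termRule) := by
    refine h2.seq h1 ?_
    rintro m _ _ ⟨h, rfl, rfl⟩
    refine ⟨_, _, _, ⟨h, rfl, rfl⟩, ⟨Mem.ext_ctr rfl rfl fun d => ?_, rfl⟩, by simp⟩
    cases d <;> simp [h.done₁, h.bits₁]
  refine (((emits_emitStart (posLits t ++ [litAtom 2 (!s)])).mono
    fun _ _ => trivial).seq emits_patU).does.seq h3 ?_
  rintro m _ _ ⟨h, rfl, rfl⟩
  refine ⟨_, _, _, ⟨h.toReady, rfl, rfl⟩, ⟨h, rfl, rfl⟩, ?_⟩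
  simp [literalTerms, rulesCode, code_termRule]

/-- The symbol is `one`. -/
def isOne : Option CNFSymbol → Bool
  | some .one => true
  | _ => false

/-- The symbol is `pos`. -/
def isPos : Option CNFSymbol → Bool
  | some .pos => true
  | _ => false

/-- The symbol is `neg`. -/
def isNeg : Option CNFSymbol → Bool
  | some .neg => true
  | _ => false

/-- The symbol of a sign. -/
def signSymbol : Bool → CNFSymbol
  | true => .pos
  | false => .neg

/-- The reverse of the string of a clause with the given literals. -/
def clauseString (cl : List (Bool × ℕ)) : List CNFSymbol :=
  cl.flatMap (fun l => List.replicate l.2 .one ++ [signSymbol l.1]) ++ [.clause]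

theorem does_popSav : Does (.pop .sav) fun m m' w => m' = { m with sav := m.sav.tail } ∧ w = [] := by
  refine ⟨.X + 1, ?_⟩
  rintro N m _ _ ⟨rfl, rfl⟩ hm
  simp only [Polynomial.eval_add, Polynomial.eval_X, Polynomial.eval_one]
  refine ⟨fun o => ?_, ⟨hm.inp.trans (by omega), ?_, fun c => (hm.ctr c).trans (by omega)⟩, by simp⟩
  · have : Exec (Cmd.pop (Δ := RegAlphabet) .sav) (m.tapes o)
        ({ m with sav := m.sav.tail }.tapes o) 1 := by
      rw [← Mem.tapes_sav m o m.sav.tail]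
      exact Exec.pop _ _
    exact this.mono (by omega)
  · have := hm.sav
    simp
    omega

/-- Read a number in unary. -/
def readOnes : Prog := .loop .sav isOne (.seq (.pop .sav) (inc .lit))

theorem does_readOnes : Does readOnes fun m m' w => m.ctr .lit = 0 ∧ ∃ k v,
    m.sav = List.replicate k .one ++ v ∧ isOne v.head? = false ∧
    m' = { m with sav := v }.set .lit k ∧ w = [] := by
  refine Does.loop (by simp) (Does.seq (S := fun m m' w => m' =
    { m with sav := m.sav.tail }.set .lit (m.ctr .lit + 1) ∧ w = []) does_popSav (does_inc .lit)
      fun m _ _ ⟨h1, h2⟩ => ⟨_, _, _, ⟨rfl, rfl⟩, ⟨h1, rfl⟩, h2⟩) .X ?_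
  rintro m _ _ ⟨h0, k, v, hs, hv, rfl, rfl⟩
  refine ⟨k, fun i => { m with sav := List.replicate (k - i) CNFSymbol.one ++ v }.set .lit i, fun _ => [],
    Mem.ext_ctr rfl (by simpa using hs) fun d => ?_, ?_, by simp, fun i hi => ⟨?_, ?_, rfl⟩, ?_,
    fun N hN => ?_⟩
  · simp +contextual [h0]
  · simp
  · obtain ⟨e, he⟩ : ∃ e, k - i = e + 1 := ⟨k - i - 1, by omega⟩
    simp only [he, List.replicate_succ]
    rfl
  · obtain ⟨e, he⟩ : ∃ e, k - i = e + 1 := ⟨k - i - 1, by omega⟩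
    have he' : k - (i + 1) = e := by omega
    refine Mem.ext_ctr rfl ?_ fun d => ?_
    · simp [he, he', List.replicate_succ]
    · cases d <;> simp
  · change isOne (List.replicate (k - k) CNFSymbol.one ++ v).head? = false
    simpa using hv
  · have h1 := hN.sav
    rw [hs, List.length_append, List.length_replicate] at h1
    rw [Polynomial.eval_X]
    refine ⟨by omega, fun i hi => Mem.Bdd.set ⟨hN.inp, ?_, hN.ctr⟩ (by omega)⟩
    simp
    omega

/-- Read a literal and write its rules. -/
def emitSlot (t : ℕ) : Prog :=
  .seq readOnes (.ite .sav isPos (.seq (.pop .sav) (emitLiteral t true))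
    (.ite .sav isNeg (.seq (.pop .sav) (emitLiteral t false)) .skip))

/-- The input is read backwards, so a literal appears as its unary index followed by its sign, and
the clause mark comes last. If that mark is on top, the clause has no further literal; nothing is
consumed and the remaining slots are skipped too. -/
theorem does_emitSlot (t : ℕ) : Does (emitSlot t) fun m m' w =>
    (GroupReady m ∧ m.ctr .lit = 0) ∧ ∃ cl v, m.sav = clauseString cl ++ v ∧
    m' = { m with sav := clauseString cl.tail ++ v } ∧ w = rulesCode ((cl.head?.toList.flatMap
      (literalTerms (m.ctr .bits) (m.ctr .idx) t)).map termRule) := by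
  have h1 : ∀ s, Does (.seq (.pop .sav) (emitLiteral t s)) fun m m' w =>
      GroupReady m ∧ m' = { m with sav := m.sav.tail }.set .lit 0 ∧ w = rulesCode ((literalTerms
        (m.ctr .bits) (m.ctr .idx) t (s, m.ctr .lit)).map termRule) :=
    fun s => does_popSav.seq (does_emitLiteral t s) fun m _ _ ⟨h1, h2, h3⟩ =>
      ⟨_, _, _, ⟨rfl, rfl⟩, ⟨⟨⟨h1.temp, h1.half, h1.flag, h1.copy, h1.done₂, h1.bits₂⟩, h1.done₁,
        h1.bits₁⟩, h2, rfl⟩, h3⟩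
  have h2 : Does (.ite .sav isPos (.seq (.pop .sav) (emitLiteral t true))
      (.ite .sav isNeg (.seq (.pop .sav) (emitLiteral t false)) .skip)) fun m m' w =>
      (∃ s v, m.sav = signSymbol s :: v ∧ GroupReady m ∧ m' = { m with sav := v }.set .lit 0 ∧
        w = rulesCode ((literalTerms (m.ctr .bits) (m.ctr .idx) t
          (s, m.ctr .lit)).map termRule)) ∨
      (∃ v, m.sav = .clause :: v) ∧ m' = m ∧ w = [] := by
    refine Does.ite (by simp) (h1 true) (Does.ite (S := fun m m' w =>
      (∃ v, m.sav = .neg :: v ∧ GroupReady m ∧ m' = { m with sav := v }.set .lit 0 ∧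
        w = rulesCode ((literalTerms (m.ctr .bits) (m.ctr .idx) t
          (false, m.ctr .lit)).map termRule)) ∨
      (∃ v, m.sav = .clause :: v) ∧ m' = m ∧ w = []) (by simp) (h1 false) does_skip ?_) ?_
    · rintro m m' w (⟨v, h1, h2, h3, h4⟩ | ⟨⟨v, h1⟩, h2, h3⟩)
      · refine Or.inl ⟨?_, h2, by rw [h1]; exact h3, h4⟩
        change isNeg m.sav.head? = true
        rw [h1]
        rfl
      · refine Or.inr ⟨?_, h2, h3⟩
        change isNeg m.sav.head? = false
        rw [h1]
        rfl
    · rintro m m' w (⟨s, v, h1, h2, h3, h4⟩ | ⟨⟨v, h1⟩, h2, h3⟩)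
      · cases s with
        | true =>
          refine Or.inl ⟨?_, h2, by rw [h1]; exact h3, h4⟩
          change isPos m.sav.head? = true
          rw [h1]
          rfl
        | false =>
          refine Or.inr ⟨?_, Or.inl ⟨v, h1, h2, h3, h4⟩⟩
          change isPos m.sav.head? = false
          rw [h1]
          rfl
      · refine Or.inr ⟨?_, Or.inr ⟨⟨v, h1⟩, h2, h3⟩⟩
        change isPos m.sav.head? = false
        rw [h1]
        rfl
  refine does_readOnes.seq h2 ?_
  rintro m _ _ ⟨⟨hm, h0⟩, cl, v, hs, rfl, rfl⟩
  rcases cl with _ | ⟨⟨s, x⟩, cl⟩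
  · refine ⟨_, _, _, ⟨h0, 0, clauseString [] ++ v, by simpa using hs, rfl, rfl, rfl⟩,
      Or.inr ⟨⟨v, rfl⟩, Mem.ext_ctr rfl rfl fun d => ?_, rfl⟩, by simp⟩
    simp +contextual [h0]
  · refine ⟨_, _, _, ⟨h0, x, signSymbol s :: (clauseString cl ++ v), ?_, ?_, rfl, rfl⟩,
      Or.inl ⟨s, clauseString cl ++ v, rfl, ⟨⟨?_, ?_, ?_, ?_, ?_, ?_⟩, ?_, ?_⟩,
        Mem.ext_ctr rfl rfl fun d => ?_, rfl⟩, ?_⟩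
    · simp [hs, clauseString]
    · cases s <;> rfl
    · simpa using hm.temp
    · simpa using hm.half
    · simpa using hm.flag
    · simpa using hm.copy
    · simpa using hm.done₂
    · simpa using hm.bits₂
    · simpa using hm.done₁
    · simpa using hm.bits₁
    · simp +contextual [h0]
    · simp

end ASP

/-! ### Processing all clauses and all universal variables -/

namespace ASP

theorem GroupReady.withSav {m : Mem} (h : GroupReady m) (v : List CNFSymbol) :
    GroupReady { m with sav := v } :=
  ⟨⟨h.temp, h.half, h.flag, h.copy, h.done₂, h.bits₂⟩, h.done₁, h.bits₁⟩

/-- Read a clause and write its rules. -/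
def emitClause : Prog :=
  .ite .sav Option.isSome
    (.seq (emitSlot 0) (.seq (emitSlot 1) (.seq (emitSlot 2) (.pop .sav))))
    (.seq (emitStart []) (emitBits []))

theorem does_emitClause : Does emitClause fun m m' w => (GroupReady m ∧ m.ctr .lit = 0) ∧
    ∃ cls : List (List (Bool × ℕ)), (∀ cl ∈ cls, cl.length ≤ 3) ∧
      m.sav = cls.flatMap clauseString ∧
      m' = { m with sav := cls.tail.flatMap clauseString } ∧
      w = rulesCode ((clauseTerms (m.ctr .bits) (m.ctr .idx) cls.head?).map termRule) := by
  have h2 : Does (.seq (emitSlot 2) (.pop .sav)) fun m m' w =>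
      (GroupReady m ∧ m.ctr .lit = 0) ∧ ∃ cl v, cl.length ≤ 1 ∧ m.sav = clauseString cl ++ v ∧
      m' = { m with sav := v } ∧ w = rulesCode ((cl.head?.toList.flatMap
        (literalTerms (m.ctr .bits) (m.ctr .idx) 2)).map termRule) := by
    refine (does_emitSlot 2).seq does_popSav ?_
    rintro m _ _ ⟨hm, cl, v, hl, hs, rfl, rfl⟩
    refine ⟨_, _, _, ⟨hm, cl, v, hs, rfl, rfl⟩, ⟨?_, rfl⟩, by simp⟩
    have : cl.tail = [] := List.length_eq_zero_iff.1 (by rw [List.length_tail]; omega)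
    simp [this, clauseString]
  have h1 : Does (.seq (emitSlot 1) (.seq (emitSlot 2) (.pop .sav))) fun m m' w =>
      (GroupReady m ∧ m.ctr .lit = 0) ∧ ∃ cl v, cl.length ≤ 2 ∧ m.sav = clauseString cl ++ v ∧
      m' = { m with sav := v } ∧ w = rulesCode ((cl.head?.toList.flatMap
        (literalTerms (m.ctr .bits) (m.ctr .idx) 1) ++ cl.tail.head?.toList.flatMap
        (literalTerms (m.ctr .bits) (m.ctr .idx) 2)).map termRule) := by
    refine (does_emitSlot 1).seq h2 ?_
    rintro m _ _ ⟨hm, cl, v, hl, hs, rfl, rfl⟩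
    exact ⟨_, _, _, ⟨hm, cl, v, hs, rfl, rfl⟩, ⟨⟨hm.1.withSav _, hm.2⟩, cl.tail, v,
      by rw [List.length_tail]; omega, rfl, rfl, rfl⟩, by simp⟩
  have h0 : Does (.seq (emitSlot 0) (.seq (emitSlot 1) (.seq (emitSlot 2) (.pop .sav))))
      fun m m' w => (GroupReady m ∧ m.ctr .lit = 0) ∧ ∃ cl v, cl.length ≤ 3 ∧
      m.sav = clauseString cl ++ v ∧ m' = { m with sav := v } ∧
      w = rulesCode ((clauseTerms (m.ctr .bits) (m.ctr .idx) (some cl)).map termRule) := by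
    refine (does_emitSlot 0).seq h1 ?_
    rintro m _ _ ⟨hm, cl, v, hl, hs, rfl, rfl⟩
    refine ⟨_, _, _, ⟨hm, cl, v, hs, rfl, rfl⟩, ⟨⟨hm.1.withSav _, hm.2⟩, cl.tail, v,
      by rw [List.length_tail]; omega, rfl, rfl, rfl⟩, ?_⟩
    -- Unrolls `zipIdx` to compare the three slots with the enumerated literals.
    rcases cl with _ | ⟨l₁, _ | ⟨l₂, _ | ⟨l₃, _ | ⟨l₄, cl⟩⟩⟩⟩
    · simp [clauseTerms]
    · simp [clauseTerms]
    · simp [clauseTerms]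
    · simp [clauseTerms]
    · simp at hl
      omega
  refine Does.ite (by simp) h0 (((emits_emitStart []).mono fun _ _ => trivial).seq
    emits_patU).does ?_
  rintro m _ _ ⟨hm, cls, hl, hs, rfl, rfl⟩
  rcases cls with _ | ⟨cl, cls⟩
  · refine Or.inr ⟨?_, hm.1.toReady, Mem.ext_ctr rfl hs.symm fun _ => rfl, ?_⟩
    · change m.sav.head?.isSome = false
      rw [hs]
      rfl
    · simp [clauseTerms, code_termRule]
  · refine Or.inl ⟨?_, hm, cl, cls.flatMap clauseString, hl cl (by simp), hs, rfl, rfl⟩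
    change m.sav.head?.isSome = true
    rw [hs]
    simp [clauseString]

/-- Write a group of rules. -/
def emitGroup : Prog := .seq emitVars (.seq emitClause (.seq (dec .rest) (inc .idx)))

theorem does_emitGroup : Does emitGroup fun m m' w => (GroupReady m ∧ m.ctr .lit = 0) ∧
    ∃ cls : List (List (Bool × ℕ)), (∀ cl ∈ cls, cl.length ≤ 3) ∧
      m.sav = cls.flatMap clauseString ∧
      m' = ({ m with sav := cls.tail.flatMap clauseString }.set .rest (m.ctr .rest - 1)).set .idx
        (m.ctr .idx + 1) ∧
      w = rulesCode ((List.range 3).map (fun c =>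
        guessRule (varIdx (m.ctr .bits) (m.ctr .idx) c)) ++
        (varLits.map (varTerm (m.ctr .bits) (m.ctr .idx)) ++
          clauseTerms (m.ctr .bits) (m.ctr .idx) cls.head?).map termRule) := by
  have h1 : Does (.seq (dec .rest) (inc .idx)) fun m m' w =>
      m' = (m.set .rest (m.ctr .rest - 1)).set .idx (m.ctr .idx + 1) ∧ w = [] :=
    (does_dec .rest).seq (does_inc .idx) fun m _ _ ⟨h1, h2⟩ =>
      ⟨_, _, _, ⟨rfl, rfl⟩, ⟨h1, rfl⟩, h2⟩
  refine emits_emitVars.does.seq (does_emitClause.seq (S := fun m m' w =>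
    (GroupReady m ∧ m.ctr .lit = 0) ∧
    ∃ cls : List (List (Bool × ℕ)), (∀ cl ∈ cls, cl.length ≤ 3) ∧
      m.sav = cls.flatMap clauseString ∧
      m' = ({ m with sav := cls.tail.flatMap clauseString }.set .rest (m.ctr .rest - 1)).set .idx
        (m.ctr .idx + 1) ∧
      w = rulesCode ((clauseTerms (m.ctr .bits) (m.ctr .idx) cls.head?).map termRule)) h1 ?_) ?_
  · rintro m _ _ ⟨hm, cls, hl, hs, rfl, rfl⟩
    exact ⟨_, _, _, ⟨hm, cls, hl, hs, rfl, rfl⟩, ⟨rfl, rfl⟩, by simp⟩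
  · rintro m _ _ ⟨hm, cls, hl, hs, rfl, rfl⟩
    exact ⟨_, _, _, ⟨hm.1.toReady, rfl, rfl⟩, ⟨hm, cls, hl, hs, rfl, rfl⟩, by simp⟩

/-- Write all groups of rules. -/
def emitGroups : Prog := whilePos .rest emitGroup

/-- Before round `k` the stack `sav` holds the clauses from index `k` on. There are as many rounds
as there are indices, possibly more than clauses; in the surplus rounds the list is empty. -/
theorem does_emitGroups : Does emitGroups fun m m' w =>
    (GroupReady m ∧ m.ctr .lit = 0 ∧ m.ctr .idx = 0) ∧
    ∃ cls : List (List (Bool × ℕ)), (∀ cl ∈ cls, cl.length ≤ 3) ∧ cls.length ≤ m.ctr .rest ∧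
      m.sav = cls.flatMap clauseString ∧
      m' = ({ m with sav := [] }.set .rest 0).set .idx (m.ctr .rest) ∧
      w = rulesCode ((List.range (m.ctr .rest)).flatMap (groupRules (m.ctr .bits) cls)) := by
  refine does_emitGroup.whilePos .X ?_
  rintro m _ _ ⟨⟨hm, h0, h1⟩, cls, hl, hlen, hs, rfl, rfl⟩
  refine ⟨m.ctr .rest, fun k => ({ m with sav := (cls.drop k).flatMap clauseString }.set .rest
    (m.ctr .rest - k)).set .idx k, fun k => rulesCode (groupRules (m.ctr .bits) cls k),
    Mem.ext_ctr rfl (by simpa using hs) fun d => ?_, ?_, ?_,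
    fun k hk => ⟨?_, ⟨⟨⟨?_, ?_, ?_, ?_, ?_, ?_⟩, ?_, ?_⟩, ?_⟩, cls.drop k,
      fun cl h => hl cl (List.mem_of_mem_drop h), rfl, ?_, ?_⟩, ?_, fun N hN => ⟨?_, fun k hk => ?_⟩⟩
  · cases d <;> simp [h1]
  · simp [List.drop_eq_nil_of_le hlen]
  · simp [rulesCode, List.flatMap_assoc]
  · simp
    omega
  · simpa using hm.temp
  · simpa using hm.half
  · simpa using hm.flag
  · simpa using hm.copy
  · simpa using hm.done₂
  · simpa using hm.bits₂
  · simpa using hm.done₁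
  · simpa using hm.bits₁
  · simpa using h0
  · refine Mem.ext_ctr rfl (by simp) fun d => ?_
    cases d <;> simp
    omega
  · simp [groupRules, groupTerms]
  · simp
  · simpa using hN.ctr .rest
  · have h2 := hN.ctr .rest
    have h3 := hN.sav
    rw [Polynomial.eval_X]
    refine Mem.Bdd.set (Mem.Bdd.set ⟨hN.inp, ?_, hN.ctr⟩ (by omega)) (by omega)
    rw [hs, ← List.take_append_drop k cls, List.flatMap_append, List.length_append] at h3
    exact le_trans (Nat.le_add_left _ _) h3

/-! ### Writing the rules for the universal variables -/

/-- The rules of a universal literal. -/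
def starTemplates (y : Atom) : List RuleTemplate :=
  [⟨[y], [(0, [])], []⟩, ⟨[], [], [y]⟩, ⟨[(0, [])], [], [y]⟩, ⟨[], [(0, [])], [y]⟩]

/-- The rules of a universal variable. -/
def univTemplates (l : List Ctr) : List RuleTemplate :=
  ⟨[(7, l), (8, l)], [], []⟩ :: (starTemplates (7, l) ++ starTemplates (8, l))

theorem emits_univTemplates {l : List Ctr} (hl : .temp ∉ l) :
    Emits (emitRules (univTemplates l)) (fun m => m.ctr .temp = 0)
      fun m => rulesCode ((univTemplates l).map (RuleTemplate.eval m)) := by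
  refine emits_emitRules _ fun r hr t ht => ?_
  simp only [univTemplates, starTemplates, List.mem_cons, List.mem_append, List.not_mem_nil,
    or_false] at hr
  rcases hr with rfl | (rfl | rfl | rfl | rfl) | (rfl | rfl | rfl | rfl) <;> simp at ht <;>
    rcases ht with rfl | rfl <;> simp [hl]

theorem eval_univTemplates {l : List Ctr} {m : Mem} {z : ℕ} (hz : 2 * z = 6 + (l.map m.ctr).sum) :
    (univTemplates l).map (RuleTemplate.eval m) = univRules z := by
  have h1 : Atom.eval m (7, l) = litAtom z false := by
    simp [Atom.eval, litAtom]
    omega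
  have h2 : Atom.eval m (8, l) = litAtom z true := by
    simp [Atom.eval, litAtom]
    omega
  have h3 : Atom.eval m (0, []) = 0 := rfl
  simp [univTemplates, starTemplates, RuleTemplate.eval, univRules, starRules, guessRule, h1, h2, h3]

/-- Write the rules for the bits of an index. -/
def emitUniv (l : List Ctr) : Prog :=
  .seq (whilePos .bits₂ (.seq (emitRules (univTemplates (l ++ [.done₂, .done₂])))
    (.seq (dec .bits₂) (inc .done₂)))) (drain .done₂ (inc .bits₂))

theorem emits_emitUniv (l : List Ctr) (hl : ∀ x ∈ l, x = .bits) (d : Mem → ℕ)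
    (hd : ∀ m, 2 * d m = 6 + (l.map m.ctr).sum) : Emits (emitUniv l) Ready
      fun m => rulesCode ((List.range (m.ctr .bits)).flatMap fun b => univRules (d m + b)) := by
  have h1 : Does (.seq (dec .bits₂) (inc .done₂)) fun m m' w =>
      m' = (m.set .bits₂ (m.ctr .bits₂ - 1)).set .done₂ (m.ctr .done₂ + 1) ∧ w = [] :=
    (does_dec .bits₂).seq (does_inc .done₂) fun m _ _ ⟨h1, h2⟩ =>
      ⟨_, _, _, ⟨rfl, rfl⟩, ⟨h1, rfl⟩, h2⟩
  have h2 : Does (whilePos .bits₂ (.seq (emitRules (univTemplates (l ++ [.done₂, .done₂])))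
      (.seq (dec .bits₂) (inc .done₂)))) fun m m' w => Ready m ∧
      m' = (m.set .bits₂ 0).set .done₂ (m.ctr .bits) ∧
      w = rulesCode ((List.range (m.ctr .bits)).flatMap fun b => univRules (d m + b)) := by
    refine Does.whilePos ((emits_univTemplates (l := l ++ [.done₂, .done₂])
      (by simpa using fun h => by simpa using hl _ h)).does.seq (S := fun m m' w =>
        m.ctr .temp = 0 ∧ m' = (m.set .bits₂ (m.ctr .bits₂ - 1)).set .done₂ (m.ctr .done₂ + 1) ∧
        w = rulesCode (univRules (d m + m.ctr .done₂))) h1 ?_) .X ?_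
    · rintro m _ _ ⟨h, rfl, rfl⟩
      refine ⟨_, _, _, ⟨h, rfl, rfl⟩, ⟨rfl, rfl⟩, ?_⟩
      rw [eval_univTemplates (z := d m + m.ctr .done₂), List.append_nil]
      have := hd m
      simp
      omega
    · rintro m _ _ ⟨h, rfl, rfl⟩
      have hc : ∀ k, d ((m.set .bits₂ (m.ctr .bits - k)).set .done₂ k) = d m := by
        intro k
        have e1 := hd m
        have e2 := hd ((m.set .bits₂ (m.ctr .bits - k)).set .done₂ k)
        have e3 : l.map ((m.set .bits₂ (m.ctr .bits - k)).set .done₂ k).ctr = l.map m.ctr := by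
          refine List.map_congr_left fun x hx => ?_
          rw [hl x hx]
          simp
        rw [e3] at e2
        omega
      refine ⟨m.ctr .bits, fun k => (m.set .bits₂ (m.ctr .bits - k)).set .done₂ k,
        fun b => rulesCode (univRules (d m + b)), Mem.ext_ctr rfl rfl fun d => ?_, ?_, ?_,
        fun k hk => ⟨?_, ?_, Mem.ext_ctr rfl rfl fun d => ?_, ?_⟩, ?_,
        fun N hN => ⟨?_, fun k hk => ?_⟩⟩
      · cases d <;> simp [h.bits₂, h.done₂]
      · simp
      · simp [rulesCode, List.flatMap_assoc]
      · simp
        omega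
      · simpa using h.temp
      · cases d <;> simp
        omega
      · simp [hc]
      · simp
      · simpa using hN.ctr .bits
      · have := hN.ctr .bits
        rw [Polynomial.eval_X]
        exact (hN.set (by omega)).set (by omega)
  refine h2.seq (does_drain (x := .done₂) (by simp) (does_inc_add .bits₂)) ?_
  rintro _ m _ ⟨h, rfl, rfl⟩
  refine ⟨_, _, _, ⟨h, rfl, rfl⟩, ⟨Mem.ext_ctr rfl rfl fun d => ?_, rfl⟩, by simp⟩
  cases d <;> simp [h.done₂, h.bits₂]

/-- Write the rules that do not belong to a group. -/
def emitHeader : Prog :=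
  .seq (emitList (rulesCode (negZeroRules ++ (List.range 3).flatMap univRules)))
    (.seq (emitUniv []) (emitUniv [.bits, .bits]))

theorem emits_emitHeader : Emits emitHeader Ready fun m => rulesCode (negZeroRules ++
    (List.range (3 + 2 * m.ctr .bits)).flatMap univRules) := by
  refine (((emits_emitList _).mono fun _ _ => trivial).seq ((emits_emitUniv [] (by simp)
    (fun _ => 3) (by simp)).seq (emits_emitUniv [.bits, .bits] (by simp)
    (fun m => 3 + m.ctr .bits) (by intro m; simp; omega)))).weaken fun m hm => ⟨hm, ?_⟩
  -- Separates the two blocks of index variables, which are written by separate loops.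
  have : 3 + 2 * m.ctr .bits = 3 + (m.ctr .bits + m.ctr .bits) := by omega
  rw [this, List.range_add, List.range_add]
  simp [rulesCode, List.flatMap_append, List.flatMap_map, add_assoc]

end ASP

/-! ### From the input string to the complete reduction -/

namespace ASP

/-! ### Reading the input -/

theorem does_popInp : Does (.pop .inp) fun m m' w => m' = { m with inp := m.inp.tail } ∧ w = [] := by
  refine ⟨.X + 1, ?_⟩
  rintro N m _ _ ⟨rfl, rfl⟩ hm
  simp only [Polynomial.eval_add, Polynomial.eval_X, Polynomial.eval_one]
  refine ⟨fun o => ?_, ⟨?_, hm.sav.trans (by omega), fun c => (hm.ctr c).trans (by omega)⟩, by simp⟩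
  · have : Exec (Cmd.pop (Δ := RegAlphabet) .inp) (m.tapes o)
        ({ m with inp := m.inp.tail }.tapes o) 1 := by
      rw [← Mem.tapes_inp m o m.inp.tail]
      exact Exec.pop _ _
    exact this.mono (by omega)
  · have := hm.inp
    simp
    omega

theorem does_pushSav (x : CNFSymbol) : Does (.push .sav x) fun m m' w =>
    m' = { m with sav := x :: m.sav } ∧ w = [] := by
  refine ⟨.X + 1, ?_⟩
  rintro N m _ _ ⟨rfl, rfl⟩ hm
  simp only [Polynomial.eval_add, Polynomial.eval_X, Polynomial.eval_one]
  refine ⟨fun o => ?_, ⟨hm.inp.trans (by omega), ?_, fun c => (hm.ctr c).trans (by omega)⟩, by simp⟩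
  · have : Exec (Cmd.push (Δ := RegAlphabet) .sav x) (m.tapes o)
        ({ m with sav := x :: m.sav }.tapes o) 1 := by
      rw [← Mem.tapes_sav m o (x :: m.sav)]
      exact Exec.push _ _ _
    exact this.mono (by omega)
  · have := hm.sav
    simp
    omega

open Classical in
/-- The symbol is `x`. -/
noncomputable def isSymbol (x : CNFSymbol) (o : Option CNFSymbol) : Bool := decide (o = some x)

/-- Copy the next symbol of the input. -/
noncomputable def saveSymbol : List CNFSymbol → Prog
  | [] => .skip
  | x :: l => .ite .inp (isSymbol x) (.push .sav x) (saveSymbol l)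

theorem does_saveSymbol (l : List CNFSymbol) : Does (saveSymbol l) fun m m' w =>
    ∃ x ∈ l, m.inp.head? = some x ∧ m' = { m with sav := x :: m.sav } ∧ w = [] := by
  induction l with
  | nil => exact does_skip.weaken fun m m' w ⟨x, hx, _⟩ => by simp at hx
  | cons y l ih =>
    refine Does.ite (by simp) (does_pushSav y) ih ?_
    rintro m m' w ⟨x, hx, h1, h2, h3⟩
    by_cases h : x = y
    · subst h
      refine Or.inl ⟨?_, h2, h3⟩
      change isSymbol x m.inp.head? = true
      simp [isSymbol, h1]
    · refine Or.inr ⟨?_, x, (List.mem_cons.1 hx).resolve_left h, h1, h2, h3⟩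
      change isSymbol y m.inp.head? = false
      simp [isSymbol, h1, h]

/-- Reverse the input, and count its symbols. -/
noncomputable def readInput : Prog :=
  .loop .inp Option.isSome
    (.seq (saveSymbol [.clause, .pos, .neg, .one]) (.seq (.pop .inp) (inc .lit)))

/-- The length of the input is collected in `lit`; it is the quantity from which the number of bits
is computed. -/
theorem does_readInput : Does readInput fun m m' w => (m.sav = [] ∧ m.ctr .lit = 0) ∧
    m' = { m with inp := [], sav := m.inp.reverse }.set .lit m.inp.length ∧ w = [] := by
  have h1 : Does (.seq (.pop .inp) (inc .lit)) fun m m' w =>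
      m' = { m with inp := m.inp.tail }.set .lit (m.ctr .lit + 1) ∧ w = [] :=
    does_popInp.seq (does_inc .lit) fun m _ _ ⟨h1, h2⟩ => ⟨_, _, _, ⟨rfl, rfl⟩, ⟨h1, rfl⟩, h2⟩
  refine Does.loop (by simp) ((does_saveSymbol [.clause, .pos, .neg, .one]).seq (S := fun m m' w =>
    ∃ x, m.inp.head? = some x ∧ m' = { m with inp := m.inp.tail, sav := x :: m.sav }.set .lit
      (m.ctr .lit + 1) ∧ w = []) h1 ?_) .X ?_
  · rintro m _ _ ⟨x, hx, rfl, rfl⟩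
    exact ⟨_, _, _, ⟨x, by cases x <;> simp, hx, rfl, rfl⟩, ⟨rfl, rfl⟩, rfl⟩
  · rintro m _ _ ⟨⟨h1, h2⟩, rfl, rfl⟩
    refine ⟨m.inp.length, fun k => (⟨m.inp.drop k, (m.inp.take k).reverse,
      m.ctr⟩ : Mem).set .lit k, fun _ => [], Mem.ext_ctr rfl (by simp [h1])
      fun d => ?_, ?_, by simp, fun k hk => ⟨?_, m.inp[k], ?_, ?_, rfl⟩, ?_,
      fun N hN => ⟨?_, fun k hk => ?_⟩⟩
    · simp +contextual [h2]
    · simp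
    · change (m.inp.drop k).head?.isSome = true
      simpa using hk
    · simp [hk]
    · refine Mem.ext_ctr (by simp) ?_ fun d => ?_
      · change (m.inp.take (k + 1)).reverse = m.inp[k] :: (m.inp.take k).reverse
        rw [List.take_succ_eq_append_getElem hk, List.reverse_append]
        rfl
      · cases d <;> simp
    · change (m.inp.drop m.inp.length).head?.isSome = false
      simp
    · simpa using hN.inp
    · have h3 := hN.inp
      rw [Polynomial.eval_X]
      refine Mem.Bdd.set ⟨?_, ?_, hN.ctr⟩ (by omega)
      · simp
        omega
      · simp
        omega

/-- Add one to the number of bits. -/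
def incBits : Prog := .seq (inc .bits) (.seq (inc .bits₁) (inc .bits₂))

theorem does_incBits : Does incBits fun m m' w =>
    m' = ((m.set .bits (m.ctr .bits + 1)).set .bits₁ (m.ctr .bits₁ + 1)).set .bits₂
      (m.ctr .bits₂ + 1) ∧ w = [] :=
  (does_inc .bits).seq ((does_inc .bits₁).seq (S := fun m m' w =>
    m' = (m.set .bits₁ (m.ctr .bits₁ + 1)).set .bits₂ (m.ctr .bits₂ + 1) ∧ w = [])
    (does_inc .bits₂) fun _ _ _ ⟨h1, h2⟩ => ⟨_, _, _, ⟨rfl, rfl⟩, ⟨h1, rfl⟩, h2⟩)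
    fun _ _ _ ⟨h1, h2⟩ => ⟨_, _, _, ⟨rfl, rfl⟩, ⟨h1, rfl⟩, h2⟩

/-- Double `rest`. -/
def double : Prog := .seq (copyTo .rest .copy) (drain .copy (inc .rest))

theorem does_double : Does double fun m m' w => (m.ctr .temp = 0 ∧ m.ctr .copy = 0) ∧
    m' = m.set .rest (2 * m.ctr .rest) ∧ w = [] := by
  refine (does_copyTo (x := .rest) (y := .copy) (by simp) (by simp) (by simp)).seq
    (does_drain (x := .copy) (by simp) (does_inc_add .rest)) ?_
  rintro m _ _ ⟨⟨h1, h2⟩, rfl, rfl⟩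
  refine ⟨_, _, _, ⟨h1, rfl, rfl⟩, ⟨Mem.ext_ctr rfl rfl fun d => ?_, rfl⟩, by simp⟩
  cases d <;> simp [h2]
  omega

/-- Halve `lit`. -/
def halveLit : Prog := .seq (halve .lit) (clear .flag)

theorem does_halveLit : Does halveLit fun m m' w => (m.ctr .half = 0 ∧ m.ctr .flag = 0) ∧
    m' = m.set .lit (m.ctr .lit / 2) ∧ w = [] := by
  refine (does_halve (x := .lit) (by simp) (by simp)).seq (does_clear .flag) ?_
  rintro m _ _ ⟨⟨h1, h2⟩, rfl, rfl⟩
  refine ⟨_, _, _, ⟨⟨h1, h2⟩, rfl, rfl⟩, ⟨Mem.ext_ctr rfl rfl fun d => ?_, rfl⟩, rfl⟩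
  cases d <;> simp [h2]

/-- One step of the computation of the number of bits. -/
def sizeStep : Prog := .seq (.seq halveLit double) incBits

theorem does_sizeStep : Does sizeStep fun m m' w =>
    (m.ctr .temp = 0 ∧ m.ctr .half = 0 ∧ m.ctr .flag = 0 ∧ m.ctr .copy = 0) ∧
    m' = ((((m.set .lit (m.ctr .lit / 2)).set .rest (2 * m.ctr .rest)).set .bits
      (m.ctr .bits + 1)).set .bits₁ (m.ctr .bits₁ + 1)).set .bits₂ (m.ctr .bits₂ + 1) ∧
    w = [] := by
  refine (does_halveLit.seq does_double (S := fun m m' w =>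
    (m.ctr .temp = 0 ∧ m.ctr .half = 0 ∧ m.ctr .flag = 0 ∧ m.ctr .copy = 0) ∧
    m' = (m.set .lit (m.ctr .lit / 2)).set .rest (2 * m.ctr .rest) ∧ w = []) ?_).seq
    does_incBits ?_
  · rintro m _ _ ⟨⟨h1, h2, h3, h4⟩, rfl, rfl⟩
    exact ⟨_, _, _, ⟨⟨h2, h3⟩, rfl, rfl⟩, ⟨⟨by simpa using h1, by simpa using h4⟩, by simp, rfl⟩,
      rfl⟩
  · rintro m _ _ ⟨h, rfl, rfl⟩
    exact ⟨_, _, _, ⟨h, rfl, rfl⟩, ⟨by simp, rfl⟩, rfl⟩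

/-- Compute the number of bits. -/
def computeSize : Prog := whilePos .lit sizeStep

/-- Halving a number until it vanishes takes as many rounds as it has bits. Meanwhile `rest` doubles
from `1` to `2 ^ a`, the number of groups. -/
theorem does_computeSize : Does computeSize fun m m' w =>
    (m.ctr .temp = 0 ∧ m.ctr .half = 0 ∧ m.ctr .flag = 0 ∧ m.ctr .copy = 0 ∧ m.ctr .rest = 1 ∧
      m.ctr .bits = 0 ∧ m.ctr .bits₁ = 0 ∧ m.ctr .bits₂ = 0) ∧
    m' = ((((m.set .lit 0).set .rest (2 ^ (m.ctr .lit).size)).set .bits (m.ctr .lit).size).set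
      .bits₁ (m.ctr .lit).size).set .bits₂ (m.ctr .lit).size ∧ w = [] := by
  refine does_sizeStep.whilePos (2 * .X + 1) ?_
  rintro m _ _ ⟨⟨e1, e2, e3, e4, e5, e6, e7, e8⟩, rfl, rfl⟩
  have f1 : ∀ k < (m.ctr .lit).size, 2 ^ k ≤ m.ctr .lit := fun k hk => Nat.lt_size.1 hk
  have f2 : m.ctr .lit / 2 ^ (m.ctr .lit).size = 0 := Nat.div_eq_of_lt (Nat.lt_size_self _)
  have f3 : (m.ctr .lit).size ≤ m.ctr .lit := Nat.size_le.2 Nat.lt_two_pow_self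
  generalize (m.ctr .lit).size = n at f1 f2 f3 ⊢
  refine ⟨n, fun k => ((((m.set .lit (m.ctr .lit / 2 ^ k)).set .rest
    (2 ^ k)).set .bits k).set .bits₁ k).set .bits₂ k, fun _ => [], ?_, ?_, by simp, ?_, ?_, ?_⟩
  · refine Mem.ext_ctr rfl rfl fun d => ?_
    cases d <;> simp [e5, e6, e7, e8]
  · simp only [f2]
  · intro k hk
    refine ⟨?_, ?_, ?_, rfl⟩
    · have := (Nat.div_pos (f1 k hk) (Nat.two_pow_pos k)).ne'
      simpa only [Mem.ctr_set, reduceCtorEq, if_false, if_true] using this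
    · simp only [Mem.ctr_set, reduceCtorEq, if_false]
      exact ⟨e1, e2, e3, e4⟩
    · refine Mem.ext_ctr (by simp only [Mem.inp_set]) (by simp only [Mem.sav_set]) fun d => ?_
      cases d <;> simp [Nat.pow_succ, Nat.div_div_eq_div_mul]
      omega
  · simpa only [Mem.ctr_set, reduceCtorEq, if_false, if_true] using f2
  · intro N hN
    have h4 := hN.ctr .lit
    have h6 : Polynomial.eval N (2 * .X + 1 : Polynomial ℕ) = 2 * N + 1 := by simp
    rw [h6]
    refine ⟨by omega, fun k hk => ?_⟩
    -- The power stays linear in the input because round `k - 1` was entered with `2 ^ (k - 1)` at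
    -- most the initial value of `lit`.
    have h7 : 2 ^ k ≤ 2 * N + 1 := by
      rcases k with _ | k
      · simp
      · have := f1 k hk
        rw [Nat.pow_succ]
        omega
    have h8 := Nat.div_le_self (m.ctr .lit) (2 ^ k)
    exact ((((Mem.Bdd.set (hN.mono (by omega)) (by omega)).set h7).set (by omega)).set
      (by omega)).set (by omega)

/-- The initial stacks. -/
def initMem (v : List CNFSymbol) : Mem := ⟨v, [], fun _ => 0⟩

/-- The stacks after reading the input. -/
def readMem (v : List CNFSymbol) : Mem :=
  ⟨[], v.reverse, fun
    | .bits | .bits₁ | .bits₂ => v.length.size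
    | .rest => 2 ^ v.length.size
    | _ => 0⟩

/-- Read the input and compute the number of bits. -/
noncomputable def prepare : Prog := .seq readInput (.seq (inc .rest) computeSize)

theorem does_prepare : Does prepare fun m m' w => ∃ v, m = initMem v ∧ m' = readMem v ∧ w = [] := by
  refine does_readInput.seq ((does_inc .rest).seq (S := fun m m' w => ∃ v,
    m = (⟨[], v.reverse, fun _ => 0⟩ : Mem).set .lit v.length ∧ m' = readMem v ∧ w = [])
    does_computeSize ?_) ?_
  · rintro _ _ _ ⟨v, rfl, rfl, rfl⟩
    refine ⟨_, _, _, ⟨rfl, rfl⟩, ⟨by simp, Mem.ext_ctr rfl rfl fun d => ?_, rfl⟩, rfl⟩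
    cases d <;> simp [readMem]
  · rintro _ _ _ ⟨v, rfl, rfl, rfl⟩
    exact ⟨_, _, _, ⟨⟨rfl, rfl⟩, rfl, rfl⟩, ⟨v, rfl, rfl, rfl⟩, rfl⟩

/-- Set the remaining counters to zero. -/
def cleanup : Prog := .seq (clear .idx) (.seq (clear .bits) (.seq (clear .bits₁) (clear .bits₂)))

/-- These are the counters that may still be nonzero after the groups; the following machine needs
all stacks but the output empty. -/
theorem does_cleanup : Does cleanup fun m m' w =>
    m' = (((m.set .idx 0).set .bits 0).set .bits₁ 0).set .bits₂ 0 ∧ w = [] :=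
  (does_clear .idx).seq ((does_clear .bits).seq (S := fun m m' w =>
    m' = ((m.set .bits 0).set .bits₁ 0).set .bits₂ 0 ∧ w = []) ((does_clear .bits₁).seq
    (S := fun m m' w => m' = (m.set .bits₁ 0).set .bits₂ 0 ∧ w = []) (does_clear .bits₂)
    fun _ _ _ ⟨h1, h2⟩ => ⟨_, _, _, ⟨rfl, rfl⟩, ⟨h1, rfl⟩, h2⟩)
    fun _ _ _ ⟨h1, h2⟩ => ⟨_, _, _, ⟨rfl, rfl⟩, ⟨h1, rfl⟩, h2⟩)
    fun _ _ _ ⟨h1, h2⟩ => ⟨_, _, _, ⟨rfl, rfl⟩, ⟨h1, rfl⟩, h2⟩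

/-- The program that computes the reduction. -/
noncomputable def reductionProg : Prog :=
  .seq prepare (.seq emitHeader (.seq emitGroups cleanup))

theorem does_reductionProg : Does reductionProg fun m m' w => ∃ (v : List CNFSymbol)
    (cls : List (List (Bool × ℕ))), (∀ cl ∈ cls, cl.length ≤ 3) ∧ cls.length ≤ 2 ^ v.length.size ∧
    v.reverse = cls.flatMap clauseString ∧ m = initMem v ∧ m' = initMem [] ∧
    w = rulesCode (listRules v.length.size cls) := by
  have h1 : Does (.seq emitGroups cleanup) fun m m' w => ∃ (v : List CNFSymbol)
      (cls : List (List (Bool × ℕ))), (∀ cl ∈ cls, cl.length ≤ 3) ∧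
      cls.length ≤ 2 ^ v.length.size ∧
      v.reverse = cls.flatMap clauseString ∧ m = readMem v ∧ m' = initMem [] ∧
      w = rulesCode ((List.range (2 ^ v.length.size)).flatMap (groupRules v.length.size cls)) := by
    refine does_emitGroups.seq does_cleanup ?_
    rintro _ _ _ ⟨v, cls, h1, h2, h3, rfl, rfl, rfl⟩
    refine ⟨_, _, _, ⟨⟨⟨⟨rfl, rfl, rfl, rfl, rfl, rfl⟩, rfl, rfl⟩, rfl, rfl⟩, cls, h1, h2, h3, rfl,
      rfl⟩, ⟨Mem.ext_ctr rfl rfl fun d => ?_, rfl⟩, by simp [readMem]⟩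
    cases d <;> simp [readMem, initMem]
  refine does_prepare.seq (emits_emitHeader.does.seq (S := fun m m' w => ∃ (v : List CNFSymbol)
      (cls : List (List (Bool × ℕ))), (∀ cl ∈ cls, cl.length ≤ 3) ∧
      cls.length ≤ 2 ^ v.length.size ∧
      v.reverse = cls.flatMap clauseString ∧ m = readMem v ∧ m' = initMem [] ∧
      w = rulesCode (listRules v.length.size cls)) h1 ?_) ?_
  · rintro _ _ _ ⟨v, cls, h1, h2, h3, rfl, rfl, rfl⟩
    exact ⟨_, _, _, ⟨⟨rfl, rfl, rfl, rfl, rfl, rfl⟩, rfl, rfl⟩,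
      ⟨v, cls, h1, h2, h3, rfl, rfl, rfl⟩, by simp [listRules, readMem]⟩
  · rintro _ _ _ ⟨v, cls, h1, h2, h3, rfl, rfl, rfl⟩
    exact ⟨_, _, _, ⟨v, rfl, rfl, rfl⟩, ⟨v, cls, h1, h2, h3, rfl, rfl, rfl⟩, rfl⟩

theorem tapes_initMem_inp (v : List CNFSymbol) :
    (initMem v).tapes [] = Function.update (fun r => ([] : List (RegAlphabet r))) Reg.inp v := by
  funext r
  rcases r with _ | _ | _ | c
  · exact (Function.update_self (β := fun r => List (RegAlphabet r)) Reg.inp v _).symm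
  all_goals exact (Function.update_of_ne (by simp) ..).symm

theorem tapes_initMem_out (w : List ProgramSymbol) :
    (initMem []).tapes w = Function.update (fun r => ([] : List (RegAlphabet r))) Reg.out w := by
  funext r
  rcases r with _ | _ | _ | c
  · exact (Function.update_of_ne (by simp) ..).symm
  · exact (Function.update_of_ne (by simp) ..).symm
  · exact (Function.update_self (β := fun r => List (RegAlphabet r)) Reg.out w _).symm
  · exact (Function.update_of_ne (by simp) ..).symm

/-- The reduction can be computed in polynomial time. -/
theorem exists_exec_reductionProg : ∃ p : Polynomial ℕ, ∀ (v : List CNFSymbol)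
    (cls : List (List (Bool × ℕ))), (∀ cl ∈ cls, cl.length ≤ 3) →
    v.reverse = cls.flatMap clauseString → cls.length ≤ 2 ^ v.length.size →
    Exec reductionProg (Function.update (fun r => ([] : List (RegAlphabet r))) Reg.inp v)
      (Function.update (fun r => ([] : List (RegAlphabet r))) Reg.out
        (rulesCode (listRules v.length.size cls)).reverse)
      (p.eval v.length) ∧ (rulesCode (listRules v.length.size cls)).length ≤ p.eval v.length := by
  obtain ⟨p, hp⟩ := does_reductionProg
  refine ⟨p, fun v cls h1 h2 h3 => ?_⟩
  obtain ⟨h4, -, h5⟩ := hp v.length _ _ _ ⟨v, cls, h1, h3, h2, rfl, rfl, rfl⟩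
    ⟨le_rfl, by simp [initMem], by simp [initMem]⟩
  have := h4 []
  rw [List.append_nil, tapes_initMem_inp, tapes_initMem_out] at this
  exact ⟨this, h5⟩

end ASP

/-! ### Size of the formula, asymptotics and conclusion -/

namespace ASP

/-! ### Formulas as lists -/

/-- The literals of a clause, in the reverse of the order in which they are written. -/
def Clause.literals (c : Clause) : List (Bool × ℕ) :=
  ((c.pos.sort (· ≤ ·)).map (Prod.mk true) ++ (c.neg.sort (· ≤ ·)).map (Prod.mk false)).reverse

theorem Clause.mem_literals {c : Clause} {b : Bool} {x : ℕ} :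
    (b, x) ∈ c.literals ↔ (b = true ∧ x ∈ c.pos) ∨ (b = false ∧ x ∈ c.neg) := by
  simp [literals, eq_comm, and_comm, or_comm]

theorem Clause.length_literals (c : Clause) :
    c.literals.length = c.pos.card + c.neg.card := by simp [literals, add_comm]

theorem Clause.reverse_code (c : Clause) : c.code.reverse = clauseString c.literals := by
  simp [code, clauseString, literals, List.reverse_flatMap, ← List.map_reverse, List.flatMap_map,
    Function.comp_def, signSymbol]

theorem Clause.length_code (c : Clause) :
    c.code.length = 1 + (c.literals.map fun l => l.2 + 1).sum := by
  rw [← List.length_reverse, c.reverse_code, clauseString, List.length_append, List.length_flatMap]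
  simp [add_comm]

/-- The lists of literals of the clauses, in reverse order. -/
def clauseLists (L : List Clause) : List (List (Bool × ℕ)) := L.reverse.map Clause.literals

theorem reverse_flatMap_code (L : List Clause) :
    (L.flatMap Clause.code).reverse = (clauseLists L).flatMap clauseString := by
  rw [List.reverse_flatMap, clauseLists, List.flatMap_map]
  congr 1
  funext c
  exact c.reverse_code

theorem length_clauseLists_le (L : List Clause) :
    (clauseLists L).length ≤ (L.flatMap Clause.code).length := by
  rw [List.length_flatMap, clauseLists, List.length_map, List.length_reverse]
  refine (List.length_le_sum_of_one_le _ ?_).trans' (by simp)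
  intro i hi
  obtain ⟨c, -, rfl⟩ := List.mem_map.1 hi
  rw [c.length_code]
  omega

/-- The length of the string bounds both the number of clauses, each having at least its mark, and
the variable indices, which are written in unary. So its bit length serves for both kinds of
indices. -/
theorem fitsIn_clauseLists {L : List Clause} (hL : ∀ c ∈ L, c.pos.card + c.neg.card ≤ 3) :
    FitsIn (clauseLists L) (L.flatMap Clause.code).length.size where
  length_le := (length_clauseLists_le L).trans (Nat.lt_size_self _).le
  clause_length cl h := by
    obtain ⟨c, hc, rfl⟩ := List.mem_map.1 h
    rw [c.length_literals]
    exact hL c (List.mem_reverse.1 hc)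
  index_lt cl h l hl := by
    obtain ⟨c, hc, rfl⟩ := List.mem_map.1 h
    refine lt_trans ?_ (Nat.lt_size_self _)
    have h1 : l.2 + 1 ≤ (c.literals.map fun l => l.2 + 1).sum :=
      List.le_sum_of_mem (List.mem_map_of_mem hl)
    have h2 : c.code.length ≤ (L.flatMap Clause.code).length := by
      rw [List.length_flatMap]
      exact List.le_sum_of_mem (List.mem_map_of_mem (List.mem_reverse.1 hc))
    rw [c.length_code] at h2
    omega

theorem satisfiable_iff_clauseLists {F : CNF} {L : List Clause} (hL : ∀ c, c ∈ L ↔ c ∈ F) :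
    F.Satisfiable ↔ ∃ x : ℕ → Bool, ∀ cl ∈ clauseLists L, ∃ l ∈ cl, x l.2 = l.1 := by
  classical
  constructor
  · rintro ⟨τ, h⟩
    refine ⟨fun x => decide (τ x), fun cl hcl => ?_⟩
    obtain ⟨c, hc, rfl⟩ := List.mem_map.1 hcl
    rcases h c ((hL c).1 (List.mem_reverse.1 hc)) with ⟨x, hx, hτ⟩ | ⟨x, hx, hτ⟩
    · exact ⟨(true, x), Clause.mem_literals.2 (Or.inl ⟨rfl, hx⟩), by simpa using hτ⟩
    · exact ⟨(false, x), Clause.mem_literals.2 (Or.inr ⟨rfl, hx⟩), by simpa using hτ⟩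
  · rintro ⟨x, h⟩
    refine ⟨fun z => x z = true, fun c hc => ?_⟩
    obtain ⟨⟨b, z⟩, hl, hx⟩ := h c.literals
      (List.mem_map_of_mem (List.mem_reverse.2 ((hL c).2 hc)))
    rcases Clause.mem_literals.1 hl with ⟨rfl, hz⟩ | ⟨rfl, hz⟩
    · exact Or.inl ⟨z, hz, hx⟩
    · exact Or.inr ⟨z, hz, by simpa using hx⟩

/-! ### The number of clauses -/

theorem card_subsets_le (n : ℕ) :
    ((Finset.range n).powerset.filter fun s => s.card ≤ 3).card ≤ (n + 1) ^ 3 := by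
  have h1 : ((Finset.range n).powerset.filter fun s => s.card ≤ 3) ⊆
      (Finset.range 4).biUnion fun i => (Finset.range n).powersetCard i := by
    intro s hs
    rw [Finset.mem_filter, Finset.mem_powerset] at hs
    exact Finset.mem_biUnion.2 ⟨s.card, Finset.mem_range.2 (by omega),
      Finset.mem_powersetCard.2 ⟨hs.1, rfl⟩⟩
  refine (Finset.card_le_card h1).trans (Finset.card_biUnion_le.trans ?_)
  calc ∑ i ∈ Finset.range 4, ((Finset.range n).powersetCard i).card
      ≤ ∑ i ∈ Finset.range 4, n ^ i := Finset.sum_le_sum fun i _ => by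
        rw [Finset.card_powersetCard, Finset.card_range]
        exact Nat.choose_le_pow n i
    _ ≤ (n + 1) ^ 3 := by
        simp only [Finset.sum_range_succ, Finset.sum_range_zero]
        nlinarith [Nat.zero_le n, sq_nonneg n]

/-- A clause is a pair of sets of at most three of the `n` variables. -/
theorem card_le_of_mem_threeCNF {F : CNF} (hF : F ∈ threeCNF) :
    F.card ≤ (F.vars.card + 1) ^ 6 := by
  obtain ⟨h3, n, hn⟩ := hF
  rw [hn, Finset.card_range]
  set A := (Finset.range n).powerset.filter fun s => s.card ≤ 3
  have hA := card_subsets_le n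
  have h1 : ∀ c ∈ F, (c.pos, c.neg) ∈ A ×ˢ A := by
    intro c hc
    have hv : c.vars ⊆ Finset.range n := hn ▸ Finset.subset_biUnion_of_mem Clause.vars hc
    have := h3 c hc
    simp only [A, Finset.mem_product, Finset.mem_filter, Finset.mem_powerset]
    exact ⟨⟨Finset.subset_union_left.trans hv, by omega⟩,
      Finset.subset_union_right.trans hv, by omega⟩
  have h2 := Finset.card_le_card_of_injOn (s := F) (t := A ×ˢ A) (fun c => (c.pos, c.neg)) h1
    fun c _ c' _ h => Clause.ext (congrArg Prod.fst h) (congrArg Prod.snd h)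
  rw [Finset.card_product] at h2
  calc F.card ≤ A.card * A.card := h2
    _ ≤ (n + 1) ^ 3 * (n + 1) ^ 3 := Nat.mul_le_mul hA hA
    _ = (n + 1) ^ 6 := by ring

/-- A clause takes at most `1 + 3 * n` symbols, because the variables are named below `n`, and no
clause is repeated. This makes time polynomial in the input length polynomial in `n`, as ETH
demands. -/
theorem length_le_of_mem_codes {F : CNF} (hF : F ∈ threeCNF) {w : List CNFSymbol}
    (hw : w ∈ F.codes) : w.length ≤ 3 * (F.vars.card + 1) ^ 7 := by
  obtain ⟨L, hL, hLF, rfl⟩ := hw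
  have hcard := card_le_of_mem_threeCNF hF
  obtain ⟨h3, n, hn⟩ := hF
  rw [hn, Finset.card_range] at hcard ⊢
  have hlen : L.length = F.card := by
    classical
    rw [← List.toFinset_card_of_nodup hL]
    congr 1
    ext c
    simp [hLF]
  have hc : ∀ c ∈ L, c.code.length ≤ 3 * (n + 1) := by
    intro c hc
    have hc' := (hLF c).1 hc
    have hv : c.vars ⊆ Finset.range n := hn ▸ Finset.subset_biUnion_of_mem Clause.vars hc'
    have h1 := h3 c hc'
    rw [← c.length_literals] at h1
    rw [c.length_code]
    have h2 : (c.literals.map fun l => l.2 + 1).sum ≤ c.literals.length * n := by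
      refine (List.sum_le_card_nsmul _ n ?_).trans (by simp)
      intro i hi
      obtain ⟨⟨b, x⟩, hl, rfl⟩ := List.mem_map.1 hi
      have hx : x ∈ c.vars := by
        rcases Clause.mem_literals.1 hl with ⟨-, h⟩ | ⟨-, h⟩
        exacts [Finset.mem_union_left _ h, Finset.mem_union_right _ h]
      exact Finset.mem_range.1 (hv hx)
    have h4 : c.literals.length * n ≤ 3 * n := Nat.mul_le_mul_right _ h1
    omega
  rw [List.length_flatMap]
  refine (List.sum_le_card_nsmul _ (3 * (n + 1)) ?_).trans ?_
  · intro i hi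
    obtain ⟨c, h, rfl⟩ := List.mem_map.1 hi
    exact hc c h
  · rw [List.length_map, hlen, smul_eq_mul]
    calc F.card * (3 * (n + 1)) ≤ (n + 1) ^ 6 * (3 * (n + 1)) := Nat.mul_le_mul_right _ hcard
      _ = 3 * (n + 1) ^ 7 := by ring

/-! ### The time bound -/

/-- The constant `B` absorbs the finitely many arguments at which the little-o bound does not hold
yet. -/
theorem exists_le_mul_add {h : ℕ → ℝ} (hh : h =o[atTop] fun k : ℕ => (k : ℝ)) {ε : ℝ}
    (hε : 0 < ε) : ∃ B, ∀ k, h k ≤ ε * k + B := by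
  obtain ⟨K, hK⟩ := eventually_atTop.1 (isLittleO_iff.1 hh hε)
  refine ⟨∑ k ∈ Finset.range K, |h k|, fun k => ?_⟩
  have h0 : 0 ≤ ∑ k ∈ Finset.range K, |h k| := Finset.sum_nonneg fun _ _ => abs_nonneg _
  rcases le_or_gt K k with hk | hk
  · have := hK k hk
    rw [Real.norm_natCast, Real.norm_eq_abs] at this
    linarith [le_abs_self (h k)]
  · have := Finset.single_le_sum (f := fun k => |h k|) (fun _ _ => abs_nonneg _)
      (Finset.mem_range.2 hk)
    have h1 : 0 ≤ ε * k := by positivity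
    linarith [le_abs_self (h k)]

/-- The largest of the numbers `2 ^ h (7 + 4 * a)` for `a ≤ s`. -/
noncomputable def maxExp (h : ℕ → ℝ) (s : ℕ) : ℝ :=
  (Finset.range (s + 1)).sup' Finset.nonempty_range_add_one fun a => (2 : ℝ) ^ h (7 + 4 * a)

theorem le_maxExp (h : ℕ → ℝ) {s a : ℕ} (ha : a ≤ s) : (2 : ℝ) ^ h (7 + 4 * a) ≤ maxExp h s :=
  Finset.le_sup' (fun a => (2 : ℝ) ^ h (7 + 4 * a)) (Finset.mem_range.2 (by omega))

theorem maxExp_nonneg (h : ℕ → ℝ) (s : ℕ) : 0 ≤ maxExp h s :=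
  (Real.rpow_nonneg zero_le_two _).trans (le_maxExp h (Nat.zero_le s))

/-- The maximum over `a ≤ s n` is needed because the number of bits depends on the string, while the
bound in ETH is a function of `n`. With `h k ≤ ε * k + B`, each entry is at most a constant times
`(2 ^ s n) ^ (4 * ε)`, hence of order `n ^ (4 * ε * d)`. The choice `ε = 1 / (8 * (d + 1))` keeps
this exponent below `1 / 2`. -/
theorem maxExp_isLittleO {h : ℕ → ℝ} (hh : h =o[atTop] fun k : ℕ => (k : ℝ)) {s : ℕ → ℕ} {C : ℝ}
    {d : ℕ} (hC : 0 ≤ C) (hs : ∀ n : ℕ, (2 : ℝ) ^ s n ≤ C * (n + 1) ^ d) :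
    (fun n => maxExp h (s n)) =o[atTop] fun n : ℕ => (n : ℝ) := by
  obtain ⟨B, hB⟩ := exists_le_mul_add hh (ε := 1 / (8 * (d + 1))) (by positivity)
  set ε : ℝ := 1 / (8 * (d + 1)) with hε
  have hε0 : 0 < ε := by positivity
  obtain ⟨D, hD0, hD⟩ : ∃ D : ℝ, 0 ≤ D ∧ ∀ n : ℕ, maxExp h (s n) ≤ D * √(n + 1) := by
    refine ⟨2 ^ (7 * ε + B) * C ^ (4 * ε), by positivity, fun n => Finset.sup'_le _ _ fun a ha => ?_⟩
    have ha : a ≤ s n := by rw [Finset.mem_range] at ha; omega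
    have hn1 : (1 : ℝ) ≤ n + 1 := by linarith [Nat.cast_nonneg (α := ℝ) n]
    calc (2 : ℝ) ^ h (7 + 4 * a) ≤ 2 ^ ((7 * ε + B) + s n * (4 * ε)) := by
          refine Real.rpow_le_rpow_of_exponent_le one_le_two ((hB _).trans ?_)
          have h1 : (a : ℝ) ≤ s n := by exact_mod_cast ha
          push_cast
          nlinarith
      _ = 2 ^ (7 * ε + B) * ((2 : ℝ) ^ s n) ^ (4 * ε) := by
          rw [Real.rpow_add two_pos, Real.rpow_mul zero_le_two, Real.rpow_natCast]
      _ ≤ 2 ^ (7 * ε + B) * (C * (n + 1) ^ d) ^ (4 * ε) := by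
          have := hs n
          gcongr
      _ = 2 ^ (7 * ε + B) * C ^ (4 * ε) * ((n + 1 : ℝ) ^ d) ^ (4 * ε) := by
          rw [Real.mul_rpow hC (by positivity), mul_assoc]
      _ ≤ 2 ^ (7 * ε + B) * C ^ (4 * ε) * √(n + 1) := by
          refine mul_le_mul_of_nonneg_left ?_ (by positivity)
          rw [← Real.rpow_natCast, ← Real.rpow_mul (by positivity), Real.sqrt_eq_rpow]
          refine Real.rpow_le_rpow_of_exponent_le hn1 ?_
          rw [hε]
          field_simp
          linarith
  refine isLittleO_iff.2 fun c hc => ?_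
  -- From here on `D ^ 2 * (n + 1) ≤ 2 * D ^ 2 * n ≤ c ^ 2 * n ^ 2`.
  filter_upwards [eventually_ge_atTop (max 1 ⌈2 * D ^ 2 / c ^ 2⌉₊)] with n hn
  have hn1 : (1 : ℝ) ≤ n := by exact_mod_cast (le_max_left _ _).trans hn
  have hn2 : 2 * D ^ 2 / c ^ 2 ≤ n :=
    (Nat.le_ceil _).trans (by exact_mod_cast (le_max_right _ _).trans hn)
  rw [Real.norm_natCast, Real.norm_eq_abs, abs_of_nonneg (maxExp_nonneg _ _)]
  refine (hD n).trans (abs_le_of_sq_le_sq' ?_ (by positivity)).2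
  rw [mul_pow, Real.sq_sqrt (by positivity), mul_pow]
  rw [div_le_iff₀ (by positivity)] at hn2
  nlinarith [sq_nonneg D]

/-! ### The reduction -/

theorem two_pow_size_le (W : ℕ) : 2 ^ W.size ≤ 2 * W + 1 := by
  rcases h : W.size with _ | k
  · simp
  · have : 2 ^ k ≤ W := Nat.lt_size.1 (by omega)
    rw [Nat.pow_succ]
    omega

/-- The machine that computes the reduction and then runs `M`. -/
noncomputable def reductionMachine (M : Turing.TM2ComputableAux ProgramSymbol Bool) :
    Turing.TM2ComputableAux CNFSymbol Bool where
  tm := preMachine reductionProg Reg.inp Reg.out M.tm M.inputAlphabet.symm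
  inputAlphabet := Equiv.refl _
  outputAlphabet := M.outputAlphabet

theorem reductionMachine_outputs {M : Turing.TM2ComputableAux ProgramSymbol Bool}
    {w : List CNFSymbol} {v : List ProgramSymbol} {b : Bool} {t t' : ℕ}
    (h : Exec reductionProg (Function.update (fun r => ([] : List (RegAlphabet r))) Reg.inp w)
      (Function.update (fun r => ([] : List (RegAlphabet r))) Reg.out v.reverse) t)
    (hM : Nonempty (Turing.TM2OutputsInTime M.tm (v.map M.inputAlphabet.symm)
      (some ([b].map M.outputAlphabet.symm)) t')) :
    Nonempty (Turing.TM2OutputsInTime (reductionMachine M).tm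
      (w.map (reductionMachine M).inputAlphabet.symm)
      (some ([b].map (reductionMachine M).outputAlphabet.symm)) (t + (v.length + 1) + t')) := by
  have h1 := preMachine_outputs h (by rwa [List.reverse_reverse])
  rw [List.length_reverse] at h1
  have h2 : w.map (reductionMachine M).inputAlphabet.symm = w := List.map_id w
  exact h2.symm ▸ h1

theorem not_consistencyInDoubleExpTime (hETH : ETH) :
    ¬ ConsistencyInDoubleExpTime (shortPathPrograms 1) := by
  rintro ⟨M, f, p, hf, hM⟩
  obtain ⟨r, hr⟩ := exists_exec_reductionProg
  let s : ℕ → ℕ := fun n => (3 * (n + 1) ^ 7).size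
  let q : Polynomial ℕ := 3 * (.X + 1) ^ 7
  have hq : ∀ n, q.eval n = 3 * (n + 1) ^ 7 := fun n => by simp [q]
  -- The summand `2 * r.comp q + 1` pays for computing the program and for moving it. The program
  -- has `7 + 4 * a + 6 * 2 ^ a` atoms; for a string of length `W` one has `a ≤ W` and `2 ^ a ≤ 2 *
  -- W + 1`, so `16 * W + 19` is a safe bound.
  refine hETH ⟨reductionMachine M, fun n => maxExp f (s n),
    2 * r.comp q + 1 + p.comp (16 * q + 19), maxExp_isLittleO hf (C := 7) (d := 7) (by norm_num) ?_,
    ?_⟩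
  · intro n
    -- `2 ^ W.size ≤ 2 * W + 1` for `W = 3 * (n + 1) ^ 7`; the extra `1` is absorbed by one more
    -- power.
    have : 2 ^ s n ≤ 7 * (n + 1) ^ 7 := by
      have h1 := two_pow_size_le (3 * (n + 1) ^ 7)
      have h2 : 1 ≤ (n + 1) ^ 7 := Nat.one_le_pow _ _ (by omega)
      change 2 ^ (3 * (n + 1) ^ 7).size ≤ _
      omega
    exact_mod_cast this
  · intro F hF w hw
    have hlen := length_le_of_mem_codes hF hw
    set n := F.vars.card
    obtain ⟨L, hL, hLF, rfl⟩ := hw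
    have hfit := fitsIn_clauseLists (L := L) fun c hc => hF.1 c ((hLF c).1 hc)
    obtain ⟨h1, h2⟩ := hr (L.flatMap Clause.code) (clauseLists L) hfit.clause_length
      (reverse_flatMap_code L) hfit.length_le
    have hW : r.eval (L.flatMap Clause.code).length ≤ r.eval (q.eval n) :=
      eval_mono r (by rw [hq]; exact hlen)
    have hWq : (L.flatMap Clause.code).length ≤ q.eval n := by rw [hq]; exact hlen
    have hsize := two_pow_size_le (L.flatMap Clause.code).length
    have hsize' : (L.flatMap Clause.code).length.size ≤ (L.flatMap Clause.code).length :=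
      Nat.size_le.2 Nat.lt_two_pow_self
    have hs : (L.flatMap Clause.code).length.size ≤ s n := Nat.size_le_size hlen
    set a := (L.flatMap Clause.code).length.size
    obtain ⟨hdist, hP⟩ := dist_reduction a (clauseLists L)
    obtain ⟨b, t, hb, ht, hout⟩ := hM _ hP _ (flatMap_code_mem_codes hfit)
    beta_reduce at ht
    rw [hdist, atoms_reduction, Finset.card_range] at ht
    have hp : p.eval (1 + 2 * numVars a) ≤ p.eval (16 * q.eval n + 19) :=
      eval_mono p (by simp only [numVars]; omega)
    refine ⟨b, _, hb.trans ((consistent_reduction_iff hfit).trans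
      (satisfiable_iff_clauseLists hLF).symm), ?_,
      reductionMachine_outputs h1 hout⟩
    have hE : (2 : ℝ) ^ (2 : ℝ) ^ f (7 + 4 * a) ≤ 2 ^ maxExp f (s n) :=
      Real.rpow_le_rpow_of_exponent_le one_le_two (le_maxExp f hs)
    -- The exponential factor is at least one, so the polynomial cost of the reduction may be
    -- multiplied by it.
    have hE1 : 1 ≤ (2 : ℝ) ^ maxExp f (s n) :=
      Real.one_le_rpow one_le_two (maxExp_nonneg f (s n))
    have ht' : (t : ℝ) ≤ 2 ^ maxExp f (s n) * (p.eval (16 * q.eval n + 19) : ℕ) :=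
      ht.trans (mul_le_mul hE (by exact_mod_cast hp) (by positivity) (by positivity))
    have hsum : r.eval (L.flatMap Clause.code).length +
        ((rulesCode (listRules a (clauseLists L))).length + 1) ≤
        2 * r.eval (q.eval n) + 1 := by
      omega
    have hsum' : ((r.eval (L.flatMap Clause.code).length +
        ((rulesCode (listRules a (clauseLists L))).length + 1) : ℕ) : ℝ) ≤
        2 ^ maxExp f (s n) * (2 * r.eval (q.eval n) + 1 : ℕ) :=
      (Nat.cast_le.2 hsum).trans (le_mul_of_one_le_left (Nat.cast_nonneg _) hE1)
    have hev : Polynomial.eval n (2 * r.comp q + 1 + p.comp (16 * q + 19)) =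
        2 * r.eval (q.eval n) + 1 + p.eval (16 * q.eval n + 19) := by
      simp [Polynomial.eval_comp]
    rw [Nat.cast_add _ t]
    change _ ≤ (2 : ℝ) ^ maxExp f (s n) * (Polynomial.eval n _ : ℕ)
    rw [hev, Nat.cast_add (2 * _ + 1), mul_add]
    exact add_le_add hsum' ht'

theorem ConsistencyInDoubleExpTime.mono {C C' : Set (Program ℕ)} (hC : C' ⊆ C)
    (h : ConsistencyInDoubleExpTime C) : ConsistencyInDoubleExpTime C' := by
  obtain ⟨M, f, p, hf, hM⟩ := h
  exact ⟨M, f, p, hf, fun P hP => hM P (hC hP)⟩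

end ASP

/-- Under the Exponential Time Hypothesis, consistency of disjunctive programs cannot be decided in
time `2 ^ (2 ^ o(k)) * poly(|at(P)|)` for the distance `k` to almost paths of the incidence graph;
this still holds on programs whose largest path length is in `O(k)`. -/
theorem mainTheorem8 (hETH : ASP.ETH) :
    ¬ ASP.ConsistencyInDoubleExpTime ASP.programs ∧
      ∃ c : ℕ, ¬ ASP.ConsistencyInDoubleExpTime (ASP.shortPathPrograms c) := by
  have h := ASP.not_consistencyInDoubleExpTime hETH
  -- A decider for all programs decides the restricted ones, so hardness of the restriction, with `c
  -- = 1`, gives both claims.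
  exact ⟨fun h' => h (h'.mono fun _ hP => hP.1), 1, h⟩
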